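/- Let $h\in\mathbb R$, $h\neq0$. Fix one end of the lattice, $-\infty$ or $+\infty$. Let $\mathcal S$ be the space of real functions $u(n,x)$, $n\in\mathbb Z$, $x\in\mathbb R$, smooth in $x$, such that for all integers $j,p,k\ge 0$ the function $|x|^p|n|^k|\partial_x^j u(n,x)|$ is bounded on $\{n\le N\}\times\mathbb R$ for every $N\in\mathbb Z$ (respectively on $\{n\ge N\}\times\mathbb R$ for every $N$, if the end is $+\infty$). Let $(Ef)(n)=f(n+1)$, $\Delta=E-1$, and let formal pseudo-difference operators $\sum_{s\le N}f_s\Delta^s$ with function coefficients be multiplied by the rule $$\Delta^s g(n)=\sum_{i\ge 0}\binom{s}{i}\bigl(\Delta^i g(n+s-i)\bigr)\Delta^{s-i}\quad(s\in\mathbb Z);$$ $P_x$ is the coefficientwise $x$-derivative and $P_+$ the part with nonnegative powers of $\Delta$. For a functional $f$ of $u\in\mathcal S$ (with values in $\mathcal S$, or coefficientwise for operators) let $f'[g]=\frac{d}{d\varepsilon}f(u+\varepsilon g)|_{\varepsilon=0}$ (pointwise in $(n,x)$), and $[\![f,g]\!]=f'[g]-g'[f]$. **Theorem.** (i) There is exactly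 one sequence of functionals $u_j:\mathcal S\to\mathcal S$ ($j\ge 0$) with $u_0(u)=u$ such that $$L=h^{-1}\Delta+u_0+h u_1\Delta^{-1}+\dots+h^ju_j\Delta^{-j}+\cdots,\qquad A_1=h^{-1}\Delta+u$$ satisfy $L_x=[A_1,L]$ for every $u\in\mathcal S$. (ii) For each $m\ge1$ there is exactly one pair consisting of an operator $A_m=h^{-m}\Delta^m+\sum_{0\le s<m}a_s\Delta^s$, whose coefficients $a_s$ are functionals $\mathcal S\to\mathcal S$ vanishing at $u=0$, and a functional $\bar K_m:\mathcal S\to\mathcal S$, that satisfy the remaining compatibility conditions of the Lax triad $L\phi=\eta\phi$, $\phi_x=A_1\phi$, $\phi_t=A_m\phi$, $\eta_t=0$, namely $$L'[\bar K_m]=[A_m,L],\qquad \bar K_m-A_{m,x}+[A_1,A_m]=0 ;$$ moreover $A_m=(L^m)_+$. (iii) For each $m\ge1$ there is exactly one pair consisting of an operator $$B_m=h^{-(m-1)}x\Delta^m+h^{-(m-1)}(x+hn)\Delta^{m-1}+\sum_{0\le s\le m}b_s\Delta^s,$$ whose coefficients $b_s$ are functionals $\mathcal S\to\mathcal S$ vanishing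 at $u=0$, and a functional $\bar\sigma_m:\mathcal S\to\mathcal S$, that satisfy the remaining compatibility conditions of the Lax triad $L\phi=\eta\phi$, $\phi_x=A_1\phi$, $\phi_t=B_m\phi$, $\eta_t=h\eta^m+\eta^{m-1}$, namely $$L'[\bar\sigma_m]=[B_m,L]+hL^m+L^{m-1},\qquad \bar\sigma_m-B_{m,x}+[A_1,B_m]=0 .$$ (iv) Put $\bar K_0=\bar\sigma_0=0$. All flows $\bar K_m,\bar\sigma_m$ vanish at $u=0$ and have Gâteaux derivatives in $\mathcal S$ at every point of $\mathcal S$ in every direction of $\mathcal S$. The real linear span of all $\bar K_m$ and $\bar\sigma_m$ is closed under $[\![\cdot,\cdot]\!]$ and is a Lie algebra under it, and for all $l,r\ge1$ $$[\![\bar K_l,\bar K_r]\!]=0,\qquad [\![\bar K_l,\bar\sigma_r]\!]=l\,(h\bar K_{l+r-1}+\bar K_{l+r-2}),\qquad [\![\bar\sigma_l,\bar\sigma_r]\!]=(l-r)(h\bar\sigma_{l+r-1}+\bar\sigma_{l+r-2}).$$ -/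

import Mathlib

open scoped ContDiff

noncomputable section

namespace DDKP

/-! ### Functions of `(n, x)`, shift, difference, `x`-derivative -/

/-- Real functions `f n x` of a discrete variable `n` and a continuous variable `x`. -/
abbrev Coef := ℤ → ℝ → ℝ

/-- The shift `E ^ s`: `(E ^ s f)(n) = f (n + s)`. -/
def shift (s : ℤ) (f : Coef) : Coef := fun n x => f (n + s) x

/-- The difference `Δ f = E f - f`. -/
def diff (f : Coef) : Coef := shift 1 f - f

/-- The derivative with respect to `x`. -/
def dx (f : Coef) : Coef := fun n x => deriv (f n) x

/-- `u` is smooth in `x`, and `u` and all its `x`-derivatives are rapidly decreasing in `x` and in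
one direction of the lattice: as `n → -∞` if `side = 1`, and as `n → +∞` if `side = -1`. -/
def RapidlyDecreasing (side : ℤˣ) (u : Coef) : Prop :=
  (∀ n, ContDiff ℝ ∞ (u n)) ∧
    ∀ (j p k : ℕ) (N : ℤ), ∃ C : ℝ, ∀ (n : ℤ) (x : ℝ), (side : ℤ) * n ≤ N →
      |x| ^ p * |(n : ℝ)| ^ k * |iteratedDeriv j (u n) x| ≤ C

/-- The space of rapidly decreasing functions. Decay is asked on one side of the lattice only, so
that `Δ` has an inverse on this space: `Δ⁻¹ g (n) = ∑_{i < n} g i` for `side = 1`, and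
`Δ⁻¹ g (n) = - ∑_{i ≥ n} g i` for `side = -1`. -/
def S (side : ℤˣ) : Submodule ℝ Coef where
  carrier := {u | RapidlyDecreasing side u}
  zero_mem' := by
    refine ⟨fun n => contDiff_const, fun j p k N => ⟨0, fun n x _ => ?_⟩⟩
    have h0 : iteratedDeriv j ((0 : Coef) n) x = 0 := by
      change iteratedDeriv j (fun _ : ℝ => (0 : ℝ)) x = 0
      simp
    rw [h0]; simp
  add_mem' := by
    rintro u v ⟨hu, hu'⟩ ⟨hv, hv'⟩
    refine ⟨fun n => (hu n).add (hv n), fun j p k N => ?_⟩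
    obtain ⟨C, hC⟩ := hu' j p k N
    obtain ⟨D, hD⟩ := hv' j p k N
    refine ⟨C + D, fun n x hn => ?_⟩
    have h0 : iteratedDeriv j ((u + v) n) x
        = iteratedDeriv j (u n) x + iteratedDeriv j (v n) x :=
      iteratedDeriv_add ((hu n).contDiffAt.of_le (by exact_mod_cast le_top))
        ((hv n).contDiffAt.of_le (by exact_mod_cast le_top))
    rw [h0]
    calc _ ≤ |x| ^ p * |(n : ℝ)| ^ k *
          (|iteratedDeriv j (u n) x| + |iteratedDeriv j (v n) x|) := by
            gcongr; exact abs_add_le _ _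
      _ ≤ C + D := by rw [mul_add]; exact add_le_add (hC n x hn) (hD n x hn)
  smul_mem' := by
    rintro c u ⟨hu, hu'⟩
    refine ⟨fun n => (hu n).const_smul c, fun j p k N => ?_⟩
    obtain ⟨C, hC⟩ := hu' j p k N
    refine ⟨|c| * C, fun n x hn => ?_⟩
    have h0 : iteratedDeriv j ((c • u) n) x = c * iteratedDeriv j (u n) x :=
      iteratedDeriv_const_smul_field c (u n)
    rw [h0, abs_mul]
    calc _ = |c| * (|x| ^ p * |(n : ℝ)| ^ k * |iteratedDeriv j (u n) x|) := by ring
      _ ≤ |c| * C := by gcongr; exact hC n x hn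

/-! ### Pseudo-difference operators -/

/-- Formal pseudo-difference operators `∑_{s ≤ N} P_s Δ ^ s`, given by their coefficients `P_s`. -/
def PsiDO : Submodule ℝ (ℤ → Coef) where
  carrier := {P | ∃ N : ℤ, ∀ s, N < s → P s = 0}
  zero_mem' := ⟨0, fun _ _ => rfl⟩
  add_mem' := by
    rintro P Q ⟨N, hN⟩ ⟨M, hM⟩
    refine ⟨max N M, fun s hs => ?_⟩
    rw [Pi.add_apply, hN s ((le_max_left _ _).trans_lt hs), hM s ((le_max_right _ _).trans_lt hs),
      add_zero]
  smul_mem' := by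
    rintro c P ⟨N, hN⟩
    exact ⟨N, fun s hs => by rw [Pi.smul_apply, hN s hs, smul_zero]⟩

/-- The operator `f Δ ^ s`. -/
def monom (f : Coef) (s : ℤ) : PsiDO :=
  ⟨Pi.single s f, s, fun t ht => by simp [ht.ne']⟩

/-- The product of pseudo-difference operators, from the discrete Leibniz rule
`Δ ^ s ∘ g = ∑_{i ≥ 0} C(s, i) (Δ ^ i g (n + s - i)) Δ ^ (s - i)`, `s ∈ ℤ`. -/
def opMul (P Q : PsiDO) : PsiDO :=
  ⟨fun k => ∑ᶠ p : ℤ × ℕ, (Ring.choose p.1 p.2 : ℤ) •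
      (P.1 p.1 * diff^[p.2] (shift (p.1 - p.2) (Q.1 (k - p.1 + p.2)))), by
    obtain ⟨N, hN⟩ := P.2
    obtain ⟨M, hM⟩ := Q.2
    refine ⟨N + M, fun k hk => ?_⟩
    refine (finsum_congr fun p => ?_).trans finsum_zero
    rcases lt_or_ge N p.1 with h | h
    · rw [hN _ h, zero_mul, smul_zero]
    · rw [hM (k - p.1 + p.2) (by omega)]
      have h0 : ∀ i : ℕ, diff^[i] (0 : Coef) = 0 := by
        intro i
        induction i with
        | zero => rfl
        | succ i ih => rw [Function.iterate_succ_apply', ih]; exact sub_self _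
      have h1 : shift (p.1 - p.2) (0 : Coef) = 0 := rfl
      rw [h1, h0, mul_zero, smul_zero]⟩

/-- Powers of a pseudo-difference operator. -/
def opPow (P : PsiDO) : ℕ → PsiDO
  | 0 => monom 1 0
  | m + 1 => opMul (opPow P m) P

/-- The commutator. -/
def opComm (P Q : PsiDO) : PsiDO := opMul P Q - opMul Q P

/-- The part `P₊` with nonnegative powers of `Δ`. -/
def nonnegPart (P : PsiDO) : PsiDO :=
  ⟨fun s => if 0 ≤ s then P.1 s else 0, by
    obtain ⟨N, hN⟩ := P.2
    exact ⟨N, fun s hs => by simp [hN s hs]⟩⟩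

/-- The coefficientwise `x`-derivative `P_x`. -/
def opDx (P : PsiDO) : PsiDO :=
  ⟨fun s => dx (P.1 s), by
    obtain ⟨N, hN⟩ := P.2
    refine ⟨N, fun s hs => ?_⟩
    funext n x
    change deriv (P.1 s n) x = 0
    rw [hN s hs]
    exact deriv_const x (0 : ℝ)⟩

/-! ### Gâteaux derivatives and the Lie product -/

variable {side : ℤˣ}

/-- `d` is the Gâteaux derivative at `u`, in the direction `v`, of the functional `f`:
`d = (d/dε) f (u + ε v)` at `ε = 0`. -/
def HasGateauxDeriv (f : S side → S side) (u v d : S side) : Prop :=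
  ∀ (n : ℤ) (x : ℝ), HasDerivAt (fun ε : ℝ => (f (u + ε • v)).1 n x) (d.1 n x) 0

/-- `Q` is the (coefficientwise) Gâteaux derivative at `u`, in the direction `v`, of the
operator-valued functional `P`. -/
def HasOpGateauxDeriv (P : S side → PsiDO) (u v : S side) (Q : PsiDO) : Prop :=
  ∀ (s n : ℤ) (x : ℝ), HasDerivAt (fun ε : ℝ => (P (u + ε • v)).1 s n x) (Q.1 s n x) 0

/-- `f` has a Gâteaux derivative at every point in every direction. -/
def GateauxDifferentiable (f : S side → S side) : Prop :=
  ∀ u v, ∃ d, HasGateauxDeriv f u v d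

open Classical in
/-- The functional `f'[g]` (with value `0` where the derivative does not exist). -/
def gateaux (f g : S side → S side) : S side → S side := fun u =>
  if H : ∃ d, HasGateauxDeriv f u (g u) d then H.choose else 0

/-- The product `⟦f, g⟧ = f'[g] - g'[f]`. -/
def lieProd (f g : S side → S side) : S side → S side := gateaux f g - gateaux g f

/-- The linear space `X` is a Lie algebra under the product `br`. -/
structure IsLieAlgebraUnder {V : Type*} [AddCommGroup V] [Module ℝ V]
    (br : V → V → V) (X : Submodule ℝ V) : Prop where
  closed : ∀ f ∈ X, ∀ g ∈ X, br f g ∈ X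
  add_left : ∀ f₁ ∈ X, ∀ f₂ ∈ X, ∀ g ∈ X, br (f₁ + f₂) g = br f₁ g + br f₂ g
  smul_left : ∀ c : ℝ, ∀ f ∈ X, ∀ g ∈ X, br (c • f) g = c • br f g
  add_right : ∀ f ∈ X, ∀ g₁ ∈ X, ∀ g₂ ∈ X, br f (g₁ + g₂) = br f g₁ + br f g₂
  smul_right : ∀ c : ℝ, ∀ f ∈ X, ∀ g ∈ X, br f (c • g) = c • br f g
  self : ∀ f ∈ X, br f f = 0
  jacobi : ∀ f ∈ X, ∀ g ∈ X, ∀ k ∈ X, br (br f g) k + br (br g k) f + br (br k f) g = 0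

/-! ### Lax triads -/

/-- `L = h⁻¹ Δ + w₀ + h w₁ Δ⁻¹ + ⋯ + h ^ j w_j Δ ^ (-j) + ⋯`. -/
def laxOp (h : ℝ) (w : ℕ → S side) : PsiDO :=
  ⟨fun s => if s = 1 then fun _ _ => h⁻¹
      else if s ≤ 0 then h ^ (-s).toNat • (w (-s).toNat).1 else 0,
    1, fun s hs => by
      simp only [if_neg (show ¬ s = 1 by omega), if_neg (show ¬ s ≤ 0 by omega)]⟩

/-- `A₁ = h⁻¹ Δ + u`. -/
def opA₁ (h : ℝ) (u : S side) : PsiDO := monom (fun _ _ => h⁻¹) 1 + monom u.1 0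

/-- The functionals `w j = u_j (u)`, with `u₀ = u`, are such that the operator
`L = h⁻¹ Δ + ∑ h ^ j u_j Δ ^ (-j)` satisfies `L_x = [A₁, L]`. -/
def IsLaxCoefficients (h : ℝ) (w : ℕ → S side → S side) : Prop :=
  (∀ u, w 0 u = u) ∧
    ∀ u, opDx (laxOp h fun j => w j u) = opComm (opA₁ h u) (laxOp h fun j => w j u)

/-- `P = P (u)` differs from `P₀` by a difference operator `∑_{0 ≤ s < d} c_s(u) Δ ^ s` whose
coefficients are rapidly decreasing functions, and `P` equals `P₀` at `u = 0`. -/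
def IsDeformation (d : ℕ) (P₀ : PsiDO) (P : S side → PsiDO) : Prop :=
  (∀ u s, (P u).1 s - P₀.1 s ∈ S side) ∧
    (∀ u (s : ℤ), ¬ (0 ≤ s ∧ s < d) → (P u).1 s = P₀.1 s) ∧ P 0 = P₀

/-- The asymptotic operator `h ^ (-m) Δ ^ m`. -/
def asympA (h : ℝ) (m : ℕ) : PsiDO := monom (fun _ _ => (h ^ m)⁻¹) m

/-- The asymptotic operator `h ^ (-(m - 1)) x Δ ^ m + h ^ (-(m - 1)) (x + h n) Δ ^ (m - 1)`,
for `m ≥ 1`. -/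
def asympB (h : ℝ) (m : ℕ) : PsiDO :=
  monom (fun _ x => (h ^ (m - 1))⁻¹ * x) m +
    monom (fun n x => (h ^ (m - 1))⁻¹ * (x + h * n)) ((m : ℤ) - 1)

/-- The compatibility conditions of the Lax triad `L φ = η φ`, `φ_x = A₁ φ`, `φ_t = A φ` with
`η_t = 0`, where `u_t = K (u)` and `A = h ^ (-m) Δ ^ m + ∑_{0 ≤ s < m} c_s Δ ^ s`,
`A = h ^ (-m) Δ ^ m` at `u = 0`; the condition `L_x = [A₁, L]` is `IsLaxCoefficients`. -/
structure IsospectralTriad (h : ℝ) (w : ℕ → S side → S side) (m : ℕ)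
    (A : S side → PsiDO) (K : S side → S side) : Prop where
  form : IsDeformation m (asympA h m) A
  lax : ∀ u, HasOpGateauxDeriv (fun v => laxOp h fun j => w j v) u (K u)
    (opComm (A u) (laxOp h fun j => w j u))
  zero_curvature : ∀ u, monom (K u).1 0 - opDx (A u) + opComm (opA₁ h u) (A u) = 0

/-- The compatibility conditions of the Lax triad `L φ = η φ`, `φ_x = A₁ φ`, `φ_t = B φ` with
`η_t = h η ^ m + η ^ (m - 1)`, where `u_t = σ (u)`, `B = ∑_{0 ≤ s ≤ m} c_s Δ ^ s` and
`B = h ^ (-(m - 1)) x Δ ^ m + h ^ (-(m - 1)) (x + h n) Δ ^ (m - 1)` at `u = 0`; the condition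
`L_x = [A₁, L]` is `IsLaxCoefficients`. -/
structure NonisospectralTriad (h : ℝ) (w : ℕ → S side → S side) (m : ℕ)
    (B : S side → PsiDO) (σ : S side → S side) : Prop where
  form : IsDeformation (m + 1) (asympB h m) B
  lax : ∀ u, HasOpGateauxDeriv (fun v => laxOp h fun j => w j v) u (σ u)
    (opComm (B u) (laxOp h fun j => w j u) + h • opPow (laxOp h fun j => w j u) m
      + opPow (laxOp h fun j => w j u) (m - 1))
  zero_curvature : ∀ u, monom (σ u).1 0 - opDx (B u) + opComm (opA₁ h u) (B u) = 0

end DDKP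

end

open DDKP

noncomputable section
namespace DDKP

variable {side : ℤˣ}

/-! Let `cov` be the derivation P ↦ P_x - [A₁, P]. If P has order at most N, the coefficient of
Δ^(N+1) in `cov P` is -h⁻¹ Δ(P_N) (`cov_coeff_top`). Decay at one end of the lattice makes Δ
bijective on `S` (`eq_zero_of_diff_eq_zero`, `diff_invDiff`). So `cov P = R` has exactly one
solution with coefficients in `S`, found from the top coefficient downwards (`eq_zero_of_cov`,
`exists_cov_eq`). An operator killed by `cov` is thus determined by its coefficients modulo `S`, and
an identity in the kernel of `cov` holds once it holds modulo `S`.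

Two free operators are dressed in this way: `freeLax`, which is h⁻¹Δ, becomes L, and `freeC`, which
is xE + hn, becomes C. The free relation [xE + hn, h⁻¹Δ] = -(Δ + 1) gives [C, L] = -(hL + 1)
(`dressed_comm`), the source of η_t = hη^m + η^(m-1). For Q = L^m or Q = C L^(m-1), `cov Q = 0` says
that cov(Q₊) = -cov(Q - Q₊). One side has no negative powers, the other has order at most 0, so both
are multiplication by a function: the flow K (`exists_flow`). The operators L'[K] and [Q₊, L] - [Q,
L] have equal images under `cov`, whence the Lax equation (`Flow.lax`).

A difference operator over `S` whose image under `cov` has order at most 0 vanishes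
(`eq_zero_of_cov_mem_degLE_zero`). This makes A_m, B_m and the flows unique, and it makes flows
multiply like the free operators they come from (`Flow.bracket`), so the brackets reduce to
commutators of (h⁻¹Δ)^a and (xE + hn)(h⁻¹Δ)^b. All flows are polynomial functionals of u, so their
derivatives exist and are linear in the direction. The Lie algebra axioms are then transferred from
an explicit bracket on pairs of polynomials in η (`lieProd_modelMap`), without second derivatives of
functionals. -/

/-! ### The space `S` -/

/-- `f` decreases rapidly, without any condition on its derivatives. -/
def Decay (side : ℤˣ) (f : Coef) : Prop :=
  ∀ (p k : ℕ) (N : ℤ), ∃ C : ℝ, ∀ (n : ℤ) (x : ℝ), (side : ℤ) * n ≤ N →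
    |x| ^ p * |(n : ℝ)| ^ k * |f n x| ≤ C


theorem dx_iterate_apply (j : ℕ) (f : Coef) (n : ℤ) : dx^[j] f n = iteratedDeriv j (f n) := by
  induction j generalizing f with
  | zero => simp
  | succ j ih => rw [Function.iterate_succ_apply, ih, iteratedDeriv_succ']; rfl

theorem Decay.add {f g : Coef} (hf : Decay side f) (hg : Decay side g) : Decay side (f + g) := by
  intro p k N
  obtain ⟨C, hC⟩ := hf p k N
  obtain ⟨D, hD⟩ := hg p k N
  refine ⟨C + D, fun n x hn => ?_⟩
  calc _ ≤ |x| ^ p * |(n : ℝ)| ^ k * (|f n x| + |g n x|) := by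
        gcongr; exact abs_add_le _ _
    _ ≤ C + D := by rw [mul_add]; exact add_le_add (hC n x hn) (hD n x hn)

theorem Decay.smul {f : Coef} (c : ℝ) (hf : Decay side f) : Decay side (c • f) := by
  intro p k N
  obtain ⟨C, hC⟩ := hf p k N
  refine ⟨|c| * C, fun n x hn => ?_⟩
  calc _ = |c| * (|x| ^ p * |(n : ℝ)| ^ k * |f n x|) := by
        change _ * |c * f n x| = _
        rw [abs_mul]; ring
    _ ≤ |c| * C := by gcongr; exact hC n x hn

theorem Decay.mul {f g : Coef} (hf : Decay side f) (hg : Decay side g) : Decay side (f * g) := by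
  intro p k N
  obtain ⟨C, hC⟩ := hf p k N
  obtain ⟨D, hD⟩ := hg 0 0 N
  refine ⟨C * D, fun n x hn => ?_⟩
  have h1 := hC n x hn
  have h2 := hD n x hn
  simp only [pow_zero, one_mul] at h2
  calc _ = (|x| ^ p * |(n : ℝ)| ^ k * |f n x|) * |g n x| := by
        change _ * |f n x * g n x| = _
        rw [abs_mul]; ring
    _ ≤ C * D := mul_le_mul h1 h2 (abs_nonneg _) (le_trans (by positivity) h1)

theorem decay_of_mem {f : Coef} (hf : f ∈ S side) : Decay side f := fun p k N => by
  simpa using hf.2 0 p k N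

theorem differentiable_of_mem {f : Coef} (hf : f ∈ S side) (n : ℤ) : Differentiable ℝ (f n) :=
  (hf.1 n).differentiable (by simp)

theorem dx_mem {f : Coef} (hf : f ∈ S side) : dx f ∈ S side := by
  refine ⟨fun n => ?_, fun j p k N => ?_⟩
  · exact (contDiff_infty_iff_deriv.1 (hf.1 n)).2
  · obtain ⟨C, hC⟩ := hf.2 (j + 1) p k N
    refine ⟨C, fun n x hn => ?_⟩
    have := hC n x hn
    rwa [iteratedDeriv_succ'] at this

/-- A set of decreasing functions that is stable under `dx` lies in `S`. -/
theorem mem_of_dx_stable (M : Set Coef) (hd : ∀ f ∈ M, ∀ n, Differentiable ℝ (f n))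
    (hb : ∀ f ∈ M, Decay side f) (hdx : ∀ f ∈ M, dx f ∈ M) {f : Coef} (hf : f ∈ M) :
    f ∈ S side := by
  have key : ∀ j, dx^[j] f ∈ M := by
    intro j
    induction j with
    | zero => exact hf
    | succ j ih => rw [Function.iterate_succ_apply']; exact hdx _ ih
  refine ⟨fun n => ?_, fun j p k N => ?_⟩
  · refine contDiff_infty.2 fun m => ?_
    refine contDiff_of_differentiable_iteratedDeriv fun j _ => ?_
    rw [← dx_iterate_apply]
    exact hd _ (key j) n
  · obtain ⟨C, hC⟩ := hb _ (key j) p k N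
    refine ⟨C, fun n x hn => ?_⟩
    rw [← dx_iterate_apply]
    exact hC n x hn

theorem dx_zero : dx 0 = 0 := by
  funext n x
  exact deriv_const x (0 : ℝ)

theorem dx_add {f g : Coef} (hf : ∀ n, Differentiable ℝ (f n)) (hg : ∀ n, Differentiable ℝ (g n)) :
    dx (f + g) = dx f + dx g := by
  funext n x
  exact deriv_add (hf n x) (hg n x)

theorem dx_smul (c : ℝ) (f : Coef) : dx (c • f) = c • dx f := by
  funext n x
  exact deriv_const_smul_field c (f n)

theorem dx_mul {f g : Coef} (hf : ∀ n, Differentiable ℝ (f n)) (hg : ∀ n, Differentiable ℝ (g n)) :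
    dx (f * g) = dx f * g + f * dx g := by
  funext n x
  exact deriv_mul (hf n x) (hg n x)

/-- The derivative of a product is a sum of two products, so the stable set has to be the span of
the products. -/
theorem mul_mem {f g : Coef} (hf : f ∈ S side) (hg : g ∈ S side) : f * g ∈ S side := by
  let M : Submodule ℝ Coef := Submodule.span ℝ {a | ∃ f ∈ S side, ∃ g ∈ S side, f * g = a}
  have hd : ∀ f ∈ M, ∀ n, Differentiable ℝ (f n) := by
    intro f hf n
    induction hf using Submodule.span_induction with
    | mem a ha =>
      obtain ⟨f, hf, g, hg, rfl⟩ := ha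
      exact (differentiable_of_mem hf n).mul (differentiable_of_mem hg n)
    | zero => exact differentiable_const 0
    | add a b _ _ ha hb => exact ha.add hb
    | smul c a _ ha => exact ha.const_smul c
  refine mem_of_dx_stable (M : Set Coef) hd ?_ ?_ (Submodule.subset_span ⟨f, hf, g, hg, rfl⟩)
  · intro f hf
    induction hf using Submodule.span_induction with
    | mem a ha =>
      obtain ⟨f, hf, g, hg, rfl⟩ := ha
      exact (decay_of_mem hf).mul (decay_of_mem hg)
    | zero => exact decay_of_mem (S side).zero_mem
    | add a b _ _ ha hb => exact ha.add hb
    | smul c a _ ha => exact ha.smul c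
  · intro f hf
    induction hf using Submodule.span_induction with
    | mem a ha =>
      obtain ⟨f, hf, g, hg, rfl⟩ := ha
      rw [dx_mul (differentiable_of_mem hf) (differentiable_of_mem hg)]
      exact M.add_mem (Submodule.subset_span ⟨_, dx_mem hf, g, hg, rfl⟩)
        (Submodule.subset_span ⟨f, hf, _, dx_mem hg, rfl⟩)
    | zero => rw [SetLike.mem_coe, dx_zero]; exact M.zero_mem
    | add a b ha' hb' ha hb =>
      rw [SetLike.mem_coe, dx_add (hd a ha') (hd b hb')]; exact M.add_mem ha hb
    | smul c a _ ha => rw [SetLike.mem_coe, dx_smul]; exact M.smul_mem c ha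

/-- The function `(n, x) ↦ x`. -/
def coordX : Coef := fun _ x => x

/-- The function `(n, x) ↦ n`. -/
def coordN : Coef := fun n _ => n

theorem coordX_mul_mem {f : Coef} (hf : f ∈ S side) : coordX * f ∈ S side := by
  have hX : ∀ n, Differentiable ℝ (coordX n) := fun n => differentiable_id
  -- The summand g makes the set stable: (x f)' = x f' + f.
  refine mem_of_dx_stable {a | ∃ f ∈ S side, ∃ g ∈ S side, coordX * f + g = a} ?_ ?_ ?_
    ⟨f, hf, 0, (S side).zero_mem, add_zero _⟩
  · rintro _ ⟨f, hf, g, hg, rfl⟩ n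
    exact ((hX n).mul (differentiable_of_mem hf n)).add (differentiable_of_mem hg n)
  · rintro _ ⟨f, hf, g, hg, rfl⟩
    refine Decay.add (fun p k N => ?_) (decay_of_mem hg)
    obtain ⟨C, hC⟩ := decay_of_mem hf (p + 1) k N
    refine ⟨C, fun n x hn => (hC n x hn).trans' (le_of_eq ?_)⟩
    change _ * |x * f n x| = _
    rw [abs_mul]; ring
  · rintro _ ⟨f, hf, g, hg, rfl⟩
    refine ⟨dx f, dx_mem hf, f + dx g, (S side).add_mem hf (dx_mem hg), ?_⟩
    rw [dx_add (f := coordX * f) (fun n => (hX n).mul (differentiable_of_mem hf n)) (differentiable_of_mem hg),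
      dx_mul hX (differentiable_of_mem hf)]
    have : dx coordX = 1 := by funext n x; exact deriv_id x
    rw [this]; ring

theorem coordN_mul_mem {f : Coef} (hf : f ∈ S side) : coordN * f ∈ S side := by
  have hX : ∀ n, Differentiable ℝ (coordN n) := fun n => differentiable_const _
  refine mem_of_dx_stable {a | ∃ f ∈ S side, coordN * f = a} ?_ ?_ ?_ ⟨f, hf, rfl⟩
  · rintro _ ⟨f, hf, rfl⟩ n
    exact (hX n).mul (differentiable_of_mem hf n)
  · rintro _ ⟨f, hf, rfl⟩ p k N
    obtain ⟨C, hC⟩ := decay_of_mem hf p (k + 1) N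
    refine ⟨C, fun n x hn => (hC n x hn).trans' (le_of_eq ?_)⟩
    change _ * |(n : ℝ) * f n x| = _
    rw [abs_mul]; ring
  · rintro _ ⟨f, hf, rfl⟩
    refine ⟨dx f, dx_mem hf, ?_⟩
    rw [dx_mul hX (differentiable_of_mem hf)]
    have : dx coordN = 0 := by funext n x; exact deriv_const x (n : ℝ)
    rw [this]; ring

/-- Weights c + |n| absorb a change of n: a bound at a translated point can be compared with |n| at
the original one. -/
theorem Decay.add_pow {f : Coef} (hf : Decay side f) (c : ℝ) (hc : 0 ≤ c) (p k : ℕ) (N : ℤ) :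
    ∃ C : ℝ, ∀ (n : ℤ) (x : ℝ), (side : ℤ) * n ≤ N →
      |x| ^ p * (c + |(n : ℝ)|) ^ k * |f n x| ≤ C := by
  obtain ⟨C, hC⟩ := hf p 0 N
  obtain ⟨D, hD⟩ := hf p k N
  refine ⟨2 ^ (k - 1) * (c ^ k * C + D), fun n x hn => ?_⟩
  have h1 := hC n x hn
  have h2 := hD n x hn
  calc _ ≤ |x| ^ p * (2 ^ (k - 1) * (c ^ k + |(n : ℝ)| ^ k)) * |f n x| := by
        gcongr; exact add_pow_le hc (abs_nonneg _) k
    _ = 2 ^ (k - 1) * (c ^ k * (|x| ^ p * |(n : ℝ)| ^ 0 * |f n x|) +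
          |x| ^ p * |(n : ℝ)| ^ k * |f n x|) := by ring
    _ ≤ _ := by gcongr

theorem shift_mem {f : Coef} (s : ℤ) (hf : f ∈ S side) : shift s f ∈ S side := by
  refine mem_of_dx_stable {a | ∃ f ∈ S side, shift s f = a} ?_ ?_ ?_ ⟨f, hf, rfl⟩
  · rintro _ ⟨f, hf, rfl⟩ n
    exact differentiable_of_mem hf (n + s)
  · rintro _ ⟨f, hf, rfl⟩ p k N
    obtain ⟨C, hC⟩ := (decay_of_mem hf).add_pow |(s : ℝ)| (abs_nonneg _) p k (N + side * s)
    refine ⟨C, fun n x hn => (hC (n + s) x (by rw [mul_add]; omega)).trans' ?_⟩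
    have : |(n : ℝ)| ≤ |(s : ℝ)| + |((n + s : ℤ) : ℝ)| := by
      push_cast
      calc |(n : ℝ)| = |-(s : ℝ) + (n + s)| := by congr 1; ring
        _ ≤ _ := (abs_add_le _ _).trans (by rw [abs_neg])
    change _ * |f (n + s) x| ≤ _
    gcongr
  · rintro _ ⟨f, hf, rfl⟩
    exact ⟨dx f, dx_mem hf, rfl⟩

/-- Such an f does not depend on n, and |n| times a nonzero constant is unbounded on a half-lattice.
-/
theorem eq_zero_of_diff_eq_zero {f : Coef} (hf : f ∈ S side) (h0 : diff f = 0) : f = 0 := by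
  have h1 : ∀ n x, f (n + 1) x = f n x := fun n x => sub_eq_zero.1 (congrFun (congrFun h0 n) x)
  have h2 : ∀ n x, f n x = f 0 x := by
    intro n x
    induction n with
    | zero => rfl
    | succ n ih => rw [h1, ih]
    | pred n ih => rw [← ih, ← h1 (-(n : ℤ) - 1)]; congr 1; ring
  obtain ⟨C, hC⟩ := decay_of_mem hf 0 1 0
  funext n x
  rw [h2]
  by_contra hne
  have hpos : 0 < |f 0 x| := abs_pos.2 hne
  obtain ⟨m, hm⟩ := exists_nat_gt (C / |f 0 x|)
  rw [div_lt_iff₀ hpos] at hm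
  have h3 : (side : ℤ) * (-(side : ℤ) * m) ≤ 0 := by
    rcases Int.units_eq_one_or side with rfl | rfl <;> simp
  have h4 := hC _ x h3
  rw [h2] at h4
  have h5 : |((-(side : ℤ) * m : ℤ) : ℝ)| = m := by
    rcases Int.units_eq_one_or side with rfl | rfl <;> simp
  rw [h5] at h4
  simp only [pow_zero, one_mul, pow_one] at h4
  linarith

/-! ### Tail sums and the inverse of `Δ` on `S` -/

/-- `∑_{k ≥ 0} g (n - k)` for `side = 1`, and `∑_{k ≥ 0} g (n + k)` for `side = -1`. -/
def tailSum (side : ℤˣ) (g : Coef) : Coef := fun n x => ∑' k : ℕ, g (n - side * k) x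

theorem summable_inv_sq : Summable fun i : ℕ => 1 / (1 + (i : ℝ)) ^ 2 := by
  have := (summable_nat_add_iff 1).2 (Real.summable_one_div_nat_pow.2 (by norm_num : 1 < 2))
  refine this.congr fun i => ?_
  push_cast; rw [add_comm]

/-- Two extra powers of the lattice weight pay for the summable factor (1 + i)⁻², uniformly in n and
x. -/
theorem Decay.term_le {g : Coef} (hg : Decay side g) (p k : ℕ) (N : ℤ) : ∃ C : ℝ,
    ∀ (n : ℤ) (x : ℝ) (i : ℕ), (side : ℤ) * n ≤ N →
      |x| ^ p * |(n : ℝ)| ^ k * |g (n - side * i) x| ≤ C * (1 / (1 + (i : ℝ)) ^ 2) := by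
  obtain ⟨C, hC⟩ := hg.add_pow (1 + |(N : ℝ)|) (by positivity) p (k + 2) N
  refine ⟨C, fun n x i hn => ?_⟩
  have h0 : (side : ℤ) * (n - side * i) ≤ N := by
    rcases Int.units_eq_one_or side with rfl | rfl <;> simp at hn ⊢ <;> omega
  have h1 := hC _ x h0
  set m : ℤ := n - side * i with hm
  -- The point m lies i steps from n towards the decaying end, and n is at most N in that
  -- orientation, so m and N control both n and i.
  have h2 : |n| ≤ |m| + |N| ∧ (i : ℤ) ≤ |m| + |N| := by
    rcases Int.units_eq_one_or side with rfl | rfl <;> simp at hn hm <;>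
      rcases abs_cases n with h | h <;> rcases abs_cases m with h' | h' <;>
      rcases abs_cases N with h'' | h'' <;> omega
  have h3 : |(n : ℝ)| ≤ 1 + |(N : ℝ)| + |(m : ℝ)| := by
    have : |(n : ℝ)| ≤ |(m : ℝ)| + |(N : ℝ)| := by exact_mod_cast h2.1
    linarith
  have h4 : 1 + (i : ℝ) ≤ 1 + |(N : ℝ)| + |(m : ℝ)| := by
    have : (i : ℝ) ≤ |(m : ℝ)| + |(N : ℝ)| := by exact_mod_cast h2.2
    linarith
  rw [mul_one_div, le_div_iff₀ (by positivity)]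
  calc _ = |x| ^ p * (|(n : ℝ)| ^ k * (1 + (i : ℝ)) ^ 2) * |g m x| := by ring
    _ ≤ |x| ^ p * ((1 + |(N : ℝ)| + |(m : ℝ)|) ^ k * (1 + |(N : ℝ)| + |(m : ℝ)|) ^ 2) *
          |g m x| := by gcongr
    _ ≤ C := by rwa [← pow_add]

theorem Decay.norm_le {g : Coef} (hg : Decay side g) (n : ℤ) : ∃ C : ℝ,
    ∀ (i : ℕ) (x : ℝ), ‖g (n - side * i) x‖ ≤ C * (1 / (1 + (i : ℝ)) ^ 2) := by
  obtain ⟨C, hC⟩ := hg.term_le 0 0 (side * n)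
  exact ⟨C, fun i x => by simpa using hC n x i le_rfl⟩

theorem Decay.summable {g : Coef} (hg : Decay side g) (n : ℤ) (x : ℝ) :
    Summable fun i : ℕ => g (n - side * i) x := by
  obtain ⟨C, hC⟩ := hg.norm_le n
  exact Summable.of_norm_bounded (summable_inv_sq.mul_left C) fun i => hC i x

theorem hasDerivAt_tailSum {g : Coef} (hg : g ∈ S side) (n : ℤ) (x : ℝ) :
    HasDerivAt (tailSum side g n) (tailSum side (dx g) n x) x := by
  obtain ⟨C, hC⟩ := (decay_of_mem (dx_mem hg)).norm_le n
  exact hasDerivAt_tsum (summable_inv_sq.mul_left C)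
    (fun i y => (differentiable_of_mem hg _ y).hasDerivAt) hC ((decay_of_mem hg).summable n 0) x

theorem tailSum_mem {g : Coef} (hg : g ∈ S side) : tailSum side g ∈ S side := by
  refine mem_of_dx_stable {a | ∃ g ∈ S side, tailSum side g = a} ?_ ?_ ?_ ⟨g, hg, rfl⟩
  · rintro _ ⟨g, hg, rfl⟩ n x
    exact (hasDerivAt_tailSum hg n x).differentiableAt
  · rintro _ ⟨g, hg, rfl⟩ p k N
    obtain ⟨C, hC⟩ := (decay_of_mem hg).term_le p k N
    refine ⟨∑' i : ℕ, C * (1 / (1 + (i : ℝ)) ^ 2), fun n x hn => ?_⟩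
    have h1 : |tailSum side g n x| ≤ ∑' i : ℕ, |g (n - side * i) x| :=
      norm_tsum_le_tsum_norm ((decay_of_mem hg).summable n x).norm
    calc _ ≤ |x| ^ p * |(n : ℝ)| ^ k * ∑' i : ℕ, |g (n - side * i) x| := by gcongr
      _ = ∑' i : ℕ, |x| ^ p * |(n : ℝ)| ^ k * |g (n - side * i) x| := tsum_mul_left.symm
      _ ≤ _ := Summable.tsum_le_tsum (fun i => hC n x i hn)
        (((decay_of_mem hg).summable n x).abs.mul_left _) (summable_inv_sq.mul_left C)
  · rintro _ ⟨g, hg, rfl⟩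
    exact ⟨dx g, dx_mem hg, by funext n x; exact (hasDerivAt_tailSum hg n x).deriv.symm⟩

theorem tailSum_eq {g : Coef} (hg : Decay side g) (n : ℤ) (x : ℝ) :
    tailSum side g n x = g n x + tailSum side g (n - side) x := by
  unfold tailSum
  rw [(hg.summable n x).tsum_eq_zero_add]
  congr 1
  · simp
  · refine tsum_congr fun i => ?_
    congr 1; push_cast; ring

/-- The inverse of `diff` on `S side`. -/
def invDiff (side : ℤˣ) (g : Coef) : Coef :=
  -- The sum over i < n omits the term i = n, hence the shift; the sum over i ≥ n includes it.
  if side = 1 then shift (-1) (tailSum side g) else - tailSum side g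

theorem invDiff_mem {g : Coef} (hg : g ∈ S side) : invDiff side g ∈ S side := by
  unfold invDiff
  split_ifs
  · exact shift_mem _ (tailSum_mem hg)
  · exact (S side).neg_mem (tailSum_mem hg)

theorem diff_invDiff {g : Coef} (hg : g ∈ S side) : diff (invDiff side g) = g := by
  have h := tailSum_eq (decay_of_mem hg)
  funext n x
  rcases Int.units_eq_one_or side with rfl | rfl
  · change tailSum 1 g (n + 1 + -1) x - tailSum 1 g (n + -1) x = g n x
    have := h n x
    rw [add_neg_cancel_right, this]
    simp [sub_eq_add_neg]
  · have h1 : invDiff (-1) g = - tailSum (-1) g := if_neg (by decide)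
    rw [h1]
    change -tailSum (-1) g (n + 1) x - -tailSum (-1) g n x = g n x
    rw [h n x]
    simp

theorem shift_mul (s : ℤ) (f g : Coef) : shift s (f * g) = shift s f * shift s g := rfl
theorem shift_zero_left (f : Coef) : shift 0 f = f := by
  funext n x; simp [shift]
theorem shift_shift (s t : ℤ) (f : Coef) : shift s (shift t f) = shift (s + t) f := by
  funext n x; simp [shift, add_assoc]

/-- The shift as a linear map. -/
def shiftₗ (s : ℤ) : Coef →ₗ[ℝ] Coef where
  toFun := shift s
  map_add' _ _ := rfl
  map_smul' _ _ := rfl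

/-- The difference as a linear map. -/
def diffₗ : Coef →ₗ[ℝ] Coef := shiftₗ 1 - LinearMap.id

theorem diff_eq_diffₗ : diff = diffₗ := rfl

theorem diff_add (f g : Coef) : diff (f + g) = diff f + diff g := diffₗ.map_add f g
theorem diff_smul (c : ℝ) (f : Coef) : diff (c • f) = c • diff f := diffₗ.map_smul c f

theorem diff_iterate_eq (i : ℕ) : diff^[i] = ⇑(diffₗ ^ i) := by
  rw [Module.End.coe_pow]; rfl

theorem eq_of_diff_eq {f g : Coef} (hf : f ∈ S side) (hg : g ∈ S side) (h : diff f = diff g) :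
    f = g := by
  rw [← sub_eq_zero]
  refine eq_zero_of_diff_eq_zero ((S side).sub_mem hf hg) ?_
  rw [diff_eq_diffₗ] at h ⊢
  rw [map_sub, h, sub_self]

theorem invDiff_add {f g : Coef} (hf : f ∈ S side) (hg : g ∈ S side) :
    invDiff side (f + g) = invDiff side f + invDiff side g :=
  eq_of_diff_eq (invDiff_mem ((S side).add_mem hf hg))
    ((S side).add_mem (invDiff_mem hf) (invDiff_mem hg)) (by
      rw [diff_add, diff_invDiff hf, diff_invDiff hg, diff_invDiff ((S side).add_mem hf hg)])

theorem invDiff_smul (c : ℝ) {f : Coef} (hf : f ∈ S side) :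
    invDiff side (c • f) = c • invDiff side f :=
  eq_of_diff_eq (invDiff_mem ((S side).smul_mem c hf))
    ((S side).smul_mem c (invDiff_mem hf)) (by
      rw [diff_smul, diff_invDiff hf, diff_invDiff ((S side).smul_mem c hf)])

/-! ### Multipliers of `S` -/

/-- The functions, smooth in `x`, that multiply `S side` into itself. -/
def multipliers (side : ℤˣ) : Submodule ℝ Coef where
  carrier := {f | (∀ n, ContDiff ℝ ∞ (f n)) ∧ ∀ g ∈ S side, f * g ∈ S side}
  zero_mem' := ⟨fun _ => contDiff_const, fun g _ => by rw [zero_mul]; exact (S side).zero_mem⟩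
  add_mem' := fun hf hf' => ⟨fun n => (hf.1 n).add (hf'.1 n), fun g hg => by
    rw [add_mul]; exact (S side).add_mem (hf.2 g hg) (hf'.2 g hg)⟩
  smul_mem' := fun c f hf => ⟨fun n => (hf.1 n).const_smul c, fun g hg => by
    rw [smul_mul_assoc]; exact (S side).smul_mem c (hf.2 g hg)⟩

theorem S_le_multipliers : S side ≤ multipliers side :=
  fun _ hf => ⟨hf.1, fun _ hg => mul_mem hf hg⟩

theorem multipliers_mul_mem {f g : Coef} (hf : f ∈ multipliers side) (hg : g ∈ multipliers side) :
    f * g ∈ multipliers side :=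
  ⟨fun n => (hf.1 n).mul (hg.1 n), fun k hk => by
    rw [mul_assoc]; exact hf.2 _ (hg.2 _ hk)⟩

theorem differentiable_of_mem_multipliers {f : Coef} (hf : f ∈ multipliers side) (n : ℤ) :
    Differentiable ℝ (f n) := (hf.1 n).differentiable (by simp)

theorem multipliers_shift_mem {f : Coef} (s : ℤ) (hf : f ∈ multipliers side) :
    shift s f ∈ multipliers side := by
  refine ⟨fun n => hf.1 (n + s), fun g hg => ?_⟩
  have h := shift_mem s (hf.2 _ (shift_mem (-s) hg))
  rwa [shift_mul, shift_shift, add_neg_cancel, shift_zero_left] at h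

theorem const_mem_multipliers (c : ℝ) : (fun _ _ => c) ∈ multipliers side :=
  ⟨fun _ => contDiff_const, fun _ hg => (S side).smul_mem c hg⟩

/-- The free operator `freeC` has coefficients growing in x and n. They lie outside `S` but multiply
it into itself, which is all that later membership arguments need. -/
theorem coordX_mem : coordX ∈ multipliers side :=
  ⟨fun _ => contDiff_id, fun _ hg => coordX_mul_mem hg⟩

theorem coordN_mem : coordN ∈ multipliers side :=
  ⟨fun _ => contDiff_const, fun _ hg => coordN_mul_mem hg⟩

/-! ### The ring of pseudo-difference operators -/

/-- The coefficients of `Δ ^ s Q`. -/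
def dpow (s : ℤ) (Q : ℤ → Coef) : ℤ → Coef := fun k =>
  ∑ᶠ i : ℕ, (Ring.choose s i : ℤ) • diff^[i] (shift (s - i) (Q (k - s + i)))

theorem diff_iterate_zero (i : ℕ) : diff^[i] 0 = 0 := by
  rw [diff_iterate_eq, map_zero]

theorem shift_zsmul (s c : ℤ) (f : Coef) : shift s (c • f) = c • shift s f := rfl

theorem shift_diff_iterate (s : ℤ) (i : ℕ) (f : Coef) :
    shift s (diff^[i] f) = diff^[i] (shift s f) := by
  have h : Function.Commute (shift s) diff := fun f => by
    funext n x
    simp [diff, shift, add_right_comm]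
  exact (h.iterate_right i) f

/-- Terms with i > M + s - k use coefficients of Q above its order. The cutoff n stays free so that
different sums can be brought to matching ranges. -/
theorem dpow_eq_sum {Q : ℤ → Coef} {M : ℤ} (hQ : ∀ t, M < t → Q t = 0) {s k : ℤ} {n : ℕ}
    (hn : M + s - k < n) : dpow s Q k = ∑ i ∈ Finset.range n,
      (Ring.choose s i : ℤ) • diff^[i] (shift (s - i) (Q (k - s + i))) := by
  refine finsum_eq_sum_of_support_subset _ fun i hi => ?_
  rw [Finset.coe_range, Set.mem_Iio]
  by_contra hlt
  refine hi ?_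
  change _ • diff^[i] (shift _ (Q _)) = 0
  rw [hQ _ (by omega)]
  have : shift (s - i) (0 : Coef) = 0 := rfl
  rw [this, diff_iterate_zero, smul_zero]

theorem dpow_eq_zero {Q : ℤ → Coef} {M : ℤ} (hQ : ∀ t, M < t → Q t = 0) {s k : ℤ}
    (hk : M + s < k) : dpow s Q k = 0 := by
  rw [dpow_eq_sum hQ (n := 0) (by push_cast; omega), Finset.sum_range_zero]

theorem dpow_zero {Q : ℤ → Coef} {M : ℤ} (hQ : ∀ t, M < t → Q t = 0) : dpow 0 Q = Q := by
  funext k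
  rw [dpow_eq_sum hQ (n := (M - k).toNat + 1) (by push_cast; omega), Finset.sum_range_succ',
    Finset.sum_eq_zero]
  · simp [shift_zero_left]
  · intro i _
    rw [Ring.choose_zero_succ, zero_smul]

/-- This is Pascal's rule for generalized binomial coefficients, so it also covers negative s. -/
theorem dpow_succ {Q : ℤ → Coef} {M : ℤ} (hQ : ∀ t, M < t → Q t = 0) (s k : ℤ) :
    dpow (s + 1) Q k = shift 1 (dpow s Q (k - 1)) + diff (dpow s Q k) := by
  set n := (M + s - k).toNat + 1 with hn
  rw [dpow_eq_sum hQ (s := s + 1) (n := n + 1) (by push_cast; omega),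
    dpow_eq_sum hQ (k := k - 1) (n := n + 1) (by push_cast; omega),
    dpow_eq_sum hQ (s := s) (k := k) (n := n) (by omega)]
  have h1 : ∀ f, shift 1 f = shiftₗ 1 f := fun _ => rfl
  rw [diff_eq_diffₗ, h1, map_sum, map_sum, Finset.sum_range_succ', Finset.sum_range_succ' _ n,
    add_right_comm, ← Finset.sum_add_distrib]
  simp only [map_zsmul, ← h1, ← diff_eq_diffₗ, shift_zsmul, shift_diff_iterate, shift_shift,
    ← Function.iterate_succ_apply']
  congr 1
  · refine Finset.sum_congr rfl fun i _ => ?_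
    rw [Ring.choose_succ_succ, add_comm (Ring.choose s i), add_smul]
    have e1 : s + 1 - ((i + 1 : ℕ) : ℤ) = s - i := by push_cast; ring
    have e2 : k - (s + 1) + ((i + 1 : ℕ) : ℤ) = k - s + i := by push_cast; ring
    have e3 : k - 1 - s + ((i + 1 : ℕ) : ℤ) = k - s + i := by push_cast; ring
    have e4 : 1 + (s - ((i + 1 : ℕ) : ℤ)) = s - i := by push_cast; ring
    rw [e1, e2, e3, e4]
  · have e1 : s + 1 - ((0 : ℕ) : ℤ) = 1 + (s - ((0 : ℕ) : ℤ)) := by push_cast; ring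
    have e2 : k - (s + 1) + ((0 : ℕ) : ℤ) = k - 1 - s + ((0 : ℕ) : ℤ) := by push_cast; ring
    rw [e1, e2, Ring.choose_zero_right, Ring.choose_zero_right]

/-! ### Order, left multiplication by `Δ`, and associativity -/

/-- The operators of order at most `N`. -/
def degLE (N : ℤ) : Submodule ℝ PsiDO where
  carrier := {P | ∀ s, N < s → P.1 s = 0}
  zero_mem' := fun _ _ => rfl
  add_mem' := fun {P Q} hP hQ s hs => by
    change P.1 s + Q.1 s = 0
    rw [hP s hs, hQ s hs, add_zero]
  smul_mem' := fun c P hP s hs => by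
    change c • P.1 s = 0
    rw [hP s hs, smul_zero]

theorem degLE_mono {N M : ℤ} (h : N ≤ M) : degLE N ≤ degLE M :=
  fun _ hP s hs => hP s (h.trans_lt hs)

theorem exists_mem_degLE (P : PsiDO) : ∃ N, P ∈ degLE N := P.2

theorem exists_mem_degLE₂ (P Q : PsiDO) : ∃ N, P ∈ degLE N ∧ Q ∈ degLE N := by
  obtain ⟨N, hN⟩ := exists_mem_degLE P
  obtain ⟨M, hM⟩ := exists_mem_degLE Q
  exact ⟨max N M, degLE_mono (le_max_left _ _) hN, degLE_mono (le_max_right _ _) hM⟩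

theorem ext_coeff {P Q : PsiDO} (h : ∀ s, P.1 s = Q.1 s) : P = Q := Subtype.ext (funext h)

/-- Both orders being bounded, only finitely many s contribute. The ends a and b may be taken wider
than necessary, so that several products can be summed over one interval. -/
theorem opMul_coeff {P Q : PsiDO} {N M : ℤ} (hP : P ∈ degLE N) (hQ : Q ∈ degLE M) {k a b : ℤ}
    (ha : a ≤ k - M) (hb : N ≤ b) :
    (opMul P Q).1 k = ∑ s ∈ Finset.Icc a b, P.1 s * dpow s Q.1 k := by
  set n := (M + b - k).toNat + 1 with hn
  have h1 : (opMul P Q).1 k = ∑ p ∈ Finset.Icc a b ×ˢ Finset.range n,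
      (Ring.choose p.1 p.2 : ℤ) •
        (P.1 p.1 * diff^[p.2] (shift (p.1 - p.2) (Q.1 (k - p.1 + p.2)))) := by
    refine finsum_eq_sum_of_support_subset _ fun p hp => ?_
    rw [Finset.mem_coe, Finset.mem_product, Finset.mem_Icc, Finset.mem_range]
    have h2 : p.1 ≤ N := by
      by_contra hlt
      refine hp ?_
      change _ • (P.1 p.1 * _) = 0
      rw [hP _ (by omega), zero_mul, smul_zero]
    have h3 : k - p.1 + p.2 ≤ M := by
      by_contra hlt
      refine hp ?_
      change _ • (_ * diff^[p.2] (shift _ (Q.1 _))) = 0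
      rw [hQ _ (by omega)]
      have : shift (p.1 - p.2) (0 : Coef) = 0 := rfl
      rw [this, diff_iterate_zero, mul_zero, smul_zero]
    omega
  rw [h1, Finset.sum_product]
  refine Finset.sum_congr rfl fun s hs => ?_
  rw [Finset.mem_Icc] at hs
  rw [dpow_eq_sum hQ (n := n) (by omega), Finset.mul_sum]
  exact Finset.sum_congr rfl fun i _ => (mul_smul_comm _ _ _).symm

theorem opMul_mem_degLE {P Q : PsiDO} {N M : ℤ} (hP : P ∈ degLE N) (hQ : Q ∈ degLE M) :
    opMul P Q ∈ degLE (N + M) := by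
  intro k hk
  rw [opMul_coeff hP hQ (a := k - M) (b := N) le_rfl le_rfl, Finset.Icc_eq_empty (by omega),
    Finset.sum_empty]

theorem opMul_coeff_top {P Q : PsiDO} {N M : ℤ} (hP : P ∈ degLE N) (hQ : Q ∈ degLE M) :
    (opMul P Q).1 (N + M) = P.1 N * shift N (Q.1 M) := by
  rw [opMul_coeff hP hQ (a := N) (b := N) (by omega) le_rfl, Finset.Icc_self,
    Finset.sum_singleton, dpow_eq_sum hQ (n := 1) (by omega), Finset.sum_range_one]
  simp

/-- Left multiplication by `Δ`. -/
def deltaMul (Q : PsiDO) : PsiDO :=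
  ⟨fun k => shift 1 (Q.1 (k - 1)) + diff (Q.1 k), by
    obtain ⟨N, hN⟩ := Q.2
    refine ⟨N + 1, fun s hs => ?_⟩
    beta_reduce
    rw [hN _ (by omega), hN _ (by omega), diff_eq_diffₗ, map_zero, add_zero]
    rfl⟩

/-- The coefficient of ΔP at s + 1 is E(P_s) + Δ(P_{s+1}). Since E is invertible, P_s is recovered
by descending from the top. -/
theorem deltaMul_injective : Function.Injective deltaMul := by
  intro P Q h
  obtain ⟨N, hP, hQ⟩ := exists_mem_degLE₂ P Q
  have key : ∀ j : ℕ, ∀ s, N - j < s → P.1 s = Q.1 s := by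
    intro j
    induction j with
    | zero => intro s hs; rw [hP s (by simpa using hs), hQ s (by simpa using hs)]
    | succ j ih =>
      intro s hs
      rcases lt_or_ge (N - j) s with h1 | h1
      · exact ih s h1
      · have h2 : (deltaMul P).1 (s + 1) = (deltaMul Q).1 (s + 1) := by rw [h]
        change shift 1 (P.1 (s + 1 - 1)) + diff (P.1 (s + 1)) =
          shift 1 (Q.1 (s + 1 - 1)) + diff (Q.1 (s + 1)) at h2
        rw [ih (s + 1) (by push_cast at hs; omega), add_right_cancel_iff, add_sub_cancel_right] at h2
        have h3 := congrArg (shift (-1)) h2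
        rwa [shift_shift, shift_shift, neg_add_cancel, shift_zero_left, shift_zero_left] at h3
  exact ext_coeff fun s => key (N - s + 1).toNat s (by omega)

/-- `Δ ^ s Q` as an operator. -/
def dpowMul (s : ℤ) (Q : PsiDO) : PsiDO :=
  ⟨dpow s Q.1, by
    obtain ⟨M, hM⟩ := Q.2
    exact ⟨M + s, fun k hk => dpow_eq_zero hM hk⟩⟩

theorem dpowMul_mem_degLE {Q : PsiDO} {M : ℤ} (s : ℤ) (hQ : Q ∈ degLE M) :
    dpowMul s Q ∈ degLE (M + s) := fun _ hk => dpow_eq_zero hQ hk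

theorem dpowMul_succ (s : ℤ) (Q : PsiDO) : dpowMul (s + 1) Q = deltaMul (dpowMul s Q) := by
  obtain ⟨M, hM⟩ := exists_mem_degLE Q
  exact ext_coeff fun k => dpow_succ hM s k

theorem dpowMul_zero (Q : PsiDO) : dpowMul 0 Q = Q := by
  obtain ⟨M, hM⟩ := exists_mem_degLE Q
  exact Subtype.ext (dpow_zero hM)

/-- Termwise this is the twisted Leibniz rule Δ(fg) = (Ef)(Δg) + (Δf)g + (Δf)(Δg - Δg), that is,
(Ef)(Δg) + (Δf)g; what remains is a shift of the summation index. -/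
theorem deltaMul_opMul (P Q : PsiDO) : opMul (deltaMul P) Q = deltaMul (opMul P Q) := by
  obtain ⟨N, hP, hQ⟩ := exists_mem_degLE₂ P Q
  have hTP : deltaMul P ∈ degLE (N + 1) := fun s hs => by
    change shift 1 (P.1 (s - 1)) + diff (P.1 s) = 0
    rw [hP _ (by omega), hP _ (by omega), diff_eq_diffₗ, map_zero, add_zero]
    rfl
  refine ext_coeff fun k => ?_
  have h1 : ∀ f, shift 1 f = shiftₗ 1 f := fun _ => rfl
  change _ = shift 1 ((opMul P Q).1 (k - 1)) + diff ((opMul P Q).1 k)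
  rw [opMul_coeff hTP hQ (a := k - N - 1) (b := N + 1) (by omega) le_rfl,
    opMul_coeff hP hQ (a := k - N - 1) (b := N + 1) (by omega) (by omega),
    opMul_coeff hP hQ (a := k - N - 1) (b := N + 1) (by omega) (by omega)]
  have h2 : ∀ s, (deltaMul P).1 s * dpow s Q.1 k =
      shift 1 (P.1 (s - 1)) * dpow s Q.1 k + diff (P.1 s) * dpow s Q.1 k :=
    fun s => add_mul _ _ _
  have h3 : ∀ s, shift 1 (P.1 s * dpow s Q.1 (k - 1)) + diff (P.1 s * dpow s Q.1 k) =
      shift 1 (P.1 s) * dpow (s + 1) Q.1 k + diff (P.1 s) * dpow s Q.1 k := by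
    intro s
    rw [dpow_succ hQ]
    simp only [diff, shift_mul]
    ring
  have h6 : ∀ f g : ℤ → Coef, shift 1 (∑ s ∈ Finset.Icc (k - N - 1) (N + 1), f s) +
      diff (∑ s ∈ Finset.Icc (k - N - 1) (N + 1), g s) =
      ∑ s ∈ Finset.Icc (k - N - 1) (N + 1), (shift 1 (f s) + diff (g s)) := by
    intro f g
    rw [h1, diff_eq_diffₗ, map_sum, map_sum, ← Finset.sum_add_distrib]
    rfl
  rw [Finset.sum_congr rfl fun s _ => h2 s, h6, Finset.sum_congr rfl fun s _ => h3 s,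
    Finset.sum_add_distrib, Finset.sum_add_distrib]
  congr 1
  have h4 : ∀ s, s ∉ Finset.Icc (k - N) (N + 1) →
      shift 1 (P.1 (s - 1)) * dpow s Q.1 k = 0 := by
    intro s hs
    rw [Finset.mem_Icc, not_and_or, not_le, not_le] at hs
    rcases hs with hs | hs
    · rw [dpow_eq_zero hQ (by omega), mul_zero]
    · rw [hP _ (by omega)]; exact zero_mul _
  -- The terms outside the common subinterval vanish, so the interval can be moved up by one.
  have h5 : ∑ s ∈ Finset.Icc (k - N - 1) (N + 1), shift 1 (P.1 (s - 1)) * dpow s Q.1 k =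
      ∑ s ∈ Finset.Icc (k - N - 1 + 1) (N + 1 + 1), shift 1 (P.1 (s - 1)) * dpow s Q.1 k := 
    (Finset.sum_subset (s₁ := Finset.Icc (k - N) (N + 1))
      (Finset.Icc_subset_Icc (by omega) le_rfl) fun s _ hs => h4 s hs).symm.trans
      (Finset.sum_subset (Finset.Icc_subset_Icc (by omega) (by omega)) fun s _ hs => h4 s hs)
  rw [h5, ← Finset.map_add_right_Icc, Finset.sum_map]
  refine Finset.sum_congr rfl fun s _ => ?_
  simp

/-- Negative powers come from injectivity of left multiplication by Δ: applying Δ to both sides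
leads back to the preceding case. -/
theorem dpowMul_opMul (s : ℤ) (Q R : PsiDO) :
    opMul (dpowMul s Q) R = dpowMul s (opMul Q R) := by
  induction s with
  | zero => rw [dpowMul_zero, dpowMul_zero]
  | succ s ih => rw [dpowMul_succ, dpowMul_succ, deltaMul_opMul, ih]
  | pred s ih =>
    apply deltaMul_injective
    rw [← deltaMul_opMul, ← dpowMul_succ, ← dpowMul_succ, sub_add_cancel, ih]

/-- Expanding P in powers of Δ reduces associativity to Δ^s(QR) = (Δ^s Q)R. -/
theorem opMul_assoc (P Q R : PsiDO) : opMul (opMul P Q) R = opMul P (opMul Q R) := by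
  obtain ⟨N₁, hP, hQ⟩ := exists_mem_degLE₂ P Q
  obtain ⟨N₂, hR⟩ := exists_mem_degLE R
  refine ext_coeff fun k => ?_
  have hPQ := opMul_mem_degLE hP hQ
  have hQR := opMul_mem_degLE hQ hR
  -- One interval for the middle index must serve PQ and every Δ^s Q with s ≤ N₁; the terms |N₁|
  -- make it wide enough whatever the sign of N₁.
  set a := k - N₂ - N₁ - |N₁| with ha
  set b := N₁ + N₁ + |N₁| with hb
  have h0 := abs_cases N₁
  rw [opMul_coeff hPQ hR (a := a) (b := b) (by omega) (by omega),
    opMul_coeff hP hQR (a := k - (N₁ + N₂)) (b := N₁) le_rfl le_rfl]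
  have h1 : ∀ t ∈ Finset.Icc a b, (opMul P Q).1 t * dpow t R.1 k =
      ∑ s ∈ Finset.Icc (k - (N₁ + N₂)) N₁, P.1 s * (dpow s Q.1 t * dpow t R.1 k) := by
    intro t _
    rcases lt_or_ge t (k - N₂) with ht | ht
    · rw [dpow_eq_zero hR (by omega), mul_zero]
      simp
    · rw [opMul_coeff hP hQ (a := k - (N₁ + N₂)) (b := N₁) (by omega) le_rfl, Finset.sum_mul]
      exact Finset.sum_congr rfl fun s _ => mul_assoc _ _ _
  rw [Finset.sum_congr rfl h1, Finset.sum_comm]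
  refine Finset.sum_congr rfl fun s hs => ?_
  rw [Finset.mem_Icc] at hs
  rw [← Finset.mul_sum]
  congr 1
  have h2 := congrArg (fun X : PsiDO => X.1 k) (dpowMul_opMul s Q R)
  change _ = dpow s (opMul Q R).1 k at h2
  rw [← h2, opMul_coeff (dpowMul_mem_degLE s hQ) hR (a := a) (b := b) (by omega) (by omega)]
  rfl

theorem dpow_add {Q R : PsiDO} (s k : ℤ) :
    dpow s (Q + R).1 k = dpow s Q.1 k + dpow s R.1 k := by
  obtain ⟨N, hQ, hR⟩ := exists_mem_degLE₂ Q R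
  have hn : N + s - k < ((N + s - k).toNat + 1 : ℕ) := by push_cast; omega
  rw [dpow_eq_sum ((degLE N).add_mem hQ hR) hn, dpow_eq_sum hQ hn, dpow_eq_sum hR hn,
    ← Finset.sum_add_distrib]
  refine Finset.sum_congr rfl fun i _ => ?_
  rw [← smul_add, diff_iterate_eq, ← map_add]
  rfl

theorem opMul_add (P Q R : PsiDO) : opMul P (Q + R) = opMul P Q + opMul P R := by
  obtain ⟨N, hP⟩ := exists_mem_degLE P
  obtain ⟨M, hQ, hR⟩ := exists_mem_degLE₂ Q R
  refine ext_coeff fun k => ?_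
  change _ = (opMul P Q).1 k + (opMul P R).1 k
  rw [opMul_coeff hP ((degLE M).add_mem hQ hR) le_rfl le_rfl, opMul_coeff hP hQ le_rfl le_rfl,
    opMul_coeff hP hR le_rfl le_rfl, ← Finset.sum_add_distrib]
  exact Finset.sum_congr rfl fun s _ => by rw [dpow_add, mul_add]

theorem add_opMul (P Q R : PsiDO) : opMul (P + Q) R = opMul P R + opMul Q R := by
  obtain ⟨N, hP, hQ⟩ := exists_mem_degLE₂ P Q
  obtain ⟨M, hR⟩ := exists_mem_degLE R
  refine ext_coeff fun k => ?_
  change _ = (opMul P R).1 k + (opMul Q R).1 k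
  rw [opMul_coeff ((degLE N).add_mem hP hQ) hR le_rfl le_rfl, opMul_coeff hP hR le_rfl le_rfl,
    opMul_coeff hQ hR le_rfl le_rfl, ← Finset.sum_add_distrib]
  exact Finset.sum_congr rfl fun s _ => add_mul _ _ _

/-! ### Monomials and the ring structure -/

theorem monom_coeff_self (f : Coef) (s : ℤ) : (monom f s).1 s = f :=
  Pi.single_eq_same (M := fun _ : ℤ => Coef) s f

theorem monom_coeff_of_ne (f : Coef) {s t : ℤ} (h : t ≠ s) : (monom f s).1 t = 0 :=
  Pi.single_eq_of_ne (M := fun _ : ℤ => Coef) h f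

theorem monom_mem_degLE (f : Coef) (s : ℤ) : monom f s ∈ degLE s :=
  fun _ ht => monom_coeff_of_ne f ht.ne'

theorem monom_mul_coeff (f : Coef) (s : ℤ) (Q : PsiDO) (k : ℤ) :
    (opMul (monom f s) Q).1 k = f * dpow s Q.1 k := by
  obtain ⟨M, hQ⟩ := exists_mem_degLE Q
  rw [opMul_coeff (monom_mem_degLE f s) hQ (a := min s (k - M)) (min_le_right _ _) le_rfl,
    Finset.sum_eq_single_of_mem s (by simp), monom_coeff_self]
  intro t _ hts
  rw [monom_coeff_of_ne f hts, zero_mul]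

theorem one_opMul (P : PsiDO) : opMul (monom 1 0) P = P := by
  obtain ⟨N, hP⟩ := exists_mem_degLE P
  refine ext_coeff fun k => ?_
  rw [monom_mul_coeff, dpow_zero hP, one_mul]

theorem shift_const (s : ℤ) (c : ℝ) : shift s (fun _ _ => c) = fun _ _ => c := rfl

theorem diff_const (c : ℝ) : diff (fun _ _ => c) = 0 := by
  funext n x; exact sub_self c

theorem dpow_monom_const (s t : ℤ) (c : ℝ) :
    dpow s (monom (fun _ _ => c) t).1 = (monom (fun _ _ => c) (s + t)).1 := by
  funext k
  obtain ⟨N, hN⟩ : ∃ N : ℕ, t + s - k < N := ⟨(t + s - k).toNat + 1, by push_cast; omega⟩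
  rw [dpow_eq_sum (monom_mem_degLE _ t) (n := N + 1) (by push_cast; omega), Finset.sum_range_succ',
    Finset.sum_eq_zero]
  · rcases eq_or_ne k (s + t) with rfl | hk
    · rw [monom_coeff_self]
      have : s + t - s + ((0 : ℕ) : ℤ) = t := by push_cast; ring
      rw [this, monom_coeff_self]
      simp [shift_const]
    · rw [monom_coeff_of_ne _ hk, monom_coeff_of_ne _ (by push_cast; omega)]
      simp; rfl
  · intro i _
    rcases eq_or_ne (k - s + ((i + 1 : ℕ) : ℤ)) t with h | h
    · rw [h, monom_coeff_self, shift_const, Function.iterate_succ_apply, diff_const,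
        diff_iterate_zero, smul_zero]
    · rw [monom_coeff_of_ne _ h]
      have : shift (s - ((i + 1 : ℕ) : ℤ)) (0 : Coef) = 0 := rfl
      rw [this, diff_iterate_zero, smul_zero]

/-- Differences of constants vanish, so right multiplication by a constant-coefficient power only
rescales and moves the index. -/
theorem mul_monom_const_coeff (P : PsiDO) (c : ℝ) (t k : ℤ) :
    (opMul P (monom (fun _ _ => c) t)).1 k = c • P.1 (k - t) := by
  obtain ⟨N, hP⟩ := exists_mem_degLE P
  rw [opMul_coeff hP (monom_mem_degLE _ t) (b := max N (k - t)) le_rfl (le_max_left _ _),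
    Finset.sum_eq_single_of_mem (k - t) (by simp), dpow_monom_const]
  · rw [sub_add_cancel, monom_coeff_self, mul_comm]; rfl
  · intro s _ hs
    rw [dpow_monom_const, monom_coeff_of_ne _ (by omega), mul_zero]

theorem opMul_one (P : PsiDO) : opMul P (monom 1 0) = P := by
  refine ext_coeff fun k => ?_
  have := mul_monom_const_coeff P 1 0 k
  rwa [one_smul, sub_zero] at this

instance : Ring PsiDO where
  __ := (inferInstance : AddCommGroup PsiDO)
  mul := opMul
  one := monom 1 0
  mul_assoc := opMul_assoc
  one_mul := one_opMul
  mul_one := opMul_one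
  left_distrib := opMul_add
  right_distrib := add_opMul
  zero_mul P := by
    have h := add_opMul 0 0 P
    rw [add_zero] at h
    exact left_eq_add.1 h
  mul_zero P := by
    have h := opMul_add P 0 0
    rw [add_zero] at h
    exact left_eq_add.1 h

theorem one_eq_monom : (1 : PsiDO) = monom 1 0 := rfl

theorem opPow_eq (P : PsiDO) (m : ℕ) : opPow P m = P ^ m := by
  induction m with
  | zero => rw [pow_zero]; rfl
  | succ m ih => rw [pow_succ, ← ih]; rfl

theorem dpow_smul (c : ℝ) (Q : PsiDO) (s k : ℤ) : dpow s (c • Q).1 k = c • dpow s Q.1 k := by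
  obtain ⟨N, hQ⟩ := exists_mem_degLE Q
  have hn : N + s - k < ((N + s - k).toNat + 1 : ℕ) := by push_cast; omega
  rw [dpow_eq_sum ((degLE N).smul_mem c hQ) hn, dpow_eq_sum hQ hn, Finset.smul_sum]
  refine Finset.sum_congr rfl fun i _ => ?_
  rw [smul_comm, diff_iterate_eq, ← map_smul (diffₗ ^ i) c]
  rfl

instance : IsScalarTower ℝ PsiDO PsiDO where
  smul_assoc c P Q := by
    obtain ⟨N, hP⟩ := exists_mem_degLE P
    obtain ⟨M, hQ⟩ := exists_mem_degLE Q
    refine ext_coeff fun k => ?_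
    change (opMul (c • P) Q).1 k = c • (opMul P Q).1 k
    rw [opMul_coeff ((degLE N).smul_mem c hP) hQ le_rfl le_rfl, opMul_coeff hP hQ le_rfl le_rfl,
      Finset.smul_sum]
    exact Finset.sum_congr rfl fun s _ => smul_mul_assoc c _ _

instance : SMulCommClass ℝ PsiDO PsiDO where
  smul_comm c P Q := by
    obtain ⟨N, hP⟩ := exists_mem_degLE P
    obtain ⟨M, hQ⟩ := exists_mem_degLE Q
    refine ext_coeff fun k => ?_
    change c • (opMul P Q).1 k = (opMul P (c • Q)).1 k
    rw [opMul_coeff hP ((degLE M).smul_mem c hQ) le_rfl le_rfl, opMul_coeff hP hQ le_rfl le_rfl,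
      Finset.smul_sum]
    exact Finset.sum_congr rfl fun s _ => by rw [dpow_smul, mul_smul_comm]

theorem mul_mem_degLE {P Q : PsiDO} {N M : ℤ} (hP : P ∈ degLE N) (hQ : Q ∈ degLE M) :
    P * Q ∈ degLE (N + M) := opMul_mem_degLE hP hQ

/-! ### Difference operators and classes of coefficients -/

/-- The difference operators: no negative powers of `Δ`. -/
def nonneg : Submodule ℝ PsiDO where
  carrier := {P | ∀ s, s < 0 → P.1 s = 0}
  zero_mem' := fun _ _ => rfl
  add_mem' := fun {P Q} hP hQ s hs => by
    change P.1 s + Q.1 s = 0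
    rw [hP s hs, hQ s hs, add_zero]
  smul_mem' := fun c P hP s hs => by
    change c • P.1 s = 0
    rw [hP s hs, smul_zero]

/-- A negative power could only come from Δ^s g with i > s ≥ 0, where the binomial coefficient is
zero. -/
theorem mul_mem_nonneg {P Q : PsiDO} (hP : P ∈ nonneg) (hQ : Q ∈ nonneg) : P * Q ∈ nonneg := by
  intro k hk
  refine (finsum_congr fun p => ?_).trans finsum_zero
  rcases lt_or_ge p.1 0 with h | h
  · rw [hP _ h, zero_mul, smul_zero]
  · rcases lt_or_ge (k - p.1 + p.2) 0 with h' | h'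
    · rw [hQ _ h']
      have : shift (p.1 - p.2) (0 : Coef) = 0 := rfl
      rw [this, diff_iterate_zero, mul_zero, smul_zero]
    · obtain ⟨j, hj⟩ := Int.eq_ofNat_of_zero_le h
      have : Ring.choose p.1 p.2 = 0 := by
        rw [hj]
        have h1 := Ring.choose_natCast (R := ℤ) j p.2
        rw [Nat.choose_eq_zero_of_lt (by omega)] at h1
        exact_mod_cast h1
      rw [this, zero_smul]

theorem pow_mem_nonneg {P : PsiDO} (hP : P ∈ nonneg) (m : ℕ) : P ^ m ∈ nonneg := by
  induction m with
  | zero => rw [pow_zero]; exact fun s hs => monom_coeff_of_ne 1 hs.ne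
  | succ m ih => rw [pow_succ]; exact mul_mem_nonneg ih hP

theorem monom_mem_nonneg (f : Coef) {s : ℤ} (hs : 0 ≤ s) : monom f s ∈ nonneg :=
  fun _ ht => monom_coeff_of_ne f (ht.trans_le hs).ne

/-- The operators with coefficients in `M`. -/
def opsIn (M : Submodule ℝ Coef) : Submodule ℝ PsiDO where
  carrier := {P | ∀ s, P.1 s ∈ M}
  zero_mem' := fun _ => M.zero_mem
  add_mem' := fun hP hQ s => M.add_mem (hP s) (hQ s)
  smul_mem' := fun c _ hP s => M.smul_mem c (hP s)

theorem diff_iterate_mem {M : Submodule ℝ Coef} (hM : ∀ (s : ℤ), ∀ f ∈ M, shift s f ∈ M) (i : ℕ)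
    {f : Coef} (hf : f ∈ M) : diff^[i] f ∈ M := by
  induction i with
  | zero => exact hf
  | succ i ih => rw [Function.iterate_succ_apply']; exact M.sub_mem (hM 1 _ ih) ih

theorem mul_mem_opsIn {M₁ M₂ M₃ : Submodule ℝ Coef} (hmul : ∀ f ∈ M₁, ∀ g ∈ M₂, f * g ∈ M₃)
    (hM : ∀ (s : ℤ), ∀ f ∈ M₂, shift s f ∈ M₂) {P Q : PsiDO} (hP : P ∈ opsIn M₁)
    (hQ : Q ∈ opsIn M₂) : P * Q ∈ opsIn M₃ := by
  intro k
  refine finsum_induction (· ∈ M₃) M₃.zero_mem (fun _ _ => M₃.add_mem) fun p => ?_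
  exact zsmul_mem (hmul _ (hP _) _ (diff_iterate_mem hM _ (hM _ _ (hQ _)))) _

theorem monom_mem_opsIn {M : Submodule ℝ Coef} {f : Coef} (hf : f ∈ M) (s : ℤ) :
    monom f s ∈ opsIn M := by
  intro t
  rcases eq_or_ne t s with rfl | h
  · rwa [monom_coeff_self]
  · rw [monom_coeff_of_ne f h]; exact M.zero_mem

theorem opsIn_mono {M₁ M₂ : Submodule ℝ Coef} (h : M₁ ≤ M₂) : opsIn M₁ ≤ opsIn M₂ :=
  fun _ hP s => h (hP s)

/-! ### Derivatives of products of operators -/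

section Derivative

variable {ξ : ℝ → ℝ} {t₀ : ℝ}

/-- The moving point ξ serves two derivatives at once: the x-derivative (ξ the identity, operators
fixed) and the Gâteaux derivative (ξ constant, operators varying). -/
theorem hasDerivAt_diff_iterate {f : ℝ → Coef} {f' : Coef} (i : ℕ)
    (hf : ∀ n, HasDerivAt (fun t => f t n (ξ t)) (f' n (ξ t₀)) t₀) (n : ℤ) :
    HasDerivAt (fun t => diff^[i] (f t) n (ξ t)) (diff^[i] f' n (ξ t₀)) t₀ := by
  induction i generalizing n with
  | zero => exact hf n
  | succ i ih =>
    simp only [Function.iterate_succ_apply']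
    exact (ih (n + 1)).sub (ih n)

theorem hasDerivAt_dpow {Q : ℝ → PsiDO} {Q' : PsiDO} {M : ℤ} (hQ : ∀ t, Q t ∈ degLE M)
    (hQ' : Q' ∈ degLE M)
    (dQ : ∀ s n, HasDerivAt (fun t => (Q t).1 s n (ξ t)) (Q'.1 s n (ξ t₀)) t₀) (s k n : ℤ) :
    HasDerivAt (fun t => dpow s (Q t).1 k n (ξ t)) (dpow s Q'.1 k n (ξ t₀)) t₀ := by
  have hm : M + s - k < ((M + s - k).toNat + 1 : ℕ) := by push_cast; omega
  simp only [fun t => dpow_eq_sum (hQ t) hm, dpow_eq_sum hQ' hm, Finset.sum_apply,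
    zsmul_eq_mul]
  refine HasDerivAt.fun_sum fun i _ => HasDerivAt.const_mul _ ?_
  exact hasDerivAt_diff_iterate (f := fun t => shift (s - i) ((Q t).1 (k - s + i))) i
    (fun n => dQ (k - s + i) (n + (s - i))) n

theorem hasDerivAt_mul {P Q : ℝ → PsiDO} {P' Q' : PsiDO} {N M : ℤ} (hP : ∀ t, P t ∈ degLE N)
    (hP' : P' ∈ degLE N) (hQ : ∀ t, Q t ∈ degLE M) (hQ' : Q' ∈ degLE M)
    (dP : ∀ s n, HasDerivAt (fun t => (P t).1 s n (ξ t)) (P'.1 s n (ξ t₀)) t₀)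
    (dQ : ∀ s n, HasDerivAt (fun t => (Q t).1 s n (ξ t)) (Q'.1 s n (ξ t₀)) t₀) (k n : ℤ) :
    HasDerivAt (fun t => (P t * Q t).1 k n (ξ t)) ((P' * Q t₀ + P t₀ * Q').1 k n (ξ t₀)) t₀ := by
  have h1 : ∀ {R T : PsiDO}, R ∈ degLE N → T ∈ degLE M → (R * T).1 k =
      ∑ s ∈ Finset.Icc (k - M) N, R.1 s * dpow s T.1 k :=
    fun hR hT => opMul_coeff hR hT le_rfl le_rfl
  have h2 : (P' * Q t₀ + P t₀ * Q').1 k = (P' * Q t₀).1 k + (P t₀ * Q').1 k := rfl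
  simp only [fun t => h1 (hP t) (hQ t), h2, h1 hP' (hQ t₀), h1 (hP t₀) hQ', Finset.sum_apply,
    Pi.add_apply, Pi.mul_apply, ← Finset.sum_add_distrib]
  exact HasDerivAt.fun_sum fun s _ => (dP s n).mul (hasDerivAt_dpow hQ hQ' dQ s k n)

end Derivative

theorem opDx_mem_degLE {P : PsiDO} {N : ℤ} (hP : P ∈ degLE N) : opDx P ∈ degLE N := by
  intro s hs
  change dx (P.1 s) = 0
  rw [hP s hs, dx_zero]

theorem opDx_mem_nonneg {P : PsiDO} (hP : P ∈ nonneg) : opDx P ∈ nonneg := by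
  intro s hs
  change dx (P.1 s) = 0
  rw [hP s hs, dx_zero]

theorem opDx_add {P Q : PsiDO} (hP : P ∈ opsIn (multipliers side))
    (hQ : Q ∈ opsIn (multipliers side)) : opDx (P + Q) = opDx P + opDx Q :=
  ext_coeff fun s => dx_add (differentiable_of_mem_multipliers (hP s))
    (differentiable_of_mem_multipliers (hQ s))

theorem opDx_smul (c : ℝ) (P : PsiDO) : opDx (c • P) = c • opDx P :=
  ext_coeff fun s => dx_smul c (P.1 s)

theorem opDx_sub {P Q : PsiDO} (hP : P ∈ opsIn (multipliers side))
    (hQ : Q ∈ opsIn (multipliers side)) : opDx (P - Q) = opDx P - opDx Q := by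
  have h : ∀ R : PsiDO, -R = (-1 : ℝ) • R := fun R => (neg_one_smul ℝ R).symm
  rw [sub_eq_add_neg, h, opDx_add hP (Submodule.smul_mem _ _ hQ), opDx_smul, ← h, sub_eq_add_neg]

theorem opDx_monom (f : Coef) (s : ℤ) : opDx (monom f s) = monom (dx f) s := by
  refine ext_coeff fun t => ?_
  change dx ((monom f s).1 t) = _
  rcases eq_or_ne t s with rfl | h
  · rw [monom_coeff_self, monom_coeff_self]
  · rw [monom_coeff_of_ne f h, monom_coeff_of_ne _ h, dx_zero]

theorem opDx_mul {P Q : PsiDO} (hP : P ∈ opsIn (multipliers side))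
    (hQ : Q ∈ opsIn (multipliers side)) : opDx (P * Q) = opDx P * Q + P * opDx Q := by
  obtain ⟨N, hPN, hQN⟩ := exists_mem_degLE₂ P Q
  refine ext_coeff fun k => ?_
  funext n x
  exact (hasDerivAt_mul (ξ := id) (t₀ := x) (fun _ => hPN) (opDx_mem_degLE hPN) (fun _ => hQN)
    (opDx_mem_degLE hQN)
    (fun s n => (differentiable_of_mem_multipliers (hP s) n x).hasDerivAt)
    (fun s n => (differentiable_of_mem_multipliers (hQ s) n x).hasDerivAt) k n).deriv

theorem multipliers_mul_mem_S {f g : Coef} (hf : f ∈ multipliers side) (hg : g ∈ S side) :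
    f * g ∈ S side := hf.2 g hg

theorem mul_multipliers_mem_S {f g : Coef} (hf : f ∈ S side) (hg : g ∈ multipliers side) :
    f * g ∈ S side := by
  rw [mul_comm]
  exact hg.2 f hf

theorem mul_mem_opsIn_multipliers {P Q : PsiDO} (hP : P ∈ opsIn (multipliers side))
    (hQ : Q ∈ opsIn (multipliers side)) : P * Q ∈ opsIn (multipliers side) :=
  mul_mem_opsIn (fun _ hf _ hg => multipliers_mul_mem hf hg)
    (fun s _ hf => multipliers_shift_mem s hf) hP hQ

theorem mul_mem_opsIn_S_right {P Q : PsiDO} (hP : P ∈ opsIn (multipliers side))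
    (hQ : Q ∈ opsIn (S side)) : P * Q ∈ opsIn (S side) :=
  mul_mem_opsIn (fun _ hf _ hg => multipliers_mul_mem_S hf hg)
    (fun s _ hf => shift_mem s hf) hP hQ

theorem mul_mem_opsIn_S_left {P Q : PsiDO} (hP : P ∈ opsIn (S side))
    (hQ : Q ∈ opsIn (multipliers side)) : P * Q ∈ opsIn (S side) :=
  mul_mem_opsIn (fun _ hf _ hg => mul_multipliers_mem_S hf hg)
    (fun s _ hf => multipliers_shift_mem s hf) hP hQ

/-! ### Polynomial functionals -/

/-- The polynomial functions of two real parameters with coefficients in `M`. -/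
def polyCurves (M : Submodule ℝ Coef) : Submodule ℝ (ℝ × ℝ → Coef) :=
  Submodule.span ℝ {p | ∃ (i j : ℕ), ∃ a ∈ M, p = fun θ => (θ.1 ^ i * θ.2 ^ j) • a}

/-- `T` is linear on `M`. -/
structure LinearOn (M : Submodule ℝ Coef) (T : Coef → Coef) : Prop where
  add : ∀ a ∈ M, ∀ b ∈ M, T (a + b) = T a + T b
  smul : ∀ c : ℝ, ∀ a ∈ M, T (c • a) = c • T a

theorem LinearOn.of_linearMap (M : Submodule ℝ Coef) (T : Coef →ₗ[ℝ] Coef) : LinearOn M T :=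
  ⟨fun a _ b _ => T.map_add a b, fun c a _ => T.map_smul c a⟩

theorem linearOn_dx : LinearOn (S side) dx :=
  ⟨fun _ ha _ hb => dx_add (differentiable_of_mem ha) (differentiable_of_mem hb),
    fun c a _ => dx_smul c a⟩

theorem linearOn_invDiff : LinearOn (S side) (invDiff side) :=
  ⟨fun _ ha _ hb => invDiff_add ha hb, fun c _ ha => invDiff_smul c ha⟩

theorem LinearOn.zero {M : Submodule ℝ Coef} {T : Coef → Coef} (hT : LinearOn M T) : T 0 = 0 := by
  simpa using hT.smul 0 0 M.zero_mem

section polyCurves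

variable {M : Submodule ℝ Coef} {p : ℝ × ℝ → Coef}

theorem polyCurves_apply_mem (hp : p ∈ polyCurves M) (θ : ℝ × ℝ) : p θ ∈ M := by
  induction hp using Submodule.span_induction with
  | mem p hp => obtain ⟨i, j, a, ha, rfl⟩ := hp; exact M.smul_mem _ ha
  | zero => exact M.zero_mem
  | add p q _ _ hp hq => exact M.add_mem hp hq
  | smul c p _ hp => exact M.smul_mem c hp

theorem monomial_mem_polyCurves (i j : ℕ) {a : Coef} (ha : a ∈ M) :
    (fun θ : ℝ × ℝ => (θ.1 ^ i * θ.2 ^ j) • a) ∈ polyCurves M :=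
  Submodule.subset_span ⟨i, j, a, ha, rfl⟩

theorem polyCurves_map {M' : Submodule ℝ Coef} {T : Coef → Coef} (hT : LinearOn M T)
    (hM : ∀ a ∈ M, T a ∈ M') (hp : p ∈ polyCurves M) : (fun θ => T (p θ)) ∈ polyCurves M' := by
  induction hp using Submodule.span_induction with
  | mem p hp =>
    obtain ⟨i, j, a, ha, rfl⟩ := hp
    simp only [hT.smul _ a ha]
    exact monomial_mem_polyCurves i j (hM a ha)
  | zero =>
    have : (fun θ => T ((0 : ℝ × ℝ → Coef) θ)) = 0 := funext fun _ => hT.zero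
    rw [this]; exact Submodule.zero_mem _
  | add p q hp' hq' hp hq =>
    have : (fun θ => T ((p + q) θ)) = (fun θ => T (p θ)) + fun θ => T (q θ) :=
      funext fun θ => hT.add _ (polyCurves_apply_mem hp' θ) _ (polyCurves_apply_mem hq' θ)
    rw [this]; exact Submodule.add_mem _ hp hq
  | smul c p hp' hp =>
    have : (fun θ => T ((c • p) θ)) = c • fun θ => T (p θ) :=
      funext fun θ => hT.smul c _ (polyCurves_apply_mem hp' θ)
    rw [this]; exact Submodule.smul_mem _ c hp

theorem polyCurves_mul {M' M'' : Submodule ℝ Coef} (hM : ∀ a ∈ M, ∀ b ∈ M', a * b ∈ M'')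
    {q : ℝ × ℝ → Coef} (hp : p ∈ polyCurves M) (hq : q ∈ polyCurves M') :
    p * q ∈ polyCurves M'' := by
  induction hp, hq using Submodule.span_induction₂ with
  | mem_mem p q hp hq =>
    obtain ⟨i, j, a, ha, rfl⟩ := hp
    obtain ⟨k, l, b, hb, rfl⟩ := hq
    refine Submodule.subset_span ⟨i + k, j + l, a * b, hM a ha b hb, funext fun θ => ?_⟩
    change (_ • a) * (_ • b) = _
    rw [smul_mul_smul_comm]
    congr 1; ring
  | zero_left q _ => rw [zero_mul]; exact Submodule.zero_mem _
  | zero_right p _ => rw [mul_zero]; exact Submodule.zero_mem _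
  | add_left p q r _ _ _ h1 h2 => rw [add_mul]; exact Submodule.add_mem _ h1 h2
  | add_right p q r _ _ _ h1 h2 => rw [mul_add]; exact Submodule.add_mem _ h1 h2
  | smul_left c p q _ _ h => rw [smul_mul_assoc]; exact Submodule.smul_mem _ c h
  | smul_right c p q _ _ h => rw [mul_smul_comm]; exact Submodule.smul_mem _ c h

/-- The first-order coefficients a and b are chosen before T, so one derivative works for every
linear T; with T = `dx` this says that it commutes with the x-derivative. -/
theorem polyCurves_hasDerivAt (hp : p ∈ polyCurves M) : ∃ a ∈ M, ∃ b ∈ M,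
    ∀ T, LinearOn M T → ∀ (c d : ℝ) (n : ℤ) (x : ℝ),
      HasDerivAt (fun t : ℝ => T (p (t * c, t * d)) n x) (T (c • a + d • b) n x) 0 := by
  induction hp using Submodule.span_induction with
  | mem p hp =>
    obtain ⟨i, j, e, he, rfl⟩ := hp
    refine ⟨(if i = 1 ∧ j = 0 then (1 : ℝ) else 0) • e, M.smul_mem _ he,
      (if i = 0 ∧ j = 1 then (1 : ℝ) else 0) • e, M.smul_mem _ he, fun T hT c d n x => ?_⟩
    rw [smul_smul, smul_smul, ← add_smul, hT.smul _ e he]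
    simp only [hT.smul _ e he]
    change HasDerivAt (fun t => (t * c) ^ i * (t * d) ^ j * T e n x) (_ * T e n x) 0
    refine HasDerivAt.mul_const ?_ _
    have h1 : ∀ t : ℝ, (t * c) ^ i * (t * d) ^ j = t ^ (i + j) * (c ^ i * d ^ j) := by
      intro t; rw [mul_pow, mul_pow, pow_add]; ring
    simp only [h1]
    refine ((hasDerivAt_pow (i + j) (0 : ℝ)).mul_const (c ^ i * d ^ j)).congr_deriv ?_
    -- At 0 only the monomials of total degree one contribute.
    rcases i with _ | _ | i <;> rcases j with _ | _ | j <;> simp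
  | zero =>
    refine ⟨0, M.zero_mem, 0, M.zero_mem, fun T hT c d n x => ?_⟩
    simp only [Pi.zero_apply, smul_zero, add_zero, hT.zero]
    exact hasDerivAt_const _ _
  | add p q hp hq hp' hq' =>
    obtain ⟨a, ha, b, hb, h⟩ := hp'
    obtain ⟨a', ha', b', hb', h'⟩ := hq'
    refine ⟨a + a', M.add_mem ha ha', b + b', M.add_mem hb hb', fun T hT c d n x => ?_⟩
    have h1 : c • (a + a') + d • (b + b') = (c • a + d • b) + (c • a' + d • b') := by module
    rw [h1, hT.add _ (M.add_mem (M.smul_mem _ ha) (M.smul_mem _ hb)) _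
      (M.add_mem (M.smul_mem _ ha') (M.smul_mem _ hb'))]
    simp only [Pi.add_apply p q, hT.add _ (polyCurves_apply_mem hp _) _ (polyCurves_apply_mem hq _)]
    exact (h T hT c d n x).add (h' T hT c d n x)
  | smul k p hp hp' =>
    obtain ⟨a, ha, b, hb, h⟩ := hp'
    refine ⟨k • a, M.smul_mem _ ha, k • b, M.smul_mem _ hb, fun T hT c d n x => ?_⟩
    have h1 : c • k • a + d • k • b = k • (c • a + d • b) := by module
    rw [h1, hT.smul _ _ (M.add_mem (M.smul_mem _ ha) (M.smul_mem _ hb))]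
    simp only [Pi.smul_apply k p, hT.smul _ _ (polyCurves_apply_mem hp _)]
    exact (h T hT c d n x).const_mul k

end polyCurves

/-- The functionals with values in `M` that are polynomial on every affine plane. -/
def polyFn (side : ℤˣ) (M : Submodule ℝ Coef) : Submodule ℝ (S side → Coef) where
  carrier := {f | ∀ u v w, (fun θ : ℝ × ℝ => f (u + θ.1 • v + θ.2 • w)) ∈ polyCurves M}
  zero_mem' := fun _ _ _ => Submodule.zero_mem _
  add_mem' := fun hf hg u v w => Submodule.add_mem _ (hf u v w) (hg u v w)
  smul_mem' := fun c _ hf u v w => Submodule.smul_mem _ c (hf u v w)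

section polyFn

variable {M : Submodule ℝ Coef} {f : S side → Coef}

theorem polyFn_apply_mem (hf : f ∈ polyFn side M) (u : S side) : f u ∈ M := by
  simpa using polyCurves_apply_mem (hf u 0 0) 0

theorem const_mem_polyFn {a : Coef} (ha : a ∈ M) : (fun _ => a) ∈ polyFn side M := fun _ _ _ => by
  simpa using monomial_mem_polyCurves 0 0 ha

theorem coe_mem_polyFn : (fun u : S side => u.1) ∈ polyFn side (S side) := fun u v w => by
  have h := Submodule.add_mem _ (Submodule.add_mem _ (monomial_mem_polyCurves 0 0 u.2)
    (monomial_mem_polyCurves 1 0 v.2)) (monomial_mem_polyCurves 0 1 w.2)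
  convert h using 1
  funext θ
  simp

theorem polyFn_map {M' : Submodule ℝ Coef} {T : Coef → Coef} (hT : LinearOn M T)
    (hM : ∀ a ∈ M, T a ∈ M') (hf : f ∈ polyFn side M) : (fun u => T (f u)) ∈ polyFn side M' :=
  fun u v w => polyCurves_map hT hM (hf u v w)

theorem polyFn_mul {M' M'' : Submodule ℝ Coef} (hM : ∀ a ∈ M, ∀ b ∈ M', a * b ∈ M'')
    {g : S side → Coef} (hf : f ∈ polyFn side M) (hg : g ∈ polyFn side M') :
    (fun u => f u * g u) ∈ polyFn side M'' :=
  fun u v w => polyCurves_mul hM (hf u v w) (hg u v w)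

theorem polyFn_mono {M' : Submodule ℝ Coef} (h : M ≤ M') (hf : f ∈ polyFn side M) :
    f ∈ polyFn side M' :=
  polyFn_map (T := id) ⟨fun _ _ _ _ => rfl, fun _ _ _ => rfl⟩ (fun _ ha => h ha) hf

/-- The derivative of a functional `f` at `u` in the direction `v`. -/
def dFn (f : S side → Coef) (u v : S side) : Coef :=
  fun n x => deriv (fun ε : ℝ => f (u + ε • v) n x) 0

theorem polyFn_hasDerivAt_plane (hf : f ∈ polyFn side M) (u v w : S side) : ∃ a ∈ M, ∃ b ∈ M,
    ∀ T, LinearOn M T → ∀ (c d : ℝ) (n : ℤ) (x : ℝ), HasDerivAt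
      (fun t : ℝ => T (f (u + t • (c • v + d • w))) n x) (T (c • a + d • b) n x) 0 := by
  obtain ⟨a, ha, b, hb, h⟩ := polyCurves_hasDerivAt (hf u v w)
  refine ⟨a, ha, b, hb, fun T hT c d n x => ?_⟩
  have h1 : ∀ t : ℝ, u + t • (c • v + d • w) = u + (t * c) • v + (t * d) • w :=
    fun t => by module
  simp only [h1]
  exact h T hT c d n x

theorem linearOn_id : LinearOn M id := ⟨fun _ _ _ _ => rfl, fun _ _ _ => rfl⟩

theorem polyFn_hasDerivAt (hf : f ∈ polyFn side M) (u v : S side) : dFn f u v ∈ M ∧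
    ∀ T, LinearOn M T → ∀ (n : ℤ) (x : ℝ),
      HasDerivAt (fun t : ℝ => T (f (u + t • v)) n x) (T (dFn f u v) n x) 0 := by
  obtain ⟨a, ha, b, -, h⟩ := polyFn_hasDerivAt_plane hf u v 0
  simp only [smul_zero, add_zero] at h
  have h1 : dFn f u v = a := by
    funext n x
    have h2 := (h id linearOn_id 1 0 n x).deriv
    simp only [one_smul, zero_smul, add_zero] at h2
    exact h2
  rw [h1]
  exact ⟨ha, fun T hT n x => by simpa using h T hT 1 0 n x⟩

/-- Additivity in the direction is the reason for testing functionals on planes: v and w span one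
plane, on which the derivative reads off two first-order coefficients. -/
theorem dFn_linear (hf : f ∈ polyFn side M) (u v w : S side) (c d : ℝ) :
    dFn f u (c • v + d • w) = c • dFn f u v + d • dFn f u w := by
  obtain ⟨a, ha, b, -, h⟩ := polyFn_hasDerivAt_plane hf u v w
  have h0 : ∀ c d : ℝ, dFn f u (c • v + d • w) = c • a + d • b :=
    fun c d => funext fun n => funext fun x => (h id linearOn_id c d n x).deriv
  have h1 := h0 1 0
  have h2 := h0 0 1
  simp only [one_smul, zero_smul, add_zero, zero_add] at h1 h2
  rw [h0, h1, h2]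

end polyFn

/-- The operator functionals of bounded order with coefficients in `polyFn side M`. -/
def polyOps (side : ℤˣ) (M : Submodule ℝ Coef) : Submodule ℝ (S side → PsiDO) where
  carrier := {P | (∃ N, ∀ u, P u ∈ degLE N) ∧ ∀ s, (fun u => (P u).1 s) ∈ polyFn side M}
  zero_mem' := ⟨⟨0, fun _ => Submodule.zero_mem _⟩, fun _ => Submodule.zero_mem _⟩
  add_mem' := by
    rintro P Q ⟨⟨N, hN⟩, hP⟩ ⟨⟨N', hN'⟩, hQ⟩
    exact ⟨⟨max N N', fun u => Submodule.add_mem _ (degLE_mono (le_max_left _ _) (hN u))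
      (degLE_mono (le_max_right _ _) (hN' u))⟩, fun s => Submodule.add_mem _ (hP s) (hQ s)⟩
  smul_mem' := by
    rintro c P ⟨⟨N, hN⟩, hP⟩
    exact ⟨⟨N, fun u => Submodule.smul_mem _ c (hN u)⟩, fun s => Submodule.smul_mem _ c (hP s)⟩

section polyOps

variable {M : Submodule ℝ Coef} {P : S side → PsiDO}

theorem polyOps_apply_mem (hP : P ∈ polyOps side M) (u : S side) : P u ∈ opsIn M :=
  fun s => polyFn_apply_mem (hP.2 s) u

theorem const_mem_polyOps {P₀ : PsiDO} (hP : P₀ ∈ opsIn M) : (fun _ => P₀) ∈ polyOps side M :=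
  ⟨(exists_mem_degLE P₀).imp fun _ h _ => h, fun s => const_mem_polyFn (hP s)⟩

theorem polyOps_mono {M' : Submodule ℝ Coef} (h : M ≤ M') (hP : P ∈ polyOps side M) :
    P ∈ polyOps side M' := ⟨hP.1, fun s => polyFn_mono h (hP.2 s)⟩

theorem monom_mem_polyOps {f : S side → Coef} (hf : f ∈ polyFn side M) (s : ℤ) :
    (fun u => monom (f u) s) ∈ polyOps side M := by
  refine ⟨⟨s, fun u => monom_mem_degLE _ s⟩, fun t => ?_⟩
  rcases eq_or_ne t s with rfl | h
  · simpa only [monom_coeff_self] using hf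
  · simp only [monom_coeff_of_ne _ h]; exact Submodule.zero_mem _

theorem dpow_mem_polyFn (hM : ∀ (s : ℤ), ∀ f ∈ M, shift s f ∈ M) (hP : P ∈ polyOps side M)
    (s k : ℤ) : (fun u => dpow s (P u).1 k) ∈ polyFn side M := by
  obtain ⟨⟨N, hN⟩, hP⟩ := hP
  have hm : N + s - k < ((N + s - k).toNat + 1 : ℕ) := by push_cast; omega
  have h1 : (fun u => dpow s (P u).1 k) = ∑ i ∈ Finset.range ((N + s - k).toNat + 1),
      (Ring.choose s i : ℤ) • fun u => diff^[i] (shift (s - i) ((P u).1 (k - s + i))) := by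
    funext u
    rw [dpow_eq_sum (hN u) hm, Finset.sum_apply]
    rfl
  rw [h1]
  refine Submodule.sum_mem _ fun i _ => zsmul_mem ?_ _
  rw [diff_iterate_eq]
  refine polyFn_map (f := fun u => (P u).1 (k - s + i))
    (LinearOn.of_linearMap M ((diffₗ ^ i) ∘ₗ shiftₗ (s - i))) (fun a ha => ?_) (hP _)
  rw [LinearMap.comp_apply, ← diff_iterate_eq]
  exact diff_iterate_mem hM i (hM _ a ha)

theorem polyOps_mul {M₂ M₃ : Submodule ℝ Coef} (hmul : ∀ f ∈ M, ∀ g ∈ M₂, f * g ∈ M₃)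
    (hM : ∀ (s : ℤ), ∀ f ∈ M₂, shift s f ∈ M₂) {Q : S side → PsiDO} (hP : P ∈ polyOps side M)
    (hQ : Q ∈ polyOps side M₂) : P * Q ∈ polyOps side M₃ := by
  obtain ⟨N, hN⟩ := hP.1
  obtain ⟨N', hN'⟩ := hQ.1
  refine ⟨⟨N + N', fun u => mul_mem_degLE (hN u) (hN' u)⟩, fun k => ?_⟩
  have h1 : (fun u => ((P * Q) u).1 k) = ∑ s ∈ Finset.Icc (k - N') N,
      fun u => (P u).1 s * dpow s (Q u).1 k := by
    funext u
    rw [Finset.sum_apply]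
    exact opMul_coeff (hN u) (hN' u) le_rfl le_rfl
  rw [h1]
  exact Submodule.sum_mem _ fun s _ => polyFn_mul hmul (hP.2 s) (dpow_mem_polyFn hM hQ s k)

theorem polyOps_mul_S_right {Q : S side → PsiDO} (hP : P ∈ polyOps side (multipliers side))
    (hQ : Q ∈ polyOps side (S side)) : P * Q ∈ polyOps side (S side) :=
  polyOps_mul (fun _ hf _ hg => multipliers_mul_mem_S hf hg)
    (fun s _ hf => shift_mem s hf) hP hQ

theorem polyOps_mul_S_left {Q : S side → PsiDO} (hP : P ∈ polyOps side (S side))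
    (hQ : Q ∈ polyOps side (multipliers side)) : P * Q ∈ polyOps side (S side) :=
  polyOps_mul (fun _ hf _ hg => mul_multipliers_mem_S hf hg)
    (fun s _ hf => multipliers_shift_mem s hf) hP hQ

theorem opDx_mem_polyOps (hP : P ∈ polyOps side (S side)) :
    (fun u => opDx (P u)) ∈ polyOps side (S side) :=
  ⟨hP.1.imp fun _ h u => opDx_mem_degLE (h u),
    fun s => polyFn_map linearOn_dx (fun _ ha => dx_mem ha) (hP.2 s)⟩

/-- A polynomial operator functional has a derivative, which commutes with `opDx`. -/
theorem polyOps_hasDeriv (hP : P ∈ polyOps side (S side)) (u v : S side) :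
    ∃ P' ∈ opsIn (S side), (∀ s, (∀ u, (P u).1 s = 0) → P'.1 s = 0) ∧
      HasOpGateauxDeriv P u v P' ∧ HasOpGateauxDeriv (fun u => opDx (P u)) u v (opDx P') := by
  have h0 : ∀ s, (∀ u, (P u).1 s = 0) → dFn (fun u => (P u).1 s) u v = 0 := by
    intro s hs
    funext n x
    simp [dFn, hs]
  obtain ⟨N, hN⟩ := hP.1
  exact ⟨⟨fun s => dFn (fun u => (P u).1 s) u v, N, fun s hs => h0 s fun u => hN u s hs⟩,
    fun s => (polyFn_hasDerivAt (hP.2 s) u v).1, h0,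
    fun s => (polyFn_hasDerivAt (hP.2 s) u v).2 id linearOn_id,
    fun s => (polyFn_hasDerivAt (hP.2 s) u v).2 dx linearOn_dx⟩

end polyOps

/-! ### Rules for Gâteaux derivatives of operators -/

section Gateaux

variable {P Q : S side → PsiDO} {u v : S side} {P' Q' : PsiDO}

theorem HasOpGateauxDeriv.add (hP : HasOpGateauxDeriv P u v P') (hQ : HasOpGateauxDeriv Q u v Q') :
    HasOpGateauxDeriv (P + Q) u v (P' + Q') := fun s n x => (hP s n x).add (hQ s n x)

theorem HasOpGateauxDeriv.sub (hP : HasOpGateauxDeriv P u v P') (hQ : HasOpGateauxDeriv Q u v Q') :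
    HasOpGateauxDeriv (P - Q) u v (P' - Q') := fun s n x => (hP s n x).sub (hQ s n x)

theorem hasOpGateauxDeriv_const (P₀ : PsiDO) : HasOpGateauxDeriv (fun _ => P₀) u v 0 :=
  fun _ _ _ => hasDerivAt_const _ _

theorem HasOpGateauxDeriv.unique (hP : HasOpGateauxDeriv P u v P')
    (hQ : HasOpGateauxDeriv P u v Q') : P' = Q' :=
  ext_coeff fun s => funext fun n => funext fun x => (hP s n x).unique (hQ s n x)

/-- A bound on the orders that is uniform in u makes each coefficient a finite sum over a fixed
range. -/
theorem HasOpGateauxDeriv.mul (hP : HasOpGateauxDeriv P u v P') (hQ : HasOpGateauxDeriv Q u v Q')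
    (hPN : ∃ N, ∀ u, P u ∈ degLE N) (hQN : ∃ N, ∀ u, Q u ∈ degLE N) :
    HasOpGateauxDeriv (P * Q) u v (P' * Q u + P u * Q') := by
  obtain ⟨N, hN⟩ := hPN
  obtain ⟨N', hN'⟩ := hQN
  have h0 : ∀ {R : S side → PsiDO} {R' : PsiDO} {N : ℤ}, HasOpGateauxDeriv R u v R' →
      (∀ u, R u ∈ degLE N) → R' ∈ degLE N := by
    intro R R' N hR hN s hs
    funext n x
    refine (hR s n x).unique ?_
    simp only [fun u => hN u s hs]
    exact hasDerivAt_const _ _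
  intro s n x
  have h := hasDerivAt_mul (ξ := fun _ => x) (t₀ := 0) (fun t => hN (u + t • v)) (h0 hP hN)
    (fun t => hN' (u + t • v)) (h0 hQ hN') (fun s n => hP s n x) (fun s n => hQ s n x) s n
  simp only [zero_smul, add_zero] at h
  exact h

theorem HasOpGateauxDeriv.monom {f : S side → Coef} {f' : Coef}
    (hf : ∀ n x, HasDerivAt (fun t : ℝ => f (u + t • v) n x) (f' n x) 0) (s : ℤ) :
    HasOpGateauxDeriv (fun u => monom (f u) s) u v (DDKP.monom f' s) := by
  intro t n x
  rcases eq_or_ne t s with rfl | h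
  · simpa only [monom_coeff_self] using hf n x
  · simp only [monom_coeff_of_ne _ h]; exact hasDerivAt_const _ _

end Gateaux

/-! ### The operator `P ↦ P_x - [A₁, P]` -/

/-- The operator `h⁻¹ Δ`. -/
def freeLax (h : ℝ) : PsiDO := monom (fun _ _ => h⁻¹) 1

/-- The operator `P ↦ P_x - [A₁, P]`. -/
def cov (h : ℝ) (u : S side) (P : PsiDO) : PsiDO := opDx P - opComm (opA₁ h u) P

section cov

variable {h : ℝ} {u : S side} {P Q : PsiDO}

theorem opA₁_eq (h : ℝ) (u : S side) : opA₁ h u = freeLax h + monom u.1 0 := rfl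

theorem cov_eq (h : ℝ) (u : S side) (P : PsiDO) :
    cov h u P = opDx P - (opA₁ h u * P - P * opA₁ h u) := rfl

theorem freeLax_mem : freeLax h ∈ opsIn (multipliers side) :=
  monom_mem_opsIn (const_mem_multipliers _) 1

theorem opA₁_mem : opA₁ h u ∈ opsIn (multipliers side) :=
  Submodule.add_mem _ freeLax_mem (monom_mem_opsIn (S_le_multipliers u.2) 0)

theorem opA₁_mem_degLE : opA₁ h u ∈ degLE 1 :=
  Submodule.add_mem _ (monom_mem_degLE _ _) (degLE_mono zero_le_one (monom_mem_degLE _ _))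

theorem opA₁_mem_nonneg : opA₁ h u ∈ nonneg :=
  Submodule.add_mem _ (monom_mem_nonneg _ zero_le_one) (monom_mem_nonneg _ le_rfl)

theorem opA₁_coeff_one : (opA₁ h u).1 1 = fun _ _ => h⁻¹ := by
  change (monom _ 1).1 1 + (monom u.1 0).1 1 = _
  rw [monom_coeff_self, monom_coeff_of_ne _ one_ne_zero, add_zero]

theorem cov_add (hP : P ∈ opsIn (multipliers side)) (hQ : Q ∈ opsIn (multipliers side)) :
    cov h u (P + Q) = cov h u P + cov h u Q := by
  simp only [cov_eq, opDx_add hP hQ]; noncomm_ring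

theorem cov_sub (hP : P ∈ opsIn (multipliers side)) (hQ : Q ∈ opsIn (multipliers side)) :
    cov h u (P - Q) = cov h u P - cov h u Q := by
  simp only [cov_eq, opDx_sub hP hQ]; noncomm_ring

theorem cov_smul (c : ℝ) : cov h u (c • P) = c • cov h u P := by
  simp only [cov_eq, opDx_smul, mul_smul_comm, smul_mul_assoc, smul_sub]

theorem cov_zero : cov h u 0 = 0 := by
  simpa using cov_smul (h := h) (u := u) (P := 0) 0

/-- As a derivation, `cov` has a kernel closed under products: powers of L and products with C stay
in it. -/
theorem cov_mul (hP : P ∈ opsIn (multipliers side)) (hQ : Q ∈ opsIn (multipliers side)) :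
    cov h u (P * Q) = cov h u P * Q + P * cov h u Q := by
  simp only [cov_eq, opDx_mul hP hQ]; noncomm_ring

theorem cov_one : cov h u 1 = 0 := by
  have h1 : dx (1 : Coef) = 0 := by funext n x; exact deriv_const x (1 : ℝ)
  have h2 : monom 0 0 = 0 := by
    refine ext_coeff fun s => ?_
    rcases eq_or_ne s 0 with rfl | hs
    · exact monom_coeff_self _ _
    · exact monom_coeff_of_ne _ hs
  rw [cov_eq, one_eq_monom, opDx_monom, h1, h2, ← one_eq_monom]; noncomm_ring

theorem one_mem : (1 : PsiDO) ∈ opsIn (multipliers side) :=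
  monom_mem_opsIn (const_mem_multipliers 1) 0

theorem pow_mem_opsIn_multipliers (hP : P ∈ opsIn (multipliers side)) (m : ℕ) :
    P ^ m ∈ opsIn (multipliers side) := by
  induction m with
  | zero => rw [pow_zero]; exact one_mem
  | succ m ih => rw [pow_succ]; exact mul_mem_opsIn_multipliers ih hP

theorem cov_pow_eq_zero (hP : P ∈ opsIn (multipliers side)) (h0 : cov h u P = 0) (m : ℕ) :
    cov h u (P ^ m) = 0 := by
  induction m with
  | zero => rw [pow_zero, cov_one]
  | succ m ih =>
    rw [pow_succ, cov_mul (pow_mem_opsIn_multipliers hP m) hP, ih, h0, zero_mul, mul_zero, add_zero]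

theorem cov_mem_degLE {N : ℤ} (hP : P ∈ degLE N) : cov h u P ∈ degLE (N + 1) := by
  refine Submodule.sub_mem _ (degLE_mono (by omega) (opDx_mem_degLE hP)) (Submodule.sub_mem _ ?_ ?_)
  · rw [add_comm]; exact mul_mem_degLE opA₁_mem_degLE hP
  · exact mul_mem_degLE hP opA₁_mem_degLE

theorem cov_mem_nonneg (hP : P ∈ nonneg) : cov h u P ∈ nonneg :=
  Submodule.sub_mem _ (opDx_mem_nonneg hP) (Submodule.sub_mem _
    (mul_mem_nonneg opA₁_mem_nonneg hP) (mul_mem_nonneg hP opA₁_mem_nonneg))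

/-- Only [h⁻¹Δ, P] reaches order N + 1; P_x and [u, P] have order at most N. -/
theorem cov_coeff_top {N : ℤ} (hP : P ∈ degLE N) :
    (cov h u P).1 (N + 1) = -(h⁻¹ • diff (P.1 N)) := by
  have h1 : (opMul (opA₁ h u) P).1 (N + 1) = h⁻¹ • shift 1 (P.1 N) := by
    rw [add_comm, opMul_coeff_top opA₁_mem_degLE hP, opA₁_coeff_one]; rfl
  have h2 : (opMul P (opA₁ h u)).1 (N + 1) = h⁻¹ • P.1 N := by
    rw [opMul_coeff_top hP opA₁_mem_degLE, opA₁_coeff_one, shift_const, mul_comm]; rfl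
  change (opDx P).1 (N + 1) - ((opMul (opA₁ h u) P).1 (N + 1) - (opMul P (opA₁ h u)).1 (N + 1)) = _
  rw [opDx_mem_degLE hP _ (by omega), h1, h2, zero_sub, ← smul_sub]
  rfl

/-- Above order M, the vanishing of the top coefficient of `cov P` gives Δ(P_N) = 0, hence P_N = 0
by decay, and the order of P drops step by step. -/
theorem mem_degLE_of_cov (hh : h ≠ 0) (hP : P ∈ opsIn (S side)) {M : ℤ}
    (hc : cov h u P ∈ degLE (M + 1)) : P ∈ degLE M := by
  obtain ⟨N, hN⟩ := exists_mem_degLE P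
  obtain ⟨j, hj⟩ : ∃ j : ℕ, N ≤ M + j := ⟨(N - M).toNat, by omega⟩
  replace hN := degLE_mono hj hN
  clear hj
  induction j with
  | zero => simpa using hN
  | succ j ih =>
    refine ih fun s hs => ?_
    rcases lt_or_ge (M + (j + 1 : ℕ)) s with h1 | h1
    · exact hN s h1
    · obtain rfl : s = M + (j + 1 : ℕ) := by push_cast at h1 ⊢; omega
      have h2 := cov_coeff_top (h := h) (u := u) hN
      rw [hc _ (by push_cast; omega), eq_comm, neg_eq_zero, smul_eq_zero_iff_right (inv_ne_zero hh)]
        at h2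
      exact eq_zero_of_diff_eq_zero (hP _) h2

theorem eq_zero_of_cov (hh : h ≠ 0) (hP : P ∈ opsIn (S side)) (hc : cov h u P = 0) : P = 0 :=
  ext_coeff fun s => mem_degLE_of_cov hh hP (M := s - 1)
    (by rw [hc]; exact Submodule.zero_mem _) s (by omega)

/-- The equation `cov P = K` with K a multiplication operator forces P to have negative order, which
a difference operator cannot have unless it is zero. This is used for uniqueness of the triads,
their values at u = 0 and the brackets. -/
theorem eq_zero_of_cov_mem_degLE_zero (hh : h ≠ 0) (hP : P ∈ opsIn (S side)) (h0 : P ∈ nonneg)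
    (hc : cov h u P ∈ degLE 0) : P = 0 := by
  refine ext_coeff fun s => ?_
  rcases lt_or_ge s 0 with hs | hs
  · exact h0 s hs
  · exact mem_degLE_of_cov hh hP (M := -1) (by simpa using hc) s (by omega)

theorem opA₁_mem_polyOps : (fun u : S side => opA₁ h u) ∈ polyOps side (multipliers side) :=
  Submodule.add_mem _ (const_mem_polyOps freeLax_mem)
    (monom_mem_polyOps (polyFn_mono S_le_multipliers coe_mem_polyFn) 0)

theorem cov_mem_polyOps {P : S side → PsiDO} (hP : P ∈ polyOps side (S side)) :
    (fun u => cov h u (P u)) ∈ polyOps side (S side) :=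
  Submodule.sub_mem _ (opDx_mem_polyOps hP) (Submodule.sub_mem _
    (polyOps_mul_S_right opA₁_mem_polyOps hP) (polyOps_mul_S_left hP opA₁_mem_polyOps))

end cov

/-! ### Solving `P_x - [A₁, P] = R` -/

section Solve

variable (h : ℝ) (R : S side → PsiDO) (N : ℤ)

/-- The coefficient at `Δ ^ (N - k)` of the solution, if `Q` is the residual after `k` steps. -/
def solCoeff (side : ℤˣ) (Q : PsiDO) (k : ℕ) : Coef := -h • invDiff side (Q.1 (N - k + 1))

/-- The residual after `k` steps in the solution of `cov h u P = R u`. -/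
def residual : ℕ → S side → PsiDO
  | 0 => R
  | k + 1 => fun u => residual k u - cov h u (monom (solCoeff h N side (residual k u) k) (N - k))

variable {h R N}

theorem solCoeff_mem_polyFn {Q : S side → PsiDO} (hQ : Q ∈ polyOps side (S side)) (k : ℕ) :
    (fun u => solCoeff h N side (Q u) k) ∈ polyFn side (S side) :=
  Submodule.smul_mem _ _ (polyFn_map linearOn_invDiff (fun _ ha => invDiff_mem ha) (hQ.2 _))

theorem residual_mem (hR : R ∈ polyOps side (S side)) (k : ℕ) :
    residual h R N k ∈ polyOps side (S side) := by
  induction k with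
  | zero => exact hR
  | succ k ih =>
    exact Submodule.sub_mem _ ih (cov_mem_polyOps (monom_mem_polyOps (solCoeff_mem_polyFn ih k) _))

/-- The map -hΔ⁻¹ in `solCoeff` inverts -h⁻¹Δ from `cov_coeff_top`, so step k cancels exactly the
leading coefficient of the residual. -/
theorem residual_mem_degLE (hh : h ≠ 0) (hR : R ∈ polyOps side (S side))
    (hN : ∀ u, R u ∈ degLE (N + 1)) (k : ℕ) (u : S side) :
    residual h R N k u ∈ degLE (N - k + 1) := by
  induction k with
  | zero =>
    have := hN u
    rwa [Nat.cast_zero, sub_zero]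
  | succ k ih =>
    set d := solCoeff h N side (residual h R N k u) k with hd
    have h1 : residual h R N (k + 1) u ∈ degLE (N - k + 1) :=
      Submodule.sub_mem _ ih (cov_mem_degLE (monom_mem_degLE d _))
    intro s hs
    rcases lt_or_ge (N - k + 1) s with h2 | h2
    · exact h1 s h2
    · obtain rfl : s = N - k + 1 := by push_cast at hs h2; omega
      change (residual h R N k u).1 (N - k + 1) - (cov h u (monom d (N - k))).1 (N - k + 1) = 0
      rw [cov_coeff_top (monom_mem_degLE _ _), monom_coeff_self, hd, solCoeff, diff_smul,
        diff_invDiff (polyOps_apply_mem (residual_mem hR k) u _), smul_smul, mul_neg,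
        inv_mul_cancel₀ hh, neg_one_smul, neg_neg, sub_self]

/-- The coefficients found by the recursion are collected into one formal series P; its partial sums
p K solve the equation up to the residual, and P - p K has order at most N - K. -/
theorem exists_cov_eq (hh : h ≠ 0) (hR : R ∈ polyOps side (S side))
    (hN : ∀ u, R u ∈ degLE (N + 1)) : ∃ P ∈ polyOps side (S side),
      (∀ u, P u ∈ degLE N) ∧ ∀ u, cov h u (P u) = R u := by
  set d : ℕ → S side → Coef := fun k u => solCoeff h N side (residual h R N k u) k with hd
  have hdS : ∀ k, d k ∈ polyFn side (S side) := fun k => solCoeff_mem_polyFn (residual_mem hR k) k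
  let P : S side → PsiDO := fun u => ⟨fun s => if s ≤ N then d (N - s).toNat u else 0, N,
    fun s hs => if_neg (by omega)⟩
  have hPN : ∀ u, P u ∈ degLE N := fun u s hs => if_neg (by omega)
  have hP : P ∈ polyOps side (S side) := by
    refine ⟨⟨N, hPN⟩, fun s => ?_⟩
    change (fun u => if s ≤ N then d (N - s).toNat u else 0) ∈ _
    split_ifs
    · exact hdS _
    · exact Submodule.zero_mem _
  refine ⟨P, hP, hPN, fun u => ?_⟩
  let p : ℕ → PsiDO := fun K => ∑ k ∈ Finset.range K, monom (d k u) (N - k)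
  have hm : ∀ k, monom (d k u) (N - k) ∈ opsIn (multipliers side) := fun k =>
    opsIn_mono S_le_multipliers (monom_mem_opsIn (polyFn_apply_mem (hdS k) u) _)
  have hp : ∀ K, p K ∈ opsIn (multipliers side) := fun K => Submodule.sum_mem _ fun k _ => hm k
  have hpc : ∀ K, cov h u (p K) = R u - residual h R N K u := by
    intro K
    induction K with
    | zero => exact cov_zero.trans (sub_self _).symm
    | succ K ih =>
      change cov h u (∑ k ∈ Finset.range (K + 1), monom (d k u) (N - k)) =
        R u - (residual h R N K u - cov h u (monom (d K u) (N - K)))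
      rw [Finset.sum_range_succ, cov_add (hp K) (hm K), ih]
      abel
  have hpP : ∀ K : ℕ, P u - p K ∈ degLE (N - K) := by
    intro K
    induction K with
    | zero => simpa [p] using hPN u
    | succ K ih =>
      have h1 : P u - p (K + 1) = P u - p K - monom (d K u) (N - K) := by
        change P u - (∑ k ∈ Finset.range (K + 1), monom (d k u) (N - k)) = _
        rw [Finset.sum_range_succ, sub_sub]
      have h2 : P u - p (K + 1) ∈ degLE (N - K) := by
        rw [h1]; exact Submodule.sub_mem _ ih (monom_mem_degLE _ _)
      intro s hs
      rcases lt_or_ge (N - K) s with h3 | h3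
      · exact h2 s h3
      · obtain rfl : s = N - K := by push_cast at hs; omega
        have h4 : (p K).1 (N - K) = 0 := by
          have h5 : p K ∈ ({Q | Q.1 (N - K) = 0} : Set PsiDO) := by
            refine Finset.sum_induction _ (· ∈ {Q : PsiDO | Q.1 (N - K) = 0})
              (fun a b ha hb => ?_) rfl fun k hk => ?_
            · change a.1 (N - K) + b.1 (N - K) = 0
              rw [ha, hb, add_zero]
            · rw [Finset.mem_range] at hk
              exact monom_coeff_of_ne _ (by omega)
          exact h5
        have h6 : (P u).1 (N - K) = d K u := by
          change (if N - (K : ℤ) ≤ N then d (N - (N - (K : ℤ))).toNat u else 0) = _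
          rw [if_pos (by omega)]
          congr 1; omega
        rw [h1]
        change (P u).1 (N - K) - (p K).1 (N - K) - (monom (d K u) (N - K)).1 (N - K) = 0
        rw [h4, h6, monom_coeff_self, sub_zero, sub_self]
  refine ext_coeff fun s => ?_
  -- With this K both `cov (P - p K)` and the residual have order below s, so neither affects the
  -- coefficient at s.
  set K : ℕ := (N + 1 - s).toNat + 1 with hK
  have h7 : cov h u (P u) = cov h u (P u - p K) + (R u - residual h R N K u) := by
    rw [cov_sub (opsIn_mono S_le_multipliers (polyOps_apply_mem hP u)) (hp K), hpc]
    abel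
  rw [h7]
  change (cov h u (P u - p K)).1 s + ((R u).1 s - (residual h R N K u).1 s) = _
  rw [cov_mem_degLE (hpP K) s (by omega), residual_mem_degLE hh hR hN K u s (by omega), zero_add,
    sub_zero]

end Solve

/-! ### The operators `L` and `C` -/

theorem opDx_freeLax (h : ℝ) : opDx (freeLax h) = 0 := by
  rw [freeLax, opDx_monom]
  refine ext_coeff fun s => ?_
  rcases eq_or_ne s 1 with rfl | hs
  · rw [monom_coeff_self]; funext n x; exact deriv_const x h⁻¹
  · exact monom_coeff_of_ne _ hs

theorem cov_opA₁ (h : ℝ) (u : S side) : cov h u (opA₁ h u) = monom (dx u.1) 0 := by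
  rw [cov_eq, opA₁_eq, opDx_add freeLax_mem (monom_mem_opsIn (S_le_multipliers u.2) 0),
    opDx_freeLax, opDx_monom]
  noncomm_ring

/-- Operator functionals `L` with `L_x = [A₁, L]` and `L = h⁻¹ Δ + u + ⋯`. -/
structure IsLax (h : ℝ) (L : S side → PsiDO) : Prop where
  mem : ∀ u, L u - opA₁ h u ∈ opsIn (S side)
  deg : ∀ u, L u - opA₁ h u ∈ degLE (-1)
  cov : ∀ u, cov h u (L u) = 0

/-- Since `cov A₁ = u_x`, L is A₁ + M with M the solution of order at most -1 of `cov M = -u_x`. -/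
theorem exists_isLax {h : ℝ} (hh : h ≠ 0) : ∃ L : S side → PsiDO,
    IsLax h L ∧ (fun u => L u - freeLax h) ∈ polyOps side (S side) := by
  obtain ⟨M, hM, hMN, hMc⟩ := exists_cov_eq (N := -1) hh
    (Submodule.neg_mem _ (monom_mem_polyOps
      (polyFn_map linearOn_dx (fun _ ha => dx_mem ha) (coe_mem_polyFn (side := side))) 0))
    fun u => Submodule.neg_mem _ (by
      rw [neg_add_cancel]; exact monom_mem_degLE _ 0)
  refine ⟨fun u => opA₁ h u + M u, ⟨fun u => ?_, fun u => ?_, fun u => ?_⟩, ?_⟩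
  · rw [add_sub_cancel_left]; exact polyOps_apply_mem hM u
  · rw [add_sub_cancel_left]; exact hMN u
  · rw [cov_add opA₁_mem (opsIn_mono S_le_multipliers (polyOps_apply_mem hM u)), hMc, cov_opA₁]
    exact add_neg_cancel _
  · have h1 : (fun u => opA₁ h u + M u - freeLax h) = (fun u => monom u.1 0) + M := by
      funext u
      change _ = monom u.1 0 + M u
      rw [opA₁_eq]; abel
    rw [h1]
    exact Submodule.add_mem _ (monom_mem_polyOps coe_mem_polyFn 0) hM

theorem isLax_mem_multipliers {h : ℝ} {L : S side → PsiDO} (hL : IsLax h L) (u : S side) :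
    L u ∈ opsIn (multipliers side) := by
  have := Submodule.add_mem _ (opsIn_mono S_le_multipliers (hL.mem u)) (opA₁_mem (h := h) (u := u))
  rwa [sub_add_cancel] at this

theorem IsLax.unique {h : ℝ} (hh : h ≠ 0) {L L' : S side → PsiDO} (hL : IsLax h L)
    (hL' : IsLax h L') (u : S side) : L u = L' u := by
  rw [← sub_eq_zero]
  refine eq_zero_of_cov hh (u := u) ?_ ?_
  · have := Submodule.sub_mem _ (hL.mem u) (hL'.mem u)
    rwa [sub_sub_sub_cancel_right] at this
  · rw [cov_sub (isLax_mem_multipliers hL u) (isLax_mem_multipliers hL' u), hL.cov, hL'.cov,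
      sub_self]

/-! ### The operator `C` and its commutator with `L` -/

/-- The operator `x E + h n`, where `E = 1 + Δ`. -/
def freeC (h : ℝ) : PsiDO := monom coordX 1 + monom (coordX + h • coordN) 0

theorem freeC_mem (h : ℝ) : freeC h ∈ opsIn (multipliers side) :=
  Submodule.add_mem _ (monom_mem_opsIn coordX_mem 1)
    (monom_mem_opsIn (Submodule.add_mem _ coordX_mem (Submodule.smul_mem _ h coordN_mem)) 0)

theorem freeC_mem_degLE (h : ℝ) : freeC h ∈ degLE 1 :=
  Submodule.add_mem _ (monom_mem_degLE _ _) (degLE_mono zero_le_one (monom_mem_degLE _ _))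

theorem freeC_mem_nonneg (h : ℝ) : freeC h ∈ nonneg :=
  Submodule.add_mem _ (monom_mem_nonneg _ zero_le_one) (monom_mem_nonneg _ le_rfl)

theorem dx_coordX : dx coordX = 1 := by
  funext n x; exact deriv_id x

theorem dx_coordX_add (h : ℝ) : dx (coordX + h • coordN) = 1 := by
  funext n x
  exact ((hasDerivAt_id x).add_const (h * n)).deriv

theorem freeLax_mul_coeff (h : ℝ) (P : PsiDO) (k : ℤ) :
    (freeLax h * P).1 k = h⁻¹ • (shift 1 (P.1 (k - 1)) + diff (P.1 k)) := by
  obtain ⟨N, hP⟩ := exists_mem_degLE P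
  have h1 := dpow_succ hP 0 k
  rw [dpow_zero hP, zero_add] at h1
  rw [← h1]
  exact monom_mul_coeff _ 1 P k

theorem mul_freeLax_coeff (h : ℝ) (P : PsiDO) (k : ℤ) :
    (P * freeLax h).1 k = h⁻¹ • P.1 (k - 1) := mul_monom_const_coeff P _ 1 k

theorem freeLax_comm_coeff (h : ℝ) (P : PsiDO) (k : ℤ) :
    (freeLax h * P - P * freeLax h).1 k = h⁻¹ • (diff (P.1 (k - 1)) + diff (P.1 k)) := by
  change (freeLax h * P).1 k - (P * freeLax h).1 k = _
  rw [freeLax_mul_coeff, mul_freeLax_coeff, ← smul_sub, add_sub_right_comm]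
  rfl

theorem freeC_coeff_of_ne (h : ℝ) {s : ℤ} (h0 : s ≠ 0) (h1 : s ≠ 1) : (freeC h).1 s = 0 := by
  change (monom _ 1).1 s + (monom _ 0).1 s = 0
  rw [monom_coeff_of_ne _ h0, monom_coeff_of_ne _ h1, add_zero]

theorem freeC_coeff_zero (h : ℝ) : (freeC h).1 0 = coordX + h • coordN := by
  change (monom _ 1).1 0 + (monom _ 0).1 0 = _
  rw [monom_coeff_self, monom_coeff_of_ne _ (by norm_num), zero_add]

theorem freeC_coeff_one (h : ℝ) : (freeC h).1 1 = coordX := by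
  change (monom _ 1).1 1 + (monom _ 0).1 1 = _
  rw [monom_coeff_self, monom_coeff_of_ne _ (by norm_num), add_zero]

/-- The right-hand side is also the x-derivative of `freeC`, so `freeC` is killed by `cov` at u = 0.
-/
theorem freeLax_comm_freeC {h : ℝ} (hh : h ≠ 0) :
    freeLax h * freeC h - freeC h * freeLax h = 1 + monom 1 1 := by
  have hd0 : diff (0 : Coef) = 0 := sub_self _
  have hX : diff coordX = 0 := by funext n x; exact sub_self x
  have hN : h⁻¹ • diff (coordX + h • coordN) = 1 := by
    funext n x
    change h⁻¹ * (x + h * ((n + 1 : ℤ) : ℝ) - (x + h * (n : ℝ))) = 1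
    push_cast; field_simp; ring
  refine ext_coeff fun k => ?_
  rw [freeLax_comm_coeff, smul_add]
  change _ = (monom 1 0).1 k + (monom 1 1).1 k
  rcases eq_or_ne k 0 with rfl | h0
  · rw [monom_coeff_self, monom_coeff_of_ne _ (by norm_num), freeC_coeff_zero,
      freeC_coeff_of_ne _ (by norm_num) (by norm_num), hd0, hN, smul_zero, zero_add, add_zero]
  rcases eq_or_ne k 1 with rfl | h1
  · rw [monom_coeff_self, monom_coeff_of_ne _ (by norm_num), freeC_coeff_one, sub_self,
      freeC_coeff_zero, hN, hX, smul_zero, zero_add, add_zero]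
  rw [monom_coeff_of_ne _ h0, monom_coeff_of_ne _ h1, freeC_coeff_of_ne h h0 h1, hd0, smul_zero]
  rcases eq_or_ne k 2 with rfl | h2
  · have : (2 : ℤ) - 1 = 1 := by norm_num
    rw [this, freeC_coeff_one, hX, smul_zero]
  · rw [freeC_coeff_of_ne h (by omega) (by omega), hd0, smul_zero]

theorem smul_freeLax {h : ℝ} (hh : h ≠ 0) : h • freeLax h = monom 1 1 := by
  refine ext_coeff fun s => ?_
  change h • (monom _ 1).1 s = _
  rcases eq_or_ne s 1 with rfl | hs
  · rw [monom_coeff_self, monom_coeff_self]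
    funext n x; exact mul_inv_cancel₀ hh
  · rw [monom_coeff_of_ne _ hs, monom_coeff_of_ne _ hs, smul_zero]

theorem freeC_comm_freeLax {h : ℝ} (hh : h ≠ 0) :
    freeC h * freeLax h - freeLax h * freeC h = -(h • freeLax h + 1) := by
  rw [smul_freeLax hh, add_comm _ 1, ← freeLax_comm_freeC hh, neg_sub]

theorem cov_freeC {h : ℝ} (hh : h ≠ 0) (u : S side) :
    cov h u (freeC h) = -(monom u.1 0 * freeC h - freeC h * monom u.1 0) := by
  have h1 : opDx (freeC h) = freeLax h * freeC h - freeC h * freeLax h := by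
    rw [freeLax_comm_freeC hh, freeC, opDx_add (side := side) (monom_mem_opsIn coordX_mem 1)
      (monom_mem_opsIn (Submodule.add_mem _ coordX_mem (Submodule.smul_mem _ h coordN_mem)) 0),
      opDx_monom, opDx_monom, dx_coordX, dx_coordX_add, add_comm]
    rfl
  rw [cov_eq, h1, opA₁_eq]
  noncomm_ring

/-- There is `C = x E + h n + ⋯` with `C_x = [A₁, C]`. -/
theorem exists_dressed_freeC {h : ℝ} (hh : h ≠ 0) : ∃ C : S side → PsiDO,
    (fun u => C u - freeC h) ∈ polyOps side (S side) ∧ (∀ u, C u - freeC h ∈ degLE 0) ∧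
      ∀ u, cov h u (C u) = 0 := by
  have hu : (fun u : S side => monom u.1 0) ∈ polyOps side (S side) :=
    monom_mem_polyOps coe_mem_polyFn 0
  have hC : (fun _ => freeC h) ∈ polyOps side (multipliers side) :=
    const_mem_polyOps (freeC_mem h)
  -- The correction D solves `cov D = [u, freeC]`, which is minus the value of `cov` at `freeC`.
  obtain ⟨D, hD, hDN, hDc⟩ := exists_cov_eq (N := 0) hh (Submodule.sub_mem _
    (polyOps_mul_S_left hu hC) (polyOps_mul_S_right hC hu)) fun u => by
      refine Submodule.sub_mem _ ?_ ?_
      · exact mul_mem_degLE (monom_mem_degLE _ _) (freeC_mem_degLE h)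
      · rw [add_comm]; exact mul_mem_degLE (freeC_mem_degLE h) (monom_mem_degLE _ _)
  refine ⟨fun u => freeC h + D u, ?_, fun u => ?_, fun u => ?_⟩
  · simpa only [add_sub_cancel_left] using hD
  · rw [add_sub_cancel_left]; exact hDN u
  · rw [cov_add (freeC_mem h) (opsIn_mono S_le_multipliers (polyOps_apply_mem hD u)), hDc,
      cov_freeC hh]
    exact neg_add_cancel _

/-- Both sides are killed by `cov`, and they agree modulo `S` because the free operators satisfy the
relation. -/
theorem dressed_comm {h : ℝ} (hh : h ≠ 0) {u : S side} {C L : PsiDO}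
    (hC : C - freeC h ∈ opsIn (S side)) (hL : L - freeLax h ∈ opsIn (S side))
    (hCc : cov h u C = 0) (hLc : cov h u L = 0) : C * L - L * C = -(h • L + 1) := by
  have hC' : C ∈ opsIn (multipliers side) := by
    simpa using Submodule.add_mem _ (opsIn_mono S_le_multipliers hC) (freeC_mem (side := side) h)
  have hL' : L ∈ opsIn (multipliers side) := by
    simpa using Submodule.add_mem _ (opsIn_mono S_le_multipliers hL)
      (freeLax_mem (side := side) (h := h))
  have hCL := mul_mem_opsIn_multipliers hC' hL'
  have hLC := mul_mem_opsIn_multipliers hL' hC'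
  rw [eq_neg_iff_add_eq_zero]
  refine eq_zero_of_cov hh (u := u) ?_ ?_
  · have h1 : C * L - L * C + (h • L + 1) = (C - freeC h) * L - L * (C - freeC h) +
        (freeC h * (L - freeLax h) - (L - freeLax h) * freeC h) + h • (L - freeLax h) := by
      have h2 := freeC_comm_freeLax hh
      have h3 : h • L + 1 = h • (L - freeLax h) - (freeC h * freeLax h - freeLax h * freeC h) := by
        rw [h2, smul_sub]; abel
      rw [h3]; noncomm_ring
    rw [h1]
    exact Submodule.add_mem _ (Submodule.add_mem _
      (Submodule.sub_mem _ (mul_mem_opsIn_S_left hC hL') (mul_mem_opsIn_S_right hL' hC))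
      (Submodule.sub_mem _ (mul_mem_opsIn_S_right (freeC_mem h) hL)
        (mul_mem_opsIn_S_left hL (freeC_mem h)))) (Submodule.smul_mem _ h hL)
  · rw [cov_add (Submodule.sub_mem _ hCL hLC) (Submodule.add_mem _ (Submodule.smul_mem _ h hL')
      one_mem), cov_sub hCL hLC, cov_mul hC' hL', cov_mul hL' hC',
      cov_add (Submodule.smul_mem _ h hL') one_mem, cov_smul, cov_one, hCc, hLc]
    simp

/-! ### The part with nonnegative powers of `Δ` -/

theorem nonnegPart_coeff (P : PsiDO) {s : ℤ} (hs : 0 ≤ s) : (nonnegPart P).1 s = P.1 s := if_pos hs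

theorem nonnegPart_coeff_of_neg (P : PsiDO) {s : ℤ} (hs : s < 0) : (nonnegPart P).1 s = 0 :=
  if_neg (by omega)

theorem nonnegPart_mem (P : PsiDO) : nonnegPart P ∈ nonneg :=
  fun _ hs => nonnegPart_coeff_of_neg P hs

theorem nonnegPart_of_mem {P : PsiDO} (hP : P ∈ nonneg) : nonnegPart P = P := by
  refine ext_coeff fun s => ?_
  rcases lt_or_ge s 0 with hs | hs
  · rw [nonnegPart_coeff_of_neg P hs, hP s hs]
  · exact nonnegPart_coeff P hs

theorem nonnegPart_sub (P Q : PsiDO) : nonnegPart (P - Q) = nonnegPart P - nonnegPart Q := by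
  refine ext_coeff fun s => ?_
  change _ = (nonnegPart P).1 s - (nonnegPart Q).1 s
  rcases lt_or_ge s 0 with hs | hs
  · rw [nonnegPart_coeff_of_neg _ hs, nonnegPart_coeff_of_neg _ hs, nonnegPart_coeff_of_neg _ hs,
      sub_zero]
  · rw [nonnegPart_coeff _ hs, nonnegPart_coeff _ hs, nonnegPart_coeff _ hs]; rfl

theorem sub_nonnegPart_mem (P : PsiDO) : P - nonnegPart P ∈ degLE (-1) := by
  intro s hs
  change P.1 s - (nonnegPart P).1 s = 0
  rw [nonnegPart_coeff P (by omega), sub_self]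

theorem nonnegPart_mem_degLE {P : PsiDO} {N : ℤ} (hP : P ∈ degLE N) : nonnegPart P ∈ degLE N := by
  intro s hs
  rcases lt_or_ge s 0 with h | h
  · exact nonnegPart_coeff_of_neg P h
  · rw [nonnegPart_coeff P h, hP s hs]

theorem nonnegPart_mem_polyOps {M : Submodule ℝ Coef} {P : S side → PsiDO}
    (hP : P ∈ polyOps side M) : (fun u => nonnegPart (P u)) ∈ polyOps side M := by
  refine ⟨hP.1.imp fun N hN u => nonnegPart_mem_degLE (hN u), fun s => ?_⟩
  rcases lt_or_ge s 0 with h | h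
  · simp only [nonnegPart_coeff_of_neg _ h]; exact Submodule.zero_mem _
  · simp only [nonnegPart_coeff _ h]; exact hP.2 s

theorem eq_monom_zero {P : PsiDO} (h0 : P ∈ nonneg) (h1 : P ∈ degLE 0) : P = monom (P.1 0) 0 := by
  refine ext_coeff fun s => ?_
  rcases lt_trichotomy s 0 with hs | rfl | hs
  · rw [h0 s hs, monom_coeff_of_ne _ hs.ne]
  · rw [monom_coeff_self]
  · rw [h1 s hs, monom_coeff_of_ne _ hs.ne']

/-! ### Flows -/

/-- `P` is a difference operator that tends to `P₀`, and `K = P_x - [A₁, P]`. -/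
structure Flow (h : ℝ) (P₀ : PsiDO) (P : S side → PsiDO) (K : S side → S side) : Prop where
  free_mem : P₀ ∈ opsIn (multipliers side)
  free_nonneg : P₀ ∈ nonneg
  op_nonneg : ∀ u, P u ∈ nonneg
  poly : (fun u => P u - P₀) ∈ polyOps side (S side)
  flow_poly : (fun u => (K u).1) ∈ polyFn side (S side)
  zero_curv : ∀ u, cov h u (P u) = monom (K u).1 0

theorem mem_multipliers_of_sub {P P₀ : PsiDO} (h₀ : P₀ ∈ opsIn (multipliers side))
    (h : P - P₀ ∈ opsIn (S side)) : P ∈ opsIn (multipliers side) := by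
  simpa using Submodule.add_mem _ (opsIn_mono S_le_multipliers h) h₀

theorem monom_add (f g : Coef) (s : ℤ) : monom (f + g) s = monom f s + monom g s :=
  Subtype.ext (Pi.single_add (f := fun _ : ℤ => Coef) s f g)

theorem monom_smul (c : ℝ) (f : Coef) (s : ℤ) : monom (c • f) s = c • monom f s :=
  Subtype.ext (Pi.single_smul (f := fun _ : ℤ => Coef) s c f)

theorem monom_sub (f g : Coef) (s : ℤ) : monom (f - g) s = monom f s - monom g s :=
  Subtype.ext (Pi.single_sub (f := fun _ : ℤ => Coef) s f g)

theorem monom_injective (s : ℤ) : Function.Injective fun f => monom f s := by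
  intro f g hfg
  have h := congrArg (fun P : PsiDO => P.1 s) hfg
  simpa only [monom_coeff_self] using h

section Flow

variable {h : ℝ} {P₀ P₀' : PsiDO} {P P' : S side → PsiDO} {K K' : S side → S side}

theorem Flow.mem (H : Flow h P₀ P K) (u : S side) : P u ∈ opsIn (multipliers side) :=
  mem_multipliers_of_sub H.free_mem (polyOps_apply_mem H.poly u)

theorem Flow.add (H : Flow h P₀ P K) (H' : Flow h P₀' P' K') :
    Flow h (P₀ + P₀') (P + P') (K + K') where
  free_mem := Submodule.add_mem _ H.free_mem H'.free_mem
  free_nonneg := Submodule.add_mem _ H.free_nonneg H'.free_nonneg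
  op_nonneg u := Submodule.add_mem _ (H.op_nonneg u) (H'.op_nonneg u)
  poly := by
    convert Submodule.add_mem _ H.poly H'.poly using 1
    funext u
    exact add_sub_add_comm _ _ _ _
  flow_poly := Submodule.add_mem _ H.flow_poly H'.flow_poly
  zero_curv u := by
    change cov h u (P u + P' u) = monom ((K u).1 + (K' u).1) 0
    rw [cov_add (H.mem u) (H'.mem u), H.zero_curv, H'.zero_curv, monom_add]

theorem Flow.smul (c : ℝ) (H : Flow h P₀ P K) : Flow h (c • P₀) (c • P) (c • K) where
  free_mem := Submodule.smul_mem _ c H.free_mem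
  free_nonneg := Submodule.smul_mem _ c H.free_nonneg
  op_nonneg u := Submodule.smul_mem _ c (H.op_nonneg u)
  poly := by
    convert Submodule.smul_mem _ c H.poly using 1
    funext u
    exact (smul_sub c _ _).symm
  flow_poly := Submodule.smul_mem _ c H.flow_poly
  zero_curv u := by
    change cov h u (c • P u) = monom (c • (K u).1) 0
    rw [cov_smul, H.zero_curv, monom_smul]

theorem Flow.zero : Flow h 0 (0 : S side → PsiDO) 0 where
  free_mem := Submodule.zero_mem _
  free_nonneg := Submodule.zero_mem _
  op_nonneg _ := Submodule.zero_mem _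
  poly := by
    convert Submodule.zero_mem _ using 1
    funext u
    exact sub_zero _
  flow_poly := Submodule.zero_mem _
  zero_curv u := by
    have h1 : monom 0 0 = 0 := by simpa using monom_smul 0 0 0
    exact cov_zero.trans h1.symm

theorem hasDeriv_opA₁ (u v : S side) :
    HasOpGateauxDeriv (fun u : S side => opA₁ h u) u v (monom v.1 0) := by
  have := (hasOpGateauxDeriv_const (freeLax h)).add (HasOpGateauxDeriv.monom
    (f := fun u : S side => u.1) (u := u) (v := v) (f' := v.1) (fun n x => by
      have := ((hasDerivAt_id (0 : ℝ)).mul_const (v.1 n x)).const_add (u.1 n x)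
      rw [one_mul] at this
      exact this) 0)
  rwa [zero_add] at this

/-- This is the zero curvature equation linearised in the direction v, with X = P'[v] and A₁'[v] =
v. -/
theorem Flow.hasDeriv (H : Flow h P₀ P K) (u v : S side) : ∃ X ∈ opsIn (S side), X ∈ nonneg ∧
    monom (dFn (fun u => (K u).1) u v) 0 =
      cov h u X - (monom v.1 0 * P u - P u * monom v.1 0) := by
  obtain ⟨X, hX, hX0, hd, hdx⟩ := polyOps_hasDeriv H.poly u v
  have hfree : P₀ ∈ opsIn (multipliers side) := H.free_mem
  have hdP : HasOpGateauxDeriv P u v X := by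
    have := hd.add (hasOpGateauxDeriv_const P₀)
    rw [add_zero] at this
    convert this using 1
    funext u
    exact (sub_add_cancel _ _).symm
  have hdxP : HasOpGateauxDeriv (fun u => opDx (P u)) u v (opDx X) := by
    have := hdx.add (hasOpGateauxDeriv_const (opDx P₀))
    rw [add_zero] at this
    convert this using 1
    funext u
    change _ = opDx (P u - P₀) + opDx P₀
    rw [opDx_sub (H.mem u) hfree, sub_add_cancel]
  have hdA := hasDeriv_opA₁ (h := h) u v
  have hPb : ∃ N, ∀ u, P u ∈ degLE N := by
    obtain ⟨N, hN⟩ := H.poly.1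
    obtain ⟨M, hM⟩ := exists_mem_degLE P₀
    refine ⟨max N M, fun u => ?_⟩
    simpa using Submodule.add_mem _ (degLE_mono (le_max_left N M) (hN u))
      (degLE_mono (le_max_right N M) hM)
  have hAb : ∃ N, ∀ u : S side, opA₁ h u ∈ degLE N := ⟨1, fun u => opA₁_mem_degLE⟩
  refine ⟨X, hX, fun s hs => hX0 s fun u => ?_, ?_⟩
  · change (P u).1 s - P₀.1 s = 0
    rw [H.op_nonneg u s hs, H.free_nonneg s hs, sub_zero]
  · have h1 := hdxP.sub ((hdA.mul hdP hAb hPb).sub (hdP.mul hdA hPb hAb))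
    have h2 := HasOpGateauxDeriv.monom (f := fun u => (K u).1) (u := u) (v := v)
      ((polyFn_hasDerivAt H.flow_poly u v).2 id linearOn_id) 0
    have h3 : (fun u => monom (K u).1 0) = (fun u => opDx (P u)) -
        ((fun u : S side => opA₁ h u) * P - P * fun u : S side => opA₁ h u) :=
      funext fun u => (H.zero_curv u).symm
    rw [h3] at h2
    have h4 := h2.unique h1
    rw [cov_eq]
    refine h4.trans ?_
    noncomm_ring

/-- If `[P₀, P₀'] = P₀''`, then the product of the flows of `P₀` and `P₀'` is that of `P₀''`. -/
theorem Flow.bracket (hh : h ≠ 0) {P₀'' : PsiDO} {P'' : S side → PsiDO} {K'' : S side → S side}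
    (H : Flow h P₀ P K) (H' : Flow h P₀' P' K') (H'' : Flow h P₀'' P'' K'')
    (h₀ : P₀ * P₀' - P₀' * P₀ = P₀'') (u : S side) :
    dFn (fun u => (K u).1) u (K' u) - dFn (fun u => (K' u).1) u (K u) = (K'' u).1 := by
  obtain ⟨X, hX, hX0, hXc⟩ := H.hasDeriv u (K' u)
  obtain ⟨X', hX', hX0', hXc'⟩ := H'.hasDeriv u (K u)
  have hXm := opsIn_mono S_le_multipliers hX
  have hXm' := opsIn_mono S_le_multipliers hX'
  have hPP := mul_mem_opsIn_multipliers (H.mem u) (H'.mem u)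
  have hPP' := mul_mem_opsIn_multipliers (H'.mem u) (H.mem u)
  -- G is the defect of zero curvature for the commuted flows. Applying `cov`, the commutators with
  -- K and K' cancel and a multiplication operator is left, so G must vanish.
  set G := X - X' + (P u * P' u - P' u * P u) - P'' u with hG
  have hGc : cov h u G = monom (dFn (fun u => (K u).1) u (K' u) - dFn (fun u => (K' u).1) u (K u)
      - (K'' u).1) 0 := by
    rw [hG, cov_sub (Submodule.add_mem _ (Submodule.sub_mem _ hXm hXm')
      (Submodule.sub_mem _ hPP hPP')) (H''.mem u), cov_add (Submodule.sub_mem _ hXm hXm')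
      (Submodule.sub_mem _ hPP hPP'), cov_sub hXm hXm', cov_sub hPP hPP',
      cov_mul (H.mem u) (H'.mem u), cov_mul (H'.mem u) (H.mem u), H.zero_curv, H'.zero_curv, H''.zero_curv,
      monom_sub, monom_sub, hXc, hXc']
    abel
  -- The free parts, whose coefficients need not decay, cancel by [P₀, P₀'] = P₀''; each remaining
  -- term has a factor over `S`.
  have hGS : G ∈ opsIn (S side) := by
    have hp := polyOps_apply_mem H.poly u
    have hp' := polyOps_apply_mem H'.poly u
    have hp'' := polyOps_apply_mem H''.poly u
    have h1 : G = X - X' + ((P u - P₀) * P' u - P' u * (P u - P₀)) +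
        (P₀ * (P' u - P₀') - (P' u - P₀') * P₀) - (P'' u - P₀'') := by
      rw [hG, ← h₀]; noncomm_ring
    rw [h1]
    exact Submodule.sub_mem _ (Submodule.add_mem _ (Submodule.add_mem _ (Submodule.sub_mem _ hX hX')
      (Submodule.sub_mem _ (mul_mem_opsIn_S_left hp (H'.mem u))
        (mul_mem_opsIn_S_right (H'.mem u) hp))) (Submodule.sub_mem _
      (mul_mem_opsIn_S_right H.free_mem hp') (mul_mem_opsIn_S_left hp' H.free_mem))) hp''
  have hGn : G ∈ nonneg := Submodule.sub_mem _ (Submodule.add_mem _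
    (Submodule.sub_mem _ hX0 hX0') (Submodule.sub_mem _ (mul_mem_nonneg (H.op_nonneg u) (H'.op_nonneg u))
      (mul_mem_nonneg (H'.op_nonneg u) (H.op_nonneg u)))) (H''.op_nonneg u)
  have hG0 : G = 0 := eq_zero_of_cov_mem_degLE_zero hh hGS hGn (by
    rw [hGc]; exact monom_mem_degLE _ 0)
  rw [hG0, cov_zero, ← (by simpa using monom_smul 0 0 0 : monom 0 0 = 0)] at hGc
  exact sub_eq_zero.1 (monom_injective 0 hGc).symm

/-- The projection of a dressed operator to its nonnegative part is a flow. -/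
theorem exists_flow {Q₀ : PsiDO} {Q : S side → PsiDO} (hQ₀ : Q₀ ∈ opsIn (multipliers side))
    (hn : Q₀ ∈ nonneg) (hQ : (fun u => Q u - Q₀) ∈ polyOps side (S side))
    (hc : ∀ u, cov h u (Q u) = 0) :
    ∃ K : S side → S side, Flow h Q₀ (fun u => nonnegPart (Q u)) K := by
  have hP : (fun u => nonnegPart (Q u) - Q₀) ∈ polyOps side (S side) := by
    have := nonnegPart_mem_polyOps hQ
    simpa only [nonnegPart_sub, nonnegPart_of_mem hn] using this
  have hneg : (fun u => Q u - nonnegPart (Q u)) ∈ polyOps side (S side) := by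
    convert Submodule.sub_mem _ hQ hP using 1
    funext u
    exact (sub_sub_sub_cancel_right _ _ _).symm
  have hcov := cov_mem_polyOps (h := h) hneg
  have hK := Submodule.neg_mem _ (hcov.2 0)
  have hc' : ∀ u, cov h u (nonnegPart (Q u)) = -cov h u (Q u - nonnegPart (Q u)) := by
    intro u
    rw [cov_sub (mem_multipliers_of_sub hQ₀ (polyOps_apply_mem hQ u))
      (mem_multipliers_of_sub hQ₀ (polyOps_apply_mem hP u)), hc, zero_sub, neg_neg]
  refine ⟨fun u => ⟨_, polyFn_apply_mem hK u⟩, hQ₀, hn, fun u => nonnegPart_mem _, hP, hK,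
    fun u => ?_⟩
  -- The discarded part has order at most -1, and `cov` raises the order by at most one.
  have h1 : cov h u (nonnegPart (Q u)) ∈ degLE 0 := by
    rw [hc']
    exact Submodule.neg_mem _ (cov_mem_degLE (sub_nonnegPart_mem _))
  rw [eq_monom_zero (cov_mem_nonneg (nonnegPart_mem _)) h1, hc']
  rfl

/-- At u = 0 the difference P - P₀ is a difference operator over `S` with `cov` of order at most 0.
-/
theorem Flow.apply_zero (hh : h ≠ 0) (H : Flow h P₀ P K) (h0 : cov h (0 : S side) P₀ = 0) :
    P 0 = P₀ ∧ K 0 = 0 := by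
  have h1 : P 0 - P₀ = 0 := by
    refine eq_zero_of_cov_mem_degLE_zero hh (polyOps_apply_mem H.poly 0)
      (Submodule.sub_mem _ (H.op_nonneg 0) H.free_nonneg) ?_ (h := h) (u := 0)
    rw [cov_sub (H.mem 0) H.free_mem, h0, sub_zero, H.zero_curv]
    exact monom_mem_degLE _ 0
  have h2 := sub_eq_zero.1 h1
  refine ⟨h2, Subtype.ext (monom_injective 0 ?_)⟩
  have h3 := H.zero_curv 0
  rw [h2, h0] at h3
  change monom (K 0).1 0 = monom 0 0
  rw [← h3]
  simpa using (monom_smul 0 0 0).symm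

/-- The Lax equation of a flow. -/
theorem Flow.lax (hh : h ≠ 0) {L Q : S side → PsiDO} (hL : IsLax h L)
    (hLp : (fun u => L u - freeLax h) ∈ polyOps side (S side)) (H : Flow h P₀ P K)
    (hQ : ∀ u, Q u - P₀ ∈ opsIn (S side)) (hc : ∀ u, cov h u (Q u) = 0) (u : S side) :
    HasOpGateauxDeriv L u (K u) (P u * L u - L u * P u - (Q u * L u - L u * Q u)) := by
  set v := K u with hv
  obtain ⟨X, hX, -, hd, hdx⟩ := polyOps_hasDeriv hLp u v
  have hLm : ∀ u, L u ∈ opsIn (multipliers side) := isLax_mem_multipliers hL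
  have hdL : HasOpGateauxDeriv L u v X := by
    have := hd.add (hasOpGateauxDeriv_const (freeLax h))
    rw [add_zero] at this
    convert this using 1
    funext u
    exact (sub_add_cancel _ _).symm
  have hdxL : HasOpGateauxDeriv (fun u => opDx (L u)) u v (opDx X) := by
    convert hdx using 1
    funext u
    rw [opDx_sub (hLm u) freeLax_mem, opDx_freeLax, sub_zero]
  have hLb : ∃ N, ∀ u, L u ∈ degLE N := ⟨1, fun u => by
    simpa using Submodule.add_mem _ (degLE_mono (by norm_num) (hL.deg u)) (opA₁_mem_degLE (h := h) (u := u))⟩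
  have h1 := (hasDeriv_opA₁ (h := h) u v).mul hdL ⟨1, fun u => opA₁_mem_degLE⟩ hLb
  have h2 := hdL.mul (hasDeriv_opA₁ (h := h) u v) hLb ⟨1, fun u => opA₁_mem_degLE⟩
  have h3 : (fun u => opDx (L u)) = (fun u : S side => opA₁ h u) * L -
      L * fun u : S side => opA₁ h u := by
    funext u
    exact sub_eq_zero.1 (hL.cov u)
  rw [h3] at hdxL
  have h4 := hdxL.unique (h1.sub h2)
  -- Differentiating L_x = [A₁, L] along the flow gives `cov (L'[K]) = [K, L]`. Since `cov P = K`,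
  -- this is also the image of [P, L], while [Q, L] is killed.
  have h5 : cov h u X = monom v.1 0 * L u - L u * monom v.1 0 := by
    rw [cov_eq, h4]; noncomm_ring
  have hQm := mem_multipliers_of_sub H.free_mem (hQ u)
  have hPL := mul_mem_opsIn_multipliers (H.mem u) (hLm u)
  have hLP := mul_mem_opsIn_multipliers (hLm u) (H.mem u)
  have hQL := mul_mem_opsIn_multipliers hQm (hLm u)
  have hLQ := mul_mem_opsIn_multipliers (hLm u) hQm
  suffices h6 : X - (P u * L u - L u * P u - (Q u * L u - L u * Q u)) = 0 by
    rwa [sub_eq_zero.1 h6] at hdL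
  refine eq_zero_of_cov hh (u := u) ?_ ?_
  -- P and Q agree modulo `S`, so the commutator of their difference with L has coefficients in `S`.
  · have h7 : X - (P u * L u - L u * P u - (Q u * L u - L u * Q u)) =
        X + ((Q u - P₀ - (P u - P₀)) * L u - L u * (Q u - P₀ - (P u - P₀))) := by noncomm_ring
    have h8 := Submodule.sub_mem _ (hQ u) (polyOps_apply_mem H.poly u)
    rw [h7]
    exact Submodule.add_mem _ hX (Submodule.sub_mem _ (mul_mem_opsIn_S_left h8 (hLm u))
      (mul_mem_opsIn_S_right (hLm u) h8))
  · rw [cov_sub (opsIn_mono S_le_multipliers hX) (Submodule.sub_mem _ (Submodule.sub_mem _ hPL hLP)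
      (Submodule.sub_mem _ hQL hLQ)), cov_sub (Submodule.sub_mem _ hPL hLP)
      (Submodule.sub_mem _ hQL hLQ), cov_sub hPL hLP, cov_sub hQL hLQ, cov_mul (H.mem u) (hLm u),
      cov_mul (hLm u) (H.mem u), cov_mul hQm (hLm u), cov_mul (hLm u) hQm, hc, hL.cov, h5,
      H.zero_curv]
    noncomm_ring

theorem Flow.isDeformation (hh : h ≠ 0) (H : Flow h P₀ P K) (h0 : cov h (0 : S side) P₀ = 0) {d : ℕ}
    (hd : ∀ u, P u - P₀ ∈ degLE ((d : ℤ) - 1)) : IsDeformation d P₀ P := by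
  refine ⟨fun u => polyOps_apply_mem H.poly u, fun u s hs => ?_, (H.apply_zero hh h0).1⟩
  rcases lt_or_ge s 0 with h1 | h1
  · rw [H.op_nonneg u s h1, H.free_nonneg s h1]
  · exact sub_eq_zero.1 (hd u s (by omega))

/-- The zero curvature equation determines the operator and the flow. -/
theorem zero_curvature_unique (hh : h ≠ 0) {d : ℕ} (h₀ : P₀ ∈ opsIn (multipliers side))
    (hP : IsDeformation d P₀ P) (hP' : IsDeformation d P₀ P')
    (hK : ∀ u, monom (K u).1 0 - opDx (P u) + opComm (opA₁ h u) (P u) = 0)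
    (hK' : ∀ u, monom (K' u).1 0 - opDx (P' u) + opComm (opA₁ h u) (P' u) = 0) :
    P = P' ∧ K = K' := by
  have h1 : ∀ {P : S side → PsiDO} {K : S side → S side},
      (∀ u, monom (K u).1 0 - opDx (P u) + opComm (opA₁ h u) (P u) = 0) →
      ∀ u, monom (K u).1 0 = cov h u (P u) := by
    intro P K hK u
    rw [← sub_eq_zero, ← hK u, cov]
    abel
  have hc := h1 hK
  have hc' := h1 hK'
  have hm := fun u => mem_multipliers_of_sub h₀ (fun s => hP.1 u s : P u - P₀ ∈ opsIn (S side))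
  have hm' := fun u => mem_multipliers_of_sub h₀ (fun s => hP'.1 u s : P' u - P₀ ∈ opsIn (S side))
  -- Zero curvature alone decides this, pointwise in u; neither differentiability nor the Lax
  -- equation enters.
  have h2 : P = P' := by
    funext u
    rw [← sub_eq_zero]
    refine eq_zero_of_cov_mem_degLE_zero hh (u := u) (fun s => ?_) (fun s hs => ?_) ?_
    · have := (S side).sub_mem (hP.1 u s) (hP'.1 u s)
      rwa [sub_sub_sub_cancel_right] at this
    · change (P u).1 s - (P' u).1 s = 0
      rw [hP.2.1 u s (by omega), hP'.2.1 u s (by omega), sub_self]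
    · rw [cov_sub (hm u) (hm' u), ← hc, ← hc']
      exact Submodule.sub_mem _ (monom_mem_degLE _ 0) (monom_mem_degLE _ 0)
  subst h2
  refine ⟨rfl, funext fun u => Subtype.ext (monom_injective 0 ?_)⟩
  exact (hc u).trans (hc' u).symm

end Flow

/-! ### The Lie product of polynomial functionals -/

/-- The polynomial functionals with values in `S side`. -/
def polyFields (side : ℤˣ) : Submodule ℝ (S side → S side) where
  carrier := {f | (fun u => (f u).1) ∈ polyFn side (S side)}
  zero_mem' := Submodule.zero_mem (polyFn side (S side))
  add_mem' := fun {f g} (hf : (fun u => (f u).1) ∈ polyFn side (S side))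
      (hg : (fun u => (g u).1) ∈ polyFn side (S side)) =>
    Submodule.add_mem (polyFn side (S side)) hf hg
  smul_mem' := fun c f (hf : (fun u => (f u).1) ∈ polyFn side (S side)) =>
    Submodule.smul_mem (polyFn side (S side)) c hf

section LieProd

variable {f g k : S side → S side}

theorem hasGateauxDeriv_of_mem (hf : f ∈ polyFields side) (u v : S side) :
    HasGateauxDeriv f u v ⟨dFn (fun u => (f u).1) u v, (polyFn_hasDerivAt hf u v).1⟩ :=
  (polyFn_hasDerivAt (f := fun u => (f u).1) hf u v).2 id linearOn_id

theorem gateauxDifferentiable_of_mem (hf : f ∈ polyFields side) : GateauxDifferentiable f :=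
  fun u v => ⟨_, hasGateauxDeriv_of_mem hf u v⟩

theorem gateaux_apply (hf : f ∈ polyFields side) (g : S side → S side) (u : S side) :
    (gateaux f g u).1 = dFn (fun u => (f u).1) u (g u) := by
  have H : ∃ d, HasGateauxDeriv f u (g u) d := gateauxDifferentiable_of_mem hf u (g u)
  rw [gateaux, dif_pos H]
  funext n x
  exact (H.choose_spec n x).unique (hasGateauxDeriv_of_mem hf u (g u) n x)

theorem lieProd_apply (hf : f ∈ polyFields side) (hg : g ∈ polyFields side) (u : S side) :
    (lieProd f g u).1 = dFn (fun u => (f u).1) u (g u) - dFn (fun u => (g u).1) u (f u) := by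
  rw [← gateaux_apply hf, ← gateaux_apply hg]
  rfl

theorem lieProd_antisymm (f g : S side → S side) : lieProd f g = -lieProd g f :=
  (neg_sub _ _).symm

theorem lieProd_linear_left (hf : f ∈ polyFields side) (hg : g ∈ polyFields side)
    (hk : k ∈ polyFields side) (c d : ℝ) :
    lieProd (c • f + d • g) k = c • lieProd f k + d • lieProd g k := by
  have hfg : c • f + d • g ∈ polyFields side :=
    Submodule.add_mem _ (Submodule.smul_mem _ c hf) (Submodule.smul_mem _ d hg)
  funext u
  refine Subtype.ext ?_
  change _ = c • (lieProd f k u).1 + d • (lieProd g k u).1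
  have h1 : dFn (fun u => ((c • f + d • g) u).1) u (k u) =
      c • dFn (fun u => (f u).1) u (k u) + d • dFn (fun u => (g u).1) u (k u) := by
    funext n x
    exact (((hasGateauxDeriv_of_mem hf u (k u) n x).const_mul c).add
      ((hasGateauxDeriv_of_mem hg u (k u) n x).const_mul d)).deriv
  have h2 : dFn (fun u => (k u).1) u ((c • f + d • g) u) =
      c • dFn (fun u => (k u).1) u (f u) + d • dFn (fun u => (k u).1) u (g u) :=
    dFn_linear hk u (f u) (g u) c d
  rw [lieProd_apply hfg hk, lieProd_apply hf hk, lieProd_apply hg hk, h1, h2]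
  module

theorem lieProd_add_left (hf : f ∈ polyFields side) (hg : g ∈ polyFields side)
    (hk : k ∈ polyFields side) : lieProd (f + g) k = lieProd f k + lieProd g k := by
  simpa using lieProd_linear_left hf hg hk 1 1

theorem lieProd_smul_left (c : ℝ) (hf : f ∈ polyFields side) (hk : k ∈ polyFields side) :
    lieProd (c • f) k = c • lieProd f k := by
  simpa using lieProd_linear_left hf (Submodule.zero_mem _) hk c 0

theorem lieProd_add_right (hf : f ∈ polyFields side) (hg : g ∈ polyFields side)
    (hk : k ∈ polyFields side) : lieProd f (g + k) = lieProd f g + lieProd f k := by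
  rw [lieProd_antisymm, lieProd_add_left hg hk hf, lieProd_antisymm f g, lieProd_antisymm f k,
    neg_add]

theorem lieProd_smul_right (c : ℝ) (hf : f ∈ polyFields side) (hk : k ∈ polyFields side) :
    lieProd f (c • k) = c • lieProd f k := by
  rw [lieProd_antisymm, lieProd_smul_left c hk hf, lieProd_antisymm f k, smul_neg]

theorem Flow.lieProd_eq {h : ℝ} (hh : h ≠ 0) {P₀ P₀' P₀'' : PsiDO} {P P' P'' : S side → PsiDO}
    {K K' K'' : S side → S side} (H : Flow h P₀ P K) (H' : Flow h P₀' P' K')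
    (H'' : Flow h P₀'' P'' K'') (h₀ : P₀ * P₀' - P₀' * P₀ = P₀'') : lieProd K K' = K'' := by
  funext u
  refine Subtype.ext ?_
  rw [lieProd_apply H.flow_poly H'.flow_poly]
  exact H.bracket hh H' H'' h₀ u

end LieProd

/-! ### A polynomial model of the algebra of flows -/

section Model

open Polynomial

variable {h : ℝ}

/-- The bracket of `p₁ + (1 + h η) q₁ ∂` and `p₂ + (1 + h η) q₂ ∂`, up to sign, for polynomials
in `η`. -/
def pairBracket (h : ℝ) (x y : ℝ[X] × ℝ[X]) : ℝ[X] × ℝ[X] :=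
  ((1 + monomial 1 h) * (y.2 * derivative x.1 - x.2 * derivative y.1),
    (1 + monomial 1 h) * (derivative x.2 * y.2 - x.2 * derivative y.2))

theorem pairBracket_jacobi (x y z : ℝ[X] × ℝ[X]) :
    pairBracket h (pairBracket h x y) z + pairBracket h (pairBracket h y z) x +
      pairBracket h (pairBracket h z x) y = 0 := by
  ext1
  · simp only [pairBracket, Prod.fst_add, derivative_mul, derivative_sub, derivative_add,
      Prod.fst_zero]
    ring
  · simp only [pairBracket, Prod.snd_add, derivative_mul, derivative_sub, derivative_add,
      Prod.snd_zero]
    ring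

theorem pairBracket_add_left (x y z : ℝ[X] × ℝ[X]) :
    pairBracket h (x + y) z = pairBracket h x z + pairBracket h y z := by
  ext1 <;> simp only [pairBracket, Prod.fst_add, Prod.snd_add, derivative_add] <;> ring

theorem pairBracket_smul_left (c : ℝ) (x z : ℝ[X] × ℝ[X]) :
    pairBracket h (c • x) z = c • pairBracket h x z := by
  ext1 <;> simp only [pairBracket, Prod.smul_fst, Prod.smul_snd, derivative_smul] <;>
    simp only [smul_eq_C_mul] <;> ring

theorem pairBracket_antisymm (x y : ℝ[X] × ℝ[X]) : pairBracket h x y = -pairBracket h y x := by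
  ext1 <;> simp only [pairBracket, Prod.fst_neg, Prod.snd_neg] <;> ring

theorem pairBracket_add_right (x y z : ℝ[X] × ℝ[X]) :
    pairBracket h x (y + z) = pairBracket h x y + pairBracket h x z := by
  rw [pairBracket_antisymm, pairBracket_add_left, neg_add, ← pairBracket_antisymm,
    ← pairBracket_antisymm]

theorem pairBracket_smul_right (c : ℝ) (x z : ℝ[X] × ℝ[X]) :
    pairBracket h x (c • z) = c • pairBracket h x z := by
  rw [pairBracket_antisymm, pairBracket_smul_left, ← smul_neg, ← pairBracket_antisymm]

/-- For a = 0 the truncated exponent a + b - 1 is harmless, because the factor a is zero. -/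
theorem monomial_mul_derivative (a b : ℕ) :
    (1 + monomial 1 h) * (monomial b (1 : ℝ) * derivative (monomial a 1)) =
      (a : ℝ) • (h • monomial (a + b) 1 + monomial (a + b - 1) 1) := by
  rcases a with _ | a
  · simp
  · rw [derivative_monomial, monomial_mul_monomial, add_mul, monomial_mul_monomial, smul_add,
      smul_smul, smul_monomial, smul_monomial, one_mul, add_comm]
    congr 2
    · congr 1; omega
    · simp [mul_comm]
    · congr 1; omega
    · simp

variable (K τ : ℕ → S side → S side)

/-- The linear map with `(η ^ a, 0) ↦ K a` and `(0, η ^ a) ↦ τ a`. -/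
def modelMap : ℝ[X] × ℝ[X] →ₗ[ℝ] (S side → S side) :=
  ((basisMonomials ℝ).constr ℝ K).coprod ((basisMonomials ℝ).constr ℝ τ)

theorem constr_monomial (f : ℕ → S side → S side) (a : ℕ) :
    (basisMonomials ℝ).constr ℝ f (monomial a 1) = f a := by
  have := (basisMonomials ℝ).constr_basis ℝ f a
  rwa [coe_basisMonomials] at this

theorem modelMap_left (a : ℕ) : modelMap K τ (monomial a 1, 0) = K a := by
  simp [modelMap, constr_monomial]

theorem modelMap_right (a : ℕ) : modelMap K τ (0, monomial a 1) = τ a := by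
  simp [modelMap, constr_monomial]

theorem constr_mem {f : ℕ → S side → S side} {X : Submodule ℝ (S side → S side)}
    (hf : ∀ a, f a ∈ X) (p : ℝ[X]) : (basisMonomials ℝ).constr ℝ f p ∈ X := by
  rw [Module.Basis.constr_apply]
  exact Submodule.sum_mem _ fun a _ => X.smul_mem _ (hf a)

theorem modelMap_mem {X : Submodule ℝ (S side → S side)} {K τ : ℕ → S side → S side}
    (hK : ∀ a, K a ∈ X) (hτ : ∀ a, τ a ∈ X) (x : ℝ[X] × ℝ[X]) : modelMap K τ x ∈ X :=
  X.add_mem (constr_mem hK x.1) (constr_mem hτ x.2)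

variable {K τ}

theorem lieProd_modelMap (hK : ∀ a, K a ∈ polyFields side) (hτ : ∀ a, τ a ∈ polyFields side)
    (hKK : ∀ a b, lieProd (K a) (K b) = 0)
    (hKτ : ∀ a b : ℕ, lieProd (K a) (τ b) = (a : ℝ) • (h • K (a + b) + K (a + b - 1)))
    (hττ : ∀ a b : ℕ,
      lieProd (τ a) (τ b) = ((a : ℝ) - b) • (h • τ (a + b) + τ (a + b - 1)))
    (x y : ℝ[X] × ℝ[X]) :
    lieProd (modelMap K τ x) (modelMap K τ y) = modelMap K τ (pairBracket h x y) := by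
  have hm := modelMap_mem hK hτ
  -- `lieProd` is shown to be bilinear only on polynomial fields, so both sides are pulled back to
  -- pairs of polynomials, where bilinear maps can be compared on monomials.
  let B : ℝ[X] × ℝ[X] →ₗ[ℝ] ℝ[X] × ℝ[X] →ₗ[ℝ] (S side → S side) :=
    LinearMap.mk₂ ℝ (fun x y => lieProd (modelMap K τ x) (modelMap K τ y))
      (fun x y z => by rw [map_add, lieProd_add_left (hm x) (hm y) (hm z)])
      (fun c x y => by rw [map_smul, lieProd_smul_left c (hm x) (hm y)])
      (fun x y z => by rw [map_add, lieProd_add_right (hm x) (hm y) (hm z)])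
      (fun c x y => by rw [map_smul, lieProd_smul_right c (hm x) (hm y)])
  let B' : ℝ[X] × ℝ[X] →ₗ[ℝ] ℝ[X] × ℝ[X] →ₗ[ℝ] (S side → S side) :=
    LinearMap.mk₂ ℝ (fun x y => modelMap K τ (pairBracket h x y))
      (fun x y z => by rw [pairBracket_add_left, map_add])
      (fun c x y => by rw [pairBracket_smul_left, map_smul])
      (fun x y z => by rw [pairBracket_add_right, map_add])
      (fun c x y => by rw [pairBracket_smul_right, map_smul])
  have hl : ∀ p : ℝ[X], modelMap K τ (p, 0) = (basisMonomials ℝ).constr ℝ K p := fun p => by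
    simp [modelMap]
  have hr : ∀ p : ℝ[X], modelMap K τ (0, p) = (basisMonomials ℝ).constr ℝ τ p := fun p => by
    simp [modelMap]
  have e1 : ∀ a b : ℕ, pairBracket h (monomial a 1, 0) (monomial b 1, 0) = 0 := fun a b => by
    simp [pairBracket]
  have e2 : ∀ a b : ℕ, pairBracket h (monomial a 1, 0) (0, monomial b 1) =
      ((a : ℝ) • (h • monomial (a + b) 1 + monomial (a + b - 1) 1), 0) := fun a b => by
    rw [← monomial_mul_derivative]; simp [pairBracket]
  have e3 : ∀ a b : ℕ, pairBracket h (0, monomial a 1) (0, monomial b 1) =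
      (0, ((a : ℝ) - b) • (h • monomial (a + b) 1 + monomial (a + b - 1) 1)) := fun a b => by
    have h1 := monomial_mul_derivative (h := h) b a
    rw [add_comm b a] at h1
    rw [sub_smul, ← monomial_mul_derivative, ← h1]
    ext1
    · simp [pairBracket]
    · simp only [pairBracket]; ring
  have e2' : ∀ a b : ℕ, lieProd (modelMap K τ (monomial a 1, 0)) (modelMap K τ (0, monomial b 1)) =
      modelMap K τ (pairBracket h (monomial a 1, 0) (0, monomial b 1)) := fun a b => by
    rw [modelMap_left, modelMap_right, hKτ, e2, hl, map_smul, map_add, map_smul, constr_monomial,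
      constr_monomial]
  have key : B = B' := by
    refine LinearMap.prod_ext (lhom_ext' fun a => LinearMap.ext_ring ?_)
      (lhom_ext' fun a => LinearMap.ext_ring ?_) <;>
    refine LinearMap.prod_ext (lhom_ext' fun b => LinearMap.ext_ring ?_)
      (lhom_ext' fun b => LinearMap.ext_ring ?_)
    · change lieProd (modelMap K τ (monomial a 1, 0)) (modelMap K τ (monomial b 1, 0)) =
        modelMap K τ (pairBracket h (monomial a 1, 0) (monomial b 1, 0))
      rw [modelMap_left, modelMap_left, hKK, e1, map_zero]
    · exact e2' a b
    · change lieProd (modelMap K τ (0, monomial a 1)) (modelMap K τ (monomial b 1, 0)) =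
        modelMap K τ (pairBracket h (0, monomial a 1) (monomial b 1, 0))
      rw [lieProd_antisymm, pairBracket_antisymm, map_neg, e2']
    · change lieProd (modelMap K τ (0, monomial a 1)) (modelMap K τ (0, monomial b 1)) =
        modelMap K τ (pairBracket h (0, monomial a 1) (0, monomial b 1))
      rw [modelMap_right, modelMap_right, hττ, e3, hr, map_smul, map_add, map_smul,
        constr_monomial, constr_monomial]
  exact LinearMap.congr_fun (LinearMap.congr_fun key x) y

/-- Intertwining the brackets suffices, injectivity of `modelMap` is not needed, and the Jacobi
identity for flows comes from that of `pairBracket`. -/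
theorem isLieAlgebraUnder_range {h : ℝ}
    (hΦ : ∀ x y, lieProd (modelMap K τ x) (modelMap K τ y) = modelMap K τ (pairBracket h x y)) :
    IsLieAlgebraUnder lieProd (LinearMap.range (modelMap K τ)) where
  closed := by
    rintro _ ⟨x, rfl⟩ _ ⟨y, rfl⟩
    exact ⟨_, (hΦ x y).symm⟩
  add_left := by
    rintro _ ⟨x, rfl⟩ _ ⟨y, rfl⟩ _ ⟨z, rfl⟩
    rw [← map_add, hΦ, hΦ, hΦ, pairBracket_add_left, map_add]
  smul_left := by
    rintro c _ ⟨x, rfl⟩ _ ⟨y, rfl⟩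
    rw [← map_smul, hΦ, hΦ, pairBracket_smul_left, map_smul]
  add_right := by
    rintro _ ⟨x, rfl⟩ _ ⟨y, rfl⟩ _ ⟨z, rfl⟩
    rw [← map_add, hΦ, hΦ, hΦ, pairBracket_add_right, map_add]
  smul_right := by
    rintro c _ ⟨x, rfl⟩ _ ⟨y, rfl⟩
    rw [← map_smul, hΦ, hΦ, pairBracket_smul_right, map_smul]
  self f _ := sub_self _
  jacobi := by
    rintro _ ⟨x, rfl⟩ _ ⟨y, rfl⟩ _ ⟨z, rfl⟩
    simp only [hΦ]
    rw [← map_add, ← map_add, pairBracket_jacobi, map_zero]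

theorem range_modelMap {σ : ℕ → S side → S side} (hσ : σ 0 = 0) :
    LinearMap.range (modelMap K fun a => σ (a + 1)) =
      Submodule.span ℝ (Set.range K ∪ Set.range σ) := by
  refine le_antisymm ?_ (Submodule.span_le.2 ?_)
  · rintro _ ⟨x, rfl⟩
    exact modelMap_mem (fun a => Submodule.subset_span (Or.inl ⟨a, rfl⟩))
      (fun a => Submodule.subset_span (Or.inr ⟨a + 1, rfl⟩)) x
  · rintro _ (⟨a, rfl⟩ | ⟨a, rfl⟩)
    · exact ⟨_, modelMap_left _ _ a⟩
    · rcases a with _ | a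
      · rw [hσ]; exact Submodule.zero_mem _
      · exact ⟨_, modelMap_right _ _ a⟩

end Model

/-! ### Powers of the free operators -/

theorem freeLax_mem_nonneg (h : ℝ) : freeLax h ∈ nonneg := monom_mem_nonneg _ zero_le_one

theorem mul_monom_const (c d : ℝ) (s t : ℤ) :
    monom (fun _ _ => c) s * monom (fun _ _ => d) t = monom (fun _ _ => d * c) (s + t) := by
  refine ext_coeff fun k => ?_
  refine (mul_monom_const_coeff _ d t k).trans ?_
  rcases eq_or_ne k (s + t) with rfl | hk
  · rw [add_sub_cancel_right, monom_coeff_self, monom_coeff_self]; rfl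
  · rw [monom_coeff_of_ne _ hk, monom_coeff_of_ne _ (by omega), smul_zero]

theorem freeLax_pow (h : ℝ) (m : ℕ) : freeLax h ^ m = asympA h m := by
  induction m with
  | zero => rw [pow_zero, asympA, pow_zero, inv_one]; rfl
  | succ m ih =>
    rw [pow_succ, ih, asympA, freeLax, mul_monom_const, asympA, pow_succ, mul_inv_rev]
    push_cast
    rfl

theorem freeC_mul_freeLax_pow (h : ℝ) (m : ℕ) : freeC h * freeLax h ^ m = asympB h (m + 1) := by
  refine ext_coeff fun k => ?_
  rw [freeLax_pow]
  refine (mul_monom_const_coeff (freeC h) _ m k).trans ?_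
  change _ • ((monom _ 1).1 (k - m) + (monom _ 0).1 (k - m)) =
    (monom _ _).1 k + (monom _ _).1 k
  rw [smul_add]
  congr 1
  · rcases eq_or_ne k (m + 1 : ℕ) with rfl | hk
    · have : ((m + 1 : ℕ) : ℤ) - m = 1 := by push_cast; ring
      rw [this, monom_coeff_self, monom_coeff_self]; rfl
    · rw [monom_coeff_of_ne _ hk, monom_coeff_of_ne _ (by push_cast at hk; omega), smul_zero]
  · have h1 : ((m + 1 : ℕ) : ℤ) - 1 = m := by push_cast; ring
    rw [h1]
    rcases eq_or_ne k m with rfl | hk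
    · rw [sub_self, monom_coeff_self, monom_coeff_self]; rfl
    · rw [monom_coeff_of_ne _ hk, monom_coeff_of_ne _ (by omega), smul_zero]

/-- Commuting with `freeC` acts on powers of `freeLax` as the derivation (1 + hη) d/dη acts on
powers of η; for a = 0 the truncated exponent has coefficient zero. -/
theorem freeLax_pow_comm_freeC {h : ℝ} (hh : h ≠ 0) (a : ℕ) :
    freeLax h ^ a * freeC h - freeC h * freeLax h ^ a =
      (a : ℝ) • (h • freeLax h ^ a + freeLax h ^ (a - 1)) := by
  induction a with
  | zero => simp
  | succ a ih =>
    have h1 : freeLax h * freeC h - freeC h * freeLax h = h • freeLax h + 1 := by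
      rw [← neg_sub, freeC_comm_freeLax hh, neg_neg]
    have h2 : freeLax h ^ (a + 1) * freeC h - freeC h * freeLax h ^ (a + 1) =
        freeLax h ^ a * (freeLax h * freeC h - freeC h * freeLax h) +
          (freeLax h ^ a * freeC h - freeC h * freeLax h ^ a) * freeLax h := by
      rw [pow_succ]; noncomm_ring
    have h3 : (a : ℝ) • (freeLax h ^ (a - 1) * freeLax h) = (a : ℝ) • freeLax h ^ a := by
      rcases a with _ | a
      · simp
      · rw [Nat.add_sub_cancel, ← pow_succ]
    rw [h2, h1, ih, mul_add, mul_one, mul_smul_comm, smul_mul_assoc, add_mul, smul_add, h3,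
      smul_mul_assoc, ← pow_succ, Nat.add_sub_cancel]
    push_cast
    module

theorem smul_pow_pred_mul (P : PsiDO) (a b : ℕ) :
    (a : ℝ) • (P ^ (a - 1) * P ^ b) = (a : ℝ) • P ^ (a + b - 1) := by
  rcases a with _ | a
  · simp
  · rw [← pow_add]; congr 2; omega

theorem freeLax_pow_comm {h : ℝ} (hh : h ≠ 0) (a b : ℕ) :
    freeLax h ^ a * (freeC h * freeLax h ^ b) - freeC h * freeLax h ^ b * freeLax h ^ a =
      (a : ℝ) • (h • freeLax h ^ (a + b) + freeLax h ^ (a + b - 1)) := by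
  have h1 : freeLax h ^ a * (freeC h * freeLax h ^ b) - freeC h * freeLax h ^ b * freeLax h ^ a =
      (freeLax h ^ a * freeC h - freeC h * freeLax h ^ a) * freeLax h ^ b := by
    rw [mul_assoc (freeC h), (Commute.pow_pow_self (freeLax h) b a).eq]; noncomm_ring
  rw [h1, freeLax_pow_comm_freeC hh, smul_mul_assoc, add_mul, smul_add, smul_pow_pred_mul,
    smul_mul_assoc, ← pow_add, smul_add]

theorem freeC_pow_comm {h : ℝ} (hh : h ≠ 0) (a b : ℕ) :
    freeC h * freeLax h ^ a * (freeC h * freeLax h ^ b) -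
        freeC h * freeLax h ^ b * (freeC h * freeLax h ^ a) =
      ((a : ℝ) - b) • (h • (freeC h * freeLax h ^ (a + b)) + freeC h * freeLax h ^ (a + b - 1)) := by
  have h1 : freeC h * freeLax h ^ a * (freeC h * freeLax h ^ b) -
      freeC h * freeLax h ^ b * (freeC h * freeLax h ^ a) =
      freeC h * (freeLax h ^ a * (freeC h * freeLax h ^ b) -
        freeC h * freeLax h ^ b * freeLax h ^ a) -
      freeC h * (freeLax h ^ b * (freeC h * freeLax h ^ a) -
        freeC h * freeLax h ^ a * freeLax h ^ b) := by
    have h2 := (Commute.pow_pow_self (freeLax h) a b).eq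
    rw [mul_assoc (freeC h) (freeLax h ^ b) (freeLax h ^ a),
      mul_assoc (freeC h) (freeLax h ^ a) (freeLax h ^ b), h2]
    noncomm_ring
  rw [h1, freeLax_pow_comm hh, freeLax_pow_comm hh, add_comm b a, mul_smul_comm, mul_smul_comm,
    mul_add, mul_smul_comm, sub_smul]

theorem cov_zero_freeLax (h : ℝ) : cov h (0 : S side) (freeLax h) = 0 := by
  have h1 : monom 0 0 = 0 := by simpa using monom_smul 0 0 0
  have h2 : opA₁ h (0 : S side) = freeLax h := by
    rw [opA₁_eq]
    change freeLax h + monom 0 0 = _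
    rw [h1, add_zero]
  rw [cov_eq, h2, opDx_freeLax]; noncomm_ring

theorem cov_zero_freeC {h : ℝ} (hh : h ≠ 0) : cov h (0 : S side) (freeC h) = 0 := by
  have h1 : monom (0 : S side).1 0 = 0 := by
    change monom 0 0 = 0
    simpa using monom_smul 0 0 0
  rw [cov_freeC hh, h1]; noncomm_ring

theorem cov_zero_freeC_mul {h : ℝ} (hh : h ≠ 0) (m : ℕ) :
    cov h (0 : S side) (freeC h * freeLax h ^ m) = 0 := by
  rw [cov_mul (freeC_mem h) (pow_mem_opsIn_multipliers freeLax_mem m), cov_zero_freeC hh,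
    cov_pow_eq_zero freeLax_mem (cov_zero_freeLax h), zero_mul, mul_zero, add_zero]

/-! ### The Lax operator and its coefficients -/

section Lax

variable {h : ℝ}

/-- The normalisation w 0 = u makes L agree with A₁ in orders 1 and 0, leaving a difference of order
at most -1. -/
theorem isLax_of_isLaxCoefficients {w : ℕ → S side → S side} (hw : IsLaxCoefficients h w) :
    IsLax h fun u => laxOp h fun j => w j u := by
  have h1 : ∀ u s, (-1 < s → (laxOp h (fun j => w j u) - opA₁ h u).1 s = 0) ∧
      (laxOp h (fun j => w j u) - opA₁ h u).1 s ∈ S side := by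
    intro u s
    have h2 : (laxOp h (fun j => w j u) - opA₁ h u).1 s =
        (if s = 1 then fun _ _ => h⁻¹
          else if s ≤ 0 then h ^ (-s).toNat • (w (-s).toNat u).1 else 0) -
        ((monom (fun _ _ => h⁻¹) 1).1 s + (monom u.1 0).1 s) := rfl
    rw [h2]
    rcases eq_or_ne s 1 with rfl | h1
    · rw [if_pos rfl, monom_coeff_self, monom_coeff_of_ne _ (by norm_num), add_zero, sub_self]
      exact ⟨fun _ => rfl, Submodule.zero_mem _⟩
    rw [if_neg h1, monom_coeff_of_ne _ h1, zero_add]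
    rcases eq_or_ne s 0 with rfl | h0
    · rw [if_pos le_rfl, monom_coeff_self]
      simp [hw.1 u]
    rw [monom_coeff_of_ne _ h0, sub_zero]
    split_ifs with h3
    · exact ⟨fun h4 => absurd h4 (by omega), Submodule.smul_mem _ _ (w _ u).2⟩
    · exact ⟨fun _ => rfl, Submodule.zero_mem _⟩
  exact ⟨fun u s => (h1 u s).2, fun u s => (h1 u s).1, fun u => sub_eq_zero.2 (hw.2 u)⟩

theorem IsLax.coeff_mem {L : S side → PsiDO} (hL : IsLax h L) (u : S side) (j : ℕ) :
    (L u).1 (-j) ∈ S side := by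
  have h1 : (L u).1 (-j) = (L u - opA₁ h u).1 (-j) + (opA₁ h u).1 (-j) := by
    change _ = (L u).1 (-j) - (opA₁ h u).1 (-j) + (opA₁ h u).1 (-j)
    rw [sub_add_cancel]
  rw [h1]
  refine Submodule.add_mem _ (hL.mem u _) ?_
  change (monom _ 1).1 (-(j : ℤ)) + (monom u.1 0).1 (-(j : ℤ)) ∈ S side
  rw [monom_coeff_of_ne _ (by omega), zero_add]
  exact monom_mem_opsIn u.2 0 _

theorem IsLax.coeff_eq {L : S side → PsiDO} (hL : IsLax h L) (u : S side) {s : ℤ} (hs : -1 < s) :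
    (L u).1 s = (opA₁ h u).1 s := sub_eq_zero.1 (hL.deg u s hs)

theorem opA₁_coeff_zero (u : S side) : (opA₁ h u).1 0 = u.1 := by
  change (monom _ 1).1 0 + (monom u.1 0).1 0 = _
  rw [monom_coeff_self, monom_coeff_of_ne _ (by norm_num), zero_add]

theorem exists_isLaxCoefficients (hh : h ≠ 0) :
    ∃ w : ℕ → S side → S side, IsLaxCoefficients h w := by
  obtain ⟨L, hL, -⟩ := exists_isLax (side := side) hh
  let w : ℕ → S side → S side := fun j u =>
    ⟨(h ^ j)⁻¹ • (L u).1 (-j), Submodule.smul_mem _ _ (hL.coeff_mem u j)⟩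
  have hLw : ∀ u, laxOp h (fun j => w j u) = L u := by
    intro u
    refine ext_coeff fun s => ?_
    change (if s = 1 then fun _ _ => h⁻¹
          else if s ≤ 0 then h ^ (-s).toNat • (w (-s).toNat u).1 else 0) = _
    split_ifs with h1 h0
    · rw [h1, hL.coeff_eq u (by norm_num), opA₁_coeff_one]
    · change h ^ (-s).toNat • (h ^ (-s).toNat)⁻¹ • (L u).1 (-((-s).toNat : ℤ)) = _
      rw [smul_smul, mul_inv_cancel₀ (pow_ne_zero _ hh), one_smul,
        Int.toNat_of_nonneg (by omega), neg_neg]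
    · rw [hL.coeff_eq u (by omega), opA₁_mem_degLE s (by omega)]
  refine ⟨w, fun u => Subtype.ext ?_, fun u => ?_⟩
  · change (h ^ 0)⁻¹ • (L u).1 (-((0 : ℕ) : ℤ)) = u.1
    rw [pow_zero, inv_one, one_smul, Nat.cast_zero, neg_zero, hL.coeff_eq u (by norm_num),
      opA₁_coeff_zero]
  · rw [hLw]
    exact sub_eq_zero.1 (hL.cov u)

theorem isLaxCoefficients_unique (hh : h ≠ 0) {w w' : ℕ → S side → S side}
    (hw : IsLaxCoefficients h w) (hw' : IsLaxCoefficients h w') : w = w' := by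
  funext j u
  refine Subtype.ext ?_
  have h1 := (isLax_of_isLaxCoefficients hw).unique hh (isLax_of_isLaxCoefficients hw') u
  have h2 := congrArg (fun P : PsiDO => P.1 (-j)) h1
  have h3 : ∀ w : ℕ → S side → S side, (laxOp h fun j => w j u).1 (-j) = h ^ j • (w j u).1 := by
    intro w
    change (if -(j : ℤ) = 1 then fun _ _ => h⁻¹
          else if -(j : ℤ) ≤ 0 then h ^ (- -(j : ℤ)).toNat • (w (- -(j : ℤ)).toNat u).1 else 0) = _
    rw [if_neg (by omega), if_pos (by omega), neg_neg, Int.toNat_natCast]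
  simp only [h3] at h2
  exact smul_right_injective _ (pow_ne_zero j hh) h2

variable {L : S side → PsiDO}

/-- By uniqueness an arbitrary solution is the constructed one, so it depends polynomially on u
although nothing was assumed about its dependence. -/
theorem IsLax.polyOps_sub (hh : h ≠ 0) (hL : IsLax h L) :
    (fun u => L u - freeLax h) ∈ polyOps side (S side) := by
  obtain ⟨L', hL', hp⟩ := exists_isLax (side := side) hh
  have : L = L' := funext fun u => hL.unique hh hL' u
  rwa [this]

theorem IsLax.polyOps (hh : h ≠ 0) (hL : IsLax h L) : L ∈ polyOps side (multipliers side) := by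
  convert Submodule.add_mem _ (polyOps_mono S_le_multipliers (hL.polyOps_sub hh))
    (const_mem_polyOps freeLax_mem) using 1
  funext u
  exact (sub_add_cancel _ _).symm

theorem IsLax.mem_degLE (hL : IsLax h L) (u : S side) : L u ∈ degLE 1 := by
  simpa using Submodule.add_mem _ (degLE_mono (by norm_num) (hL.deg u))
    (opA₁_mem_degLE (h := h) (u := u))

theorem IsLax.pow_mem_degLE (hL : IsLax h L) (u : S side) (m : ℕ) : L u ^ m ∈ degLE m := by
  induction m with
  | zero => rw [pow_zero]; exact monom_mem_degLE _ 0
  | succ m ih => rw [pow_succ]; push_cast; exact mul_mem_degLE ih (hL.mem_degLE u)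

theorem IsLax.sub_mem_degLE (hL : IsLax h L) (u : S side) : L u - freeLax h ∈ degLE 0 := by
  have h1 : L u - freeLax h = L u - opA₁ h u + monom u.1 0 := by rw [opA₁_eq]; abel
  rw [h1]
  exact Submodule.add_mem _ (degLE_mono (by norm_num) (hL.deg u)) (monom_mem_degLE _ 0)

theorem IsLax.pow_polyOps (hh : h ≠ 0) (hL : IsLax h L) (m : ℕ) :
    (fun u => L u ^ m - freeLax h ^ m) ∈ DDKP.polyOps side (S side) := by
  induction m with
  | zero =>
    simp only [pow_zero, sub_self]
    exact Submodule.zero_mem _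
  | succ m ih =>
    have hm : (fun u => L u ^ m) ∈ DDKP.polyOps side (multipliers side) := by
      convert Submodule.add_mem _ (polyOps_mono S_le_multipliers ih)
        (const_mem_polyOps (pow_mem_opsIn_multipliers freeLax_mem m)) using 1
      funext u
      exact (sub_add_cancel _ _).symm
    convert Submodule.add_mem _ (polyOps_mul_S_right hm (hL.polyOps_sub hh))
      (polyOps_mul_S_left ih (const_mem_polyOps (freeLax_mem (h := h)))) using 1
    funext u
    change _ = L u ^ m * (L u - freeLax h) + (L u ^ m - freeLax h ^ m) * freeLax h
    rw [pow_succ, pow_succ]; noncomm_ring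

theorem IsLax.pow_sub_mem_degLE (hL : IsLax h L) (u : S side) (m : ℕ) :
    L u ^ m - freeLax h ^ m ∈ degLE ((m : ℤ) - 1) := by
  induction m with
  | zero => simp
  | succ m ih =>
    have h1 : L u ^ (m + 1) - freeLax h ^ (m + 1) =
        L u ^ m * (L u - freeLax h) + (L u ^ m - freeLax h ^ m) * freeLax h := by
      rw [pow_succ, pow_succ]; noncomm_ring
    have h2 := mul_mem_degLE (hL.pow_mem_degLE u m) (hL.sub_mem_degLE u)
    have h3 := mul_mem_degLE ih (monom_mem_degLE (fun _ _ => h⁻¹) 1)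
    rw [h1]
    exact Submodule.add_mem _ (degLE_mono (by push_cast; omega) h2)
      (degLE_mono (by push_cast; omega) h3)

end Lax

/-! ### Existence of the triads -/

section Triads

variable {h : ℝ} {w : ℕ → S side → S side}

theorem IsospectralTriad.unique (hh : h ≠ 0) {m : ℕ} {A A' : S side → PsiDO}
    {K K' : S side → S side} (H : IsospectralTriad h w m A K) (H' : IsospectralTriad h w m A' K') :
    A = A' ∧ K = K' :=
  zero_curvature_unique hh (by rw [← freeLax_pow]; exact pow_mem_opsIn_multipliers freeLax_mem m)
    H.form H'.form H.zero_curvature H'.zero_curvature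

theorem NonisospectralTriad.unique (hh : h ≠ 0) {m : ℕ} (hm : 1 ≤ m) {A A' : S side → PsiDO}
    {K K' : S side → S side} (H : NonisospectralTriad h w m A K)
    (H' : NonisospectralTriad h w m A' K') : A = A' ∧ K = K' := by
  obtain ⟨m, rfl⟩ := Nat.exists_eq_add_of_le' hm
  refine zero_curvature_unique hh ?_ H.form H'.form H.zero_curvature H'.zero_curvature
  rw [← freeC_mul_freeLax_pow]
  exact mul_mem_opsIn_multipliers (freeC_mem h) (pow_mem_opsIn_multipliers freeLax_mem m)

theorem Flow.zero_curvature {P₀ : PsiDO} {P : S side → PsiDO} {K : S side → S side}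
    (H : Flow h P₀ P K) (u : S side) :
    monom (K u).1 0 - opDx (P u) + opComm (opA₁ h u) (P u) = 0 := by
  rw [← H.zero_curv, cov]; abel

theorem exists_isospectralTriad (hh : h ≠ 0) (hw : IsLaxCoefficients h w) (m : ℕ) :
    ∃ K, Flow h (freeLax h ^ m) (fun u => nonnegPart (opPow (laxOp h fun j => w j u) m)) K ∧
      IsospectralTriad h w m (fun u => nonnegPart (opPow (laxOp h fun j => w j u) m)) K := by
  have hL := isLax_of_isLaxCoefficients hw
  simp only [opPow_eq]
  set L : S side → PsiDO := fun u => laxOp h fun j => w j u with hLdef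
  have hn := pow_mem_nonneg (freeLax_mem_nonneg h) m
  have hc : ∀ u, cov h u (L u ^ m) = 0 := fun u =>
    cov_pow_eq_zero (isLax_mem_multipliers hL u) (hL.cov u) m
  obtain ⟨K, H⟩ := exists_flow (pow_mem_opsIn_multipliers freeLax_mem m) hn
    (hL.pow_polyOps hh m) hc
  refine ⟨K, H, ?_, fun u => ?_, H.zero_curvature⟩
  · rw [← freeLax_pow]
    refine H.isDeformation hh (cov_pow_eq_zero freeLax_mem (cov_zero_freeLax h) m) fun u => ?_
    have h1 := nonnegPart_mem_degLE (hL.pow_sub_mem_degLE u m)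
    rwa [nonnegPart_sub, nonnegPart_of_mem hn] at h1
  -- Here Q = L^m commutes with L, so the correction [Q, L] disappears.
  · have h1 := H.lax hh hL (hL.polyOps_sub hh) (polyOps_apply_mem (hL.pow_polyOps hh m)) hc u
    rwa [← pow_succ, ← pow_succ', sub_self, sub_zero] at h1

theorem exists_nonisospectralTriad (hh : h ≠ 0) (hw : IsLaxCoefficients h w) (m : ℕ) :
    ∃ B σ, Flow h (freeC h * freeLax h ^ m) B σ ∧ NonisospectralTriad h w (m + 1) B σ := by
  have hL := isLax_of_isLaxCoefficients hw
  obtain ⟨C, hCp, hCd, hCc⟩ := exists_dressed_freeC (side := side) hh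
  set L : S side → PsiDO := fun u => laxOp h fun j => w j u with hLdef
  have hL₀ := pow_mem_opsIn_multipliers (freeLax_mem (side := side) (h := h)) m
  have hLm : (fun u => L u ^ m) ∈ polyOps side (multipliers side) := by
    convert Submodule.add_mem _ (polyOps_mono S_le_multipliers (hL.pow_polyOps hh m))
      (const_mem_polyOps hL₀) using 1
    funext u
    exact (sub_add_cancel _ _).symm
  have hn := mul_mem_nonneg (freeC_mem_nonneg h) (pow_mem_nonneg (freeLax_mem_nonneg h) m)
  have hsub : ∀ u, C u * L u ^ m - freeC h * freeLax h ^ m =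
      (C u - freeC h) * L u ^ m + freeC h * (L u ^ m - freeLax h ^ m) := fun u => by noncomm_ring
  have hQp : (fun u => C u * L u ^ m - freeC h * freeLax h ^ m) ∈ polyOps side (S side) := by
    convert Submodule.add_mem _ (polyOps_mul_S_left hCp hLm) (polyOps_mul_S_right
      (const_mem_polyOps (freeC_mem h)) (hL.pow_polyOps hh m)) using 1
    exact funext hsub
  have hCm : ∀ u, C u ∈ opsIn (multipliers side) := fun u =>
    mem_multipliers_of_sub (freeC_mem h) (polyOps_apply_mem hCp u)
  have hc : ∀ u, cov h u (C u * L u ^ m) = 0 := fun u => by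
    have hLu := isLax_mem_multipliers hL u
    rw [cov_mul (hCm u) (pow_mem_opsIn_multipliers hLu m), hCc,
      cov_pow_eq_zero hLu (hL.cov u), zero_mul, mul_zero, add_zero]
  obtain ⟨σ, H⟩ := exists_flow (mul_mem_opsIn_multipliers (freeC_mem h) hL₀) hn hQp hc
  refine ⟨_, σ, H, ?_, fun u => ?_, H.zero_curvature⟩
  · rw [← freeC_mul_freeLax_pow]
    refine H.isDeformation hh (cov_zero_freeC_mul hh m) fun u => ?_
    have h1 : C u * L u ^ m - freeC h * freeLax h ^ m ∈ degLE (((m + 1 + 1 : ℕ) : ℤ) - 1) := by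
      rw [hsub]
      exact Submodule.add_mem _
        (degLE_mono (by push_cast; omega) (mul_mem_degLE (hCd u) (hL.pow_mem_degLE u m)))
        (degLE_mono (by push_cast; omega)
          (mul_mem_degLE (freeC_mem_degLE h) (hL.pow_sub_mem_degLE u m)))
    have h2 := nonnegPart_mem_degLE h1
    rwa [nonnegPart_sub, nonnegPart_of_mem hn] at h2
  · have h1 := H.lax hh hL (hL.polyOps_sub hh) (polyOps_apply_mem hQp) hc u
    have h2 := dressed_comm hh (polyOps_apply_mem hCp u) (polyOps_apply_mem (hL.polyOps_sub hh) u)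
      (hCc u) (hL.cov u)
    -- [C L^m, L] = [C, L] L^m; this is the term accounting for η_t.
    have h3 : C u * L u ^ m * L u - L u * (C u * L u ^ m) = -(h • L u ^ (m + 1) + L u ^ m) := by
      have h4 : C u * L u ^ m * L u - L u * (C u * L u ^ m) = (C u * L u - L u * C u) * L u ^ m := by
        rw [mul_assoc (C u), ← pow_succ, pow_succ']; noncomm_ring
      rw [h4, h2, neg_mul, add_mul, one_mul, smul_mul_assoc, ← pow_succ']
    rw [h3, sub_neg_eq_add, ← add_assoc] at h1
    rw [opPow_eq, opPow_eq, Nat.add_sub_cancel]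
    exact h1

/-- The identity operator has zero flow, which makes the convention K̄_0 = 0 the case m = 0 of the
flows of L^m. -/
theorem Flow.one : Flow h 1 (fun _ : S side => 1) 0 where
  free_mem := one_mem
  free_nonneg := monom_mem_nonneg 1 le_rfl
  op_nonneg _ := monom_mem_nonneg 1 le_rfl
  poly := by simp only [sub_self]; exact Submodule.zero_mem _
  flow_poly := Submodule.zero_mem _
  zero_curv u := by
    have h1 : monom 0 0 = 0 := by simpa using monom_smul 0 0 0
    exact cov_one.trans h1.symm

end Triads

/-! ### The algebra of flows -/

section Algebra

variable {h : ℝ} {K τ : ℕ → S side → S side}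

theorem lieProd_isospectral (hh : h ≠ 0) (hK : ∀ m, ∃ P, Flow h (freeLax h ^ m) P (K m))
    (a b : ℕ) : lieProd (K a) (K b) = 0 := by
  obtain ⟨P, H⟩ := hK a
  obtain ⟨P', H'⟩ := hK b
  refine H.lieProd_eq hh H' Flow.zero ?_
  rw [(Commute.pow_pow_self (freeLax h) a b).eq, sub_self]

theorem lieProd_isospectral_nonisospectral (hh : h ≠ 0)
    (hK : ∀ m, ∃ P, Flow h (freeLax h ^ m) P (K m))
    (hτ : ∀ m, ∃ P, Flow h (freeC h * freeLax h ^ m) P (τ m)) (a b : ℕ) :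
    lieProd (K a) (τ b) = (a : ℝ) • (h • K (a + b) + K (a + b - 1)) := by
  obtain ⟨P, H⟩ := hK a
  obtain ⟨P', H'⟩ := hτ b
  obtain ⟨P₁, H₁⟩ := hK (a + b)
  obtain ⟨P₂, H₂⟩ := hK (a + b - 1)
  exact H.lieProd_eq hh H' (((H₁.smul h).add H₂).smul a) (freeLax_pow_comm hh a b)

theorem lieProd_nonisospectral (hh : h ≠ 0)
    (hτ : ∀ m, ∃ P, Flow h (freeC h * freeLax h ^ m) P (τ m)) (a b : ℕ) :
    lieProd (τ a) (τ b) = ((a : ℝ) - b) • (h • τ (a + b) + τ (a + b - 1)) := by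
  obtain ⟨P, H⟩ := hτ a
  obtain ⟨P', H'⟩ := hτ b
  obtain ⟨P₁, H₁⟩ := hτ (a + b)
  obtain ⟨P₂, H₂⟩ := hτ (a + b - 1)
  exact H.lieProd_eq hh H' (((H₁.smul h).add H₂).smul _) (freeC_pow_comm hh a b)

end Algebra

end DDKP

end

open DDKP
theorem mainTheorem1 (h : ℝ) (hh : h ≠ 0) (side : ℤˣ) :
    -- the relation `L_x = [A₁, L]` determines `L` as a functional of `u`
    (∃! w : ℕ → S side → S side, IsLaxCoefficients h w) ∧
    ∀ w : ℕ → S side → S side, IsLaxCoefficients h w →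
      -- the Lax triads determine the operators `A_m`, `B_m` and the flows `K_m`, `σ_m`
      (∀ m : ℕ, 1 ≤ m → ∃! AK : (S side → PsiDO) × (S side → S side),
        IsospectralTriad h w m AK.1 AK.2) ∧
      (∀ (m : ℕ) (A : S side → PsiDO) (K : S side → S side), 1 ≤ m →
        IsospectralTriad h w m A K → ∀ u, A u = nonnegPart (opPow (laxOp h fun j => w j u) m)) ∧
      (∀ m : ℕ, 1 ≤ m → ∃! Bσ : (S side → PsiDO) × (S side → S side),
        NonisospectralTriad h w m Bσ.1 Bσ.2) ∧
      -- the algebra of these flows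
      ∀ K σ : ℕ → S side → S side, K 0 = 0 → σ 0 = 0 →
        (∀ m, 1 ≤ m → ∃ A, IsospectralTriad h w m A (K m)) →
        (∀ m, 1 ≤ m → ∃ B, NonisospectralTriad h w m B (σ m)) →
        (∀ m, K m 0 = 0 ∧ GateauxDifferentiable (K m)) ∧
        (∀ m, σ m 0 = 0 ∧ GateauxDifferentiable (σ m)) ∧
        IsLieAlgebraUnder lieProd (Submodule.span ℝ (Set.range K ∪ Set.range σ)) ∧
        (∀ l r : ℕ, 1 ≤ l → 1 ≤ r → lieProd (K l) (K r) = 0) ∧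
        (∀ l r : ℕ, 1 ≤ l → 1 ≤ r →
          lieProd (K l) (σ r) = (l : ℝ) • (h • K (l + r - 1) + K (l + r - 2))) ∧
        (∀ l r : ℕ, 1 ≤ l → 1 ≤ r →
          lieProd (σ l) (σ r) = ((l : ℝ) - (r : ℝ)) • (h • σ (l + r - 1) + σ (l + r - 2))) := by
  obtain ⟨w₀, hw₀⟩ := exists_isLaxCoefficients (side := side) hh
  refine ⟨⟨w₀, hw₀, fun w hw => isLaxCoefficients_unique hh hw hw₀⟩, fun w hw =>
    ⟨fun m _ => ?_, fun m A K _ HA u => ?_, fun m hm => ?_, fun K σ hK0 hσ0 hK hσ => ?_⟩⟩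
  · obtain ⟨K, -, H⟩ := exists_isospectralTriad hh hw m
    exact ⟨(_, K), H, fun AK HAK => Prod.ext (HAK.unique hh H).1 (HAK.unique hh H).2⟩
  · obtain ⟨K', -, H⟩ := exists_isospectralTriad hh hw m
    exact congrFun (HA.unique hh H).1 u
  · obtain ⟨m, rfl⟩ := Nat.exists_eq_add_of_le' hm
    obtain ⟨B, σ, -, H⟩ := exists_nonisospectralTriad hh hw m
    exact ⟨(B, σ), H, fun Bσ HBσ => Prod.ext (HBσ.unique hh hm H).1 (HBσ.unique hh hm H).2⟩
  · have hKf : ∀ m, ∃ P, Flow h (freeLax h ^ m) P (K m) := by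
      intro m
      rcases m with _ | m
      · rw [pow_zero, hK0]; exact ⟨_, Flow.one⟩
      · obtain ⟨A, HA⟩ := hK (m + 1) (by omega)
        obtain ⟨K', HF, H⟩ := exists_isospectralTriad hh hw (m + 1)
        rw [(HA.unique hh H).2]
        exact ⟨_, HF⟩
    -- The index moves by one: σ_(m+1) belongs to (xE + hn)(h⁻¹Δ)^m.
    have hσf : ∀ m, ∃ P, Flow h (freeC h * freeLax h ^ m) P (σ (m + 1)) := by
      intro m
      obtain ⟨B, HB⟩ := hσ (m + 1) (by omega)
      obtain ⟨B', σ', HF, H⟩ := exists_nonisospectralTriad hh hw m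
      rw [(HB.unique hh (by omega) H).2]
      exact ⟨_, HF⟩
    have hKp : ∀ m, K m ∈ polyFields side := fun m => (hKf m).choose_spec.flow_poly
    have hσp : ∀ m, σ (m + 1) ∈ polyFields side := fun m => (hσf m).choose_spec.flow_poly
    have hKK := lieProd_isospectral hh hKf
    have hKσ := lieProd_isospectral_nonisospectral hh hKf hσf
    have hσσ := lieProd_nonisospectral hh hσf
    refine ⟨fun m => ⟨?_, gateauxDifferentiable_of_mem (hKp m)⟩, fun m => ?_, ?_,
      fun l r _ _ => hKK l r, fun l r _ hr => ?_, fun l r hl hr => ?_⟩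
    · obtain ⟨P, HF⟩ := hKf m
      exact (HF.apply_zero hh (cov_pow_eq_zero freeLax_mem (cov_zero_freeLax h) m)).2
    · rcases m with _ | m
      · rw [hσ0]; exact ⟨rfl, gateauxDifferentiable_of_mem (Submodule.zero_mem _)⟩
      · obtain ⟨P, HF⟩ := hσf m
        exact ⟨(HF.apply_zero hh (cov_zero_freeC_mul hh m)).2,
          gateauxDifferentiable_of_mem (hσp m)⟩
    · rw [← range_modelMap hσ0]
      exact isLieAlgebraUnder_range (lieProd_modelMap hKp hσp hKK hKσ hσσ)
    · obtain ⟨b, rfl⟩ := Nat.exists_eq_add_of_le' hr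
      exact hKσ l b
    · obtain ⟨a, rfl⟩ := Nat.exists_eq_add_of_le' hl
      obtain ⟨b, rfl⟩ := Nat.exists_eq_add_of_le' hr
      rw [hσσ a b]
      push_cast
      rw [add_sub_add_right_eq_sub]
      have h1 : a + 1 + (b + 1) - 1 = a + b + 1 := by omega
      rw [h1]
      -- For l = r = 1 the truncated index of the last term does not match l + r - 2, but the
      -- coefficient l - r is zero.
      rcases Nat.eq_zero_or_pos (a + b) with h0 | h0
      · obtain ⟨rfl, rfl⟩ : a = 0 ∧ b = 0 := by omega
        simp
      · have h2 : a + 1 + (b + 1) - 2 = a + b - 1 + 1 := by omega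
        rw [h2]
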